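/- Let $\kappa\ge 1$. For $\sigma,\tau\in\{1,\dots,\kappa\}^N$ let $R(\sigma,\tau)=\bigl(\frac1N\sum_{i\le N}\mathbf 1(\sigma_i=k)\mathbf 1(\tau_i=k')\bigr)_{k,k'\le\kappa}$ be their overlap matrix; $A^{\circ p}$ denotes the entrywise $p$-th power of a matrix $A$. Let $\Theta$ be the countable set of all $\theta=(p,m,n_1,\dots,n_m,\lambda^1,\dots,\lambda^m)$ with integers $p,m,n_1,\dots,n_m\ge1$ and $\lambda^j\in([-1,1]\cap\mathbb Q)^\kappa$. For $\theta\in\Theta$ put $$C^\theta(A)=\prod_{j\le m}\bigl(A^{\circ p}\lambda^j,\lambda^j\bigr)^{n_j},\qquad h_\theta(\sigma)=N^{-p(n_1+\dots+n_m)/2}\sum_{I_1,\dots,I_m}g^\theta_{I_1,\dots,I_m}\prod_{j\le m}\prod_{a\le n_j}S_{\lambda^j}(\sigma_{e_{j,a}}),$$ where $I_j=(e_{j,1},\dots,e_{j,n_j})$ runs over $(\{1,\dots,N\}^p)^{n_j}$ and $S_\lambda(\sigma_e)=\sum_{k\le\kappa}\lambda_k\prod_{r\le p}\mathbf 1(\sigma_{i_r}=k)$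 for $e=(i_1,\dots,i_p)$. Fix an injection $j_0:([-1,1]\cap\mathbb Q)^\kappa\to\mathbb N$, let $j(\theta)=p+\sum_j n_j+\sum_j j_0(\lambda^j)+4m$, fix $\gamma\in(1/4,1/2)$, and for $u=(u_\theta)_{\theta\in\Theta}\in[1,2]^\Theta$ let $$H_N^{\mathrm{pert}}(\sigma)=\frac1{\sqrt N}\sum_{i,j\le N}g_{ij}\mathbf 1(\sigma_i=\sigma_j)+N^{\gamma}\sum_{\theta\in\Theta}2^{-j(\theta)}u_\theta h_\theta(\sigma),$$ where all $g_{ij}$ and $g^\theta_{I_1,\dots,I_m}$ are independent standard Gaussian variables. For every $N$ let $d^N$ be a vector of proportions, $d^N_k\ge0$, $\sum_kd^N_k=1$, such that the set $\Sigma(d^N)$ of all $\sigma\in\{1,\dots,\kappa\}^N$ with exactly $Nd^N_k$ coordinates equal to $k$, for all $k$, is not empty. Let $G_N$ be the random probability measure on $\Sigma(d^N)$ proportional to $\exp H_N^{\mathrm{pert}}(\sigma)$, let $(\sigma^\ell)_{\ell\ge1}$ be i.i.d. samples from $G_N$, let $\langle\cdot\rangle$ be the average over them and $\mathbb E$ the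 expectation over the Gaussian variables, and let $R_{\ell,\ell'}=R(\sigma^\ell,\sigma^{\ell'})$ and $R^n=(R_{\ell,\ell'})_{\ell,\ell'\le n}$. A non-random sequence $(u^N)_N$ in $[1,2]^\Theta$ is called admissible if, for $u=u^N$, for all $n\ge2$, all bounded measurable $f=f(R^n)$ and all $\theta\in\Theta$, $$\lim_{N\to\infty}\Bigl|\mathbb E\langle fC^\theta(R_{1,n+1})\rangle-\frac1n\mathbb E\langle f\rangle\,\mathbb E\langle C^\theta(R_{1,2})\rangle-\frac1n\sum_{\ell=2}^n\mathbb E\langle fC^\theta(R_{1,\ell})\rangle\Bigr|=0.$$ Then admissible sequences exist. Moreover, for every admissible sequence $(u^N)$ and every subsequence $(N_k)$ along which the array $(R_{\ell,\ell'})_{\ell,\ell'\ge1}$ under $\mathbb E G_N^{\otimes\infty}$ (with $u=u^N$) converges in distribution to a random array, denoted again by $(R_{\ell,\ell'})_{\ell,\ell'\ge1}$, the limiting array satisfies the following. For all $p\ge1$, $m\ge1$, $\lambda^1,\dots,\lambda^m\in[-1,1]^\kappa$ and every bounded measurable $\varphi:\mathbb R^m\to\mathbb R$, put $$Q_{\ell,\ell'}=\varphi\bigl((R_{\ell,\ell'}^{\circ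 p}\lambda^1,\lambda^1),\dots,(R_{\ell,\ell'}^{\circ p}\lambda^m,\lambda^m)\bigr).$$ Then, for every $n\ge2$ and every bounded measurable function $f=f(R^n)$, $$\mathbb E f(R^n)Q_{1,n+1}=\frac1n\,\mathbb E f(R^n)\,\mathbb E Q_{1,2}+\frac1n\sum_{\ell=2}^n\mathbb E f(R^n)Q_{1,\ell}.$$ -/

import Mathlib

open MeasureTheory ProbabilityTheory Filter Topology

noncomputable section

namespace Potts

/-- Spin configurations: `N` spins, each in one of `κ` states. -/
abbrev Config (κ N : ℕ) := Fin N → Fin κ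

/-- `κ × κ` real matrices, as functions of two indices (with the product topology and
σ-algebra). -/
abbrev Mat (κ : ℕ) := Fin κ → Fin κ → ℝ

/-- Infinite arrays of `κ × κ` matrices, indexed by pairs of replicas.  The replicas are numbered
from `0`. -/
abbrev OverlapArray (κ : ℕ) := ℕ → ℕ → Mat κ

/-- The overlap matrix of two configurations. -/
def overlap {κ N : ℕ} (σ τ : Config κ N) : Mat κ :=
  fun k k' => (1 / (N : ℝ)) * ∑ i, (if σ i = k then 1 else 0) * (if τ i = k' then 1 else 0)

/-- The array of all overlap matrices of a sequence of replicas. -/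
def overlapArray {κ N : ℕ} (s : ℕ → Config κ N) : OverlapArray κ :=
  fun l l' => overlap (s l) (s l')

/-- The block of an array that corresponds to the first `n` replicas. -/
def block {κ : ℕ} (n : ℕ) (R : OverlapArray κ) : Fin n → Fin n → Mat κ :=
  fun l l' => R l l'

/-- The quadratic form `(A^{∘p} x, x)` of the `p`-th Hadamard (entrywise) power of `A`. -/
def hadamardForm {κ : ℕ} (p : ℕ) (A : Mat κ) (x : Fin κ → ℝ) : ℝ :=
  ∑ k, ∑ k', (A k k') ^ p * x k * x k'

/-- Configurations in which a proportion `d k` of the spins is in state `k`, for all `k`. -/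
def stateSet {κ : ℕ} (N : ℕ) (d : Fin κ → ℝ) : Set (Config κ N) :=
  {σ | ∀ k, (∑ i, if σ i = k then (1 : ℝ) else 0) = N * d k}

/-- The proportions of states that are realized by some configuration of `N` spins. -/
def stateSizes (κ N : ℕ) : Set (Fin κ → ℝ) :=
  {d | d ∈ stdSimplex ℝ (Fin κ) ∧ (stateSet N d).Nonempty}

/-- Vectors with rational coordinates in `[-1, 1]`. -/
abbrev RatVec (κ : ℕ) := Fin κ → Set.Icc (-1 : ℚ) 1

/-- The parameters `(p, m, n_1, …, n_m, λ^1, …, λ^m)` of the perturbation terms. -/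
structure Theta (κ : ℕ) where
  p : ℕ
  m : ℕ
  n : Fin m → ℕ
  lam : Fin m → RatVec κ
  one_le_p : 1 ≤ p
  one_le_m : 1 ≤ m
  one_le_n : ∀ j, 1 ≤ n j

instance (κ : ℕ) : Countable (Theta κ) := by
  let F : Theta κ → ℕ × (Σ m : ℕ, (Fin m → ℕ) × (Fin m → RatVec κ)) :=
    fun θ => (θ.p, ⟨θ.m, θ.n, θ.lam⟩)
  refine Function.Injective.countable (f := F) ?_
  rintro ⟨p, m, n, lam, _, _, _⟩ ⟨p', m', n', lam', _, _, _⟩ h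
  simp only [F, Prod.mk.injEq, Sigma.mk.injEq] at h
  obtain ⟨rfl, rfl, h⟩ := h
  simp only [heq_eq_eq, Prod.mk.injEq] at h
  obtain ⟨rfl, rfl⟩ := h
  rfl

/-- The real vector `λ^j` of `θ`. -/
def Theta.vec {κ : ℕ} (θ : Theta κ) (j : Fin θ.m) : Fin κ → ℝ :=
  fun k => ((θ.lam j k : ℚ) : ℝ)

/-- Lists `(I_1, …, I_m)`, where `I_j` consists of `n_j` elements of `{1, …, N}^p`. -/
abbrev Theta.Idx {κ : ℕ} (θ : Theta κ) (N : ℕ) :=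
  (j : Fin θ.m) → Fin (θ.n j) → Fin θ.p → Fin N

/-- `S_λ(σ_e)` for `e ∈ {1, …, N}^p`. -/
def spinSum {κ N p : ℕ} (lam : Fin κ → ℝ) (σ : Config κ N) (e : Fin p → Fin N) : ℝ :=
  ∑ k, lam k * ∏ r, if σ (e r) = k then (1 : ℝ) else 0

/-- Indices of the Gaussian disorder: the pairs `(i, j)` of the Potts Hamiltonian, and, for every
`θ`, the indices of the perturbation term with parameters `θ`. -/
abbrev DisorderIdx (κ N : ℕ) := (Fin N × Fin N) ⊕ (Σ θ : Theta κ, θ.Idx N)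

/-- The disorder consists of independent standard Gaussian random variables. -/
def disorderLaw (κ N : ℕ) : Measure (DisorderIdx κ N → ℝ) :=
  Measure.infinitePi fun _ => gaussianReal 0 1

/-- The Hamiltonian of the Potts spin glass. -/
def pottsH {κ N : ℕ} (g : DisorderIdx κ N → ℝ) (σ : Config κ N) : ℝ :=
  (1 / √(N : ℝ)) * ∑ i, ∑ j, g (.inl (i, j)) * if σ i = σ j then 1 else 0

/-- The perturbation term with parameters `θ`. -/
def thetaH {κ N : ℕ} (g : DisorderIdx κ N → ℝ) (θ : Theta κ) (σ : Config κ N) : ℝ :=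
  (1 / √((N : ℝ) ^ (θ.p * ∑ j, θ.n j))) *
    ∑ I : θ.Idx N, g (.inr ⟨θ, I⟩) * ∏ j, ∏ a, spinSum (θ.vec j) σ (I j a)

/-- The exponent `j(θ) = p + n_1 + … + n_m + j_0(λ^1) + … + j_0(λ^m) + 4m`. -/
def Theta.exponent {κ : ℕ} (j₀ : RatVec κ → ℕ) (θ : Theta κ) : ℕ :=
  θ.p + ∑ j, θ.n j + ∑ j, j₀ (θ.lam j) + 4 * θ.m

/-- The perturbation Hamiltonian; for injective `j₀` and `u` with values in `[1, 2]` the series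
converges absolutely for almost all `g`. -/
def perturbH {κ N : ℕ} (j₀ : RatVec κ → ℕ) (u : Theta κ → ℝ) (g : DisorderIdx κ N → ℝ)
    (σ : Config κ N) : ℝ :=
  ∑' θ : Theta κ, (2 : ℝ)⁻¹ ^ (θ.exponent j₀) * u θ * thetaH g θ σ

/-- The perturbed Hamiltonian `H_N + N^γ h_N`. -/
def perturbedH {κ N : ℕ} (γ : ℝ) (j₀ : RatVec κ → ℕ) (u : Theta κ → ℝ)
    (g : DisorderIdx κ N → ℝ) (σ : Config κ N) : ℝ :=
  pottsH g σ + (N : ℝ) ^ γ * perturbH j₀ u g σ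

open Classical in
/-- The partition function over the configurations with state sizes `d`. -/
def partitionZ {κ N : ℕ} (γ : ℝ) (j₀ : RatVec κ → ℕ) (u : Theta κ → ℝ) (d : Fin κ → ℝ)
    (g : DisorderIdx κ N → ℝ) : ℝ :=
  ∑ σ : Config κ N, if σ ∈ stateSet N d then Real.exp (perturbedH γ j₀ u g σ) else 0

open Classical in
/-- The Gibbs weights of configurations, restricted to state sizes `d`. -/
def gibbsWeight {κ N : ℕ} (γ : ℝ) (j₀ : RatVec κ → ℕ) (u : Theta κ → ℝ) (d : Fin κ → ℝ)
    (g : DisorderIdx κ N → ℝ) (σ : Config κ N) : ℝ :=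
  if σ ∈ stateSet N d then Real.exp (perturbedH γ j₀ u g σ) / partitionZ γ j₀ u d g else 0

/-- The (random) Gibbs measure on the configurations with state sizes `d`. -/
def gibbs {κ N : ℕ} (γ : ℝ) (j₀ : RatVec κ → ℕ) (u : Theta κ → ℝ) (d : Fin κ → ℝ)
    (g : DisorderIdx κ N → ℝ) : Measure (Config κ N) :=
  ∑ σ : Config κ N, ENNReal.ofReal (gibbsWeight γ j₀ u d g σ) • Measure.dirac σ

section Gibbs

variable {κ N : ℕ} (γ : ℝ) (j₀ : RatVec κ → ℕ) (u : Theta κ → ℝ)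

theorem partitionZ_pos (d : stateSizes κ N) (g : DisorderIdx κ N → ℝ) :
    0 < partitionZ γ j₀ u d g := by
  classical
  obtain ⟨σ, hσ⟩ := d.2.2
  refine Finset.sum_pos' (fun τ _ => ?_) ⟨σ, Finset.mem_univ _, ?_⟩
  · split_ifs <;> positivity
  · rw [if_pos hσ]
    positivity

theorem gibbsWeight_nonneg (d : stateSizes κ N) (g : DisorderIdx κ N → ℝ) (σ : Config κ N) :
    0 ≤ gibbsWeight γ j₀ u d g σ := by
  have := partitionZ_pos γ j₀ u d g
  unfold gibbsWeight
  split_ifs <;> positivity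

instance (d : stateSizes κ N) (g : DisorderIdx κ N → ℝ) :
    IsProbabilityMeasure (gibbs γ j₀ u d g) := by
  classical
  constructor
  have h : ∑ σ, gibbsWeight γ j₀ u d g σ = 1 := by
    have hZ := partitionZ_pos γ j₀ u d g
    rw [← div_self hZ.ne']
    conv_rhs => rw [partitionZ, Finset.sum_div]
    refine Finset.sum_congr rfl fun σ _ => ?_
    unfold gibbsWeight
    split_ifs <;> simp [partitionZ]
  simp only [gibbs, Measure.finsetSum_apply, Measure.smul_apply, measure_univ, smul_eq_mul,
    mul_one]
  rw [← ENNReal.ofReal_sum_of_nonneg fun σ _ => gibbsWeight_nonneg γ j₀ u d g σ, h,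
    ENNReal.ofReal_one]

theorem measurable_perturbedH (σ : Config κ N) :
    Measurable fun g : DisorderIdx κ N → ℝ => perturbedH γ j₀ u g σ := by
  have h : Measurable fun g : DisorderIdx κ N → ℝ => perturbH j₀ u g σ := by
    unfold perturbH
    refine Measurable.tsum fun θ => ?_
    unfold thetaH
    fun_prop
  unfold perturbedH pottsH
  fun_prop

theorem measurable_gibbsWeight (d : Fin κ → ℝ) (σ : Config κ N) :
    Measurable fun g : DisorderIdx κ N → ℝ => gibbsWeight γ j₀ u d g σ := by
  classical
  have hH := measurable_perturbedH (N := N) γ j₀ u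
  have hZ : Measurable fun g : DisorderIdx κ N → ℝ => partitionZ γ j₀ u d g := by
    unfold partitionZ
    refine Finset.measurable_sum _ fun τ _ => ?_
    split_ifs
    · exact (hH τ).exp
    · fun_prop
  unfold gibbsWeight
  split_ifs
  · exact (hH σ).exp.div hZ
  · fun_prop

theorem measurable_gibbs_apply (d : Fin κ → ℝ) (A : Set (Config κ N)) :
    Measurable fun g : DisorderIdx κ N → ℝ => gibbs γ j₀ u d g A := by
  simp only [gibbs, Measure.finsetSum_apply, Measure.smul_apply, smul_eq_mul]
  exact Finset.measurable_sum _ fun σ _ =>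
    ((measurable_gibbsWeight γ j₀ u d σ).ennreal_ofReal).mul_const _

theorem measurable_replicas (d : stateSizes κ N) :
    Measurable fun g : DisorderIdx κ N → ℝ =>
      Measure.infinitePi fun _ : ℕ => gibbs γ j₀ u d g := by
  refine Measurable.measure_of_isPiSystem_of_isProbabilityMeasure
    generateFrom_measurableCylinders.symm isPiSystem_measurableCylinders ?_
  intro A hA
  obtain ⟨s, S, hS, rfl⟩ := (mem_measurableCylinders A).1 hA
  have key : Measurable fun g : DisorderIdx κ N → ℝ =>
      Measure.pi fun _ : s => gibbs γ j₀ u d g := by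
    refine Measurable.measure_of_isPiSystem_of_isProbabilityMeasure
      generateFrom_pi.symm isPiSystem_pi ?_
    rintro B ⟨t, -, rfl⟩
    simp only [Measure.pi_pi]
    exact Finset.measurable_prod _ fun i _ => measurable_gibbs_apply γ j₀ u d _
  have h : ∀ g : DisorderIdx κ N → ℝ,
      (Measure.infinitePi fun _ : ℕ => gibbs γ j₀ u d g) (cylinder s S) =
        (Measure.pi fun _ : s => gibbs γ j₀ u d g) S :=
    fun g => Measure.infinitePi_cylinder _ hS
  simp only [h]
  exact (Measure.measurable_coe hS).comp key

end Gibbs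

/-- The averaged law `𝔼 G^{⊗∞}` of an infinite sequence of replicas: independent samples from
the Gibbs measure with state sizes `d`, averaged over the Gaussian disorder. -/
def replicaLaw {κ N : ℕ} (γ : ℝ) (j₀ : RatVec κ → ℕ) (u : Theta κ → ℝ) (d : stateSizes κ N) :
    Measure (ℕ → Config κ N) :=
  (disorderLaw κ N).bind fun g => Measure.infinitePi fun _ : ℕ => gibbs γ j₀ u d g

instance {κ N : ℕ} (γ : ℝ) (j₀ : RatVec κ → ℕ) (u : Theta κ → ℝ) (d : stateSizes κ N) :
    IsProbabilityMeasure (replicaLaw γ j₀ u d) := by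
  have : IsProbabilityMeasure (disorderLaw κ N) := by
    unfold disorderLaw
    infer_instance
  exact isProbabilityMeasure_bind (measurable_replicas γ j₀ u d).aemeasurable
    (.of_forall fun g => inferInstance)

/-- The function `C^θ` of an overlap matrix. -/
def covTheta {κ : ℕ} (θ : Theta κ) (A : Mat κ) : ℝ :=
  ∏ j, hadamardForm θ.p A (θ.vec j) ^ θ.n j

/-- The defect in the Ghirlanda–Guerra identity for the function `C^θ` and a test function `f` of
the overlaps of `n` replicas (numbered from `0`), for fixed `u`. -/
def ggDefect {κ N : ℕ} (γ : ℝ) (j₀ : RatVec κ → ℕ) (u : Theta κ → ℝ) (d : stateSizes κ N)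
    (n : ℕ) (f : (Fin n → Fin n → Mat κ) → ℝ) (θ : Theta κ) : ℝ :=
  |(∫ s, f (block n (overlapArray s)) * covTheta θ (overlapArray s 0 n) ∂replicaLaw γ j₀ u d)
    - 1 / (n : ℝ) * (∫ s, f (block n (overlapArray s)) ∂replicaLaw γ j₀ u d)
        * (∫ s, covTheta θ (overlapArray s 0 1) ∂replicaLaw γ j₀ u d)
    - 1 / (n : ℝ) * ∑ l ∈ Finset.Ico 1 n,
        ∫ s, f (block n (overlapArray s)) * covTheta θ (overlapArray s 0 l)
          ∂replicaLaw γ j₀ u d|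

/-- A non-random choice `u N ∈ [1, 2]^Θ` of the perturbation parameters for every `N` is
admissible if all the defects vanish in the limit `N → ∞`. -/
def Admissible {κ : ℕ} (γ : ℝ) (j₀ : RatVec κ → ℕ) (d : ∀ N, stateSizes κ N)
    (u : ℕ → Theta κ → ℝ) : Prop :=
  (∀ N θ, u N θ ∈ Set.Icc (1 : ℝ) 2) ∧
  ∀ (n : ℕ), 2 ≤ n → ∀ f : (Fin n → Fin n → Mat κ) → ℝ, Measurable f → (∃ K, ∀ x, |f x| ≤ K) →
    ∀ θ : Theta κ, Tendsto (fun N => ggDefect γ j₀ (u N) (d N) n f θ) atTop (𝓝 0)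

end Potts

end

/-! The perturbation is built so that h_θ has covariance C^θ of the overlap matrix. If h_θ, measured
on its own scale, concentrates around its mean E⟨h_θ⟩, then E⟨f h_θ(σ^1)⟩ - E⟨f⟩E⟨h_θ⟩ is small on
that scale. Gaussian integration by parts (`integral_repAvg_mul_thetaH`) identifies this difference,
up to sign, with the Ghirlanda–Guerra defect for C^θ times n N^γ 2^{-j(θ)} u_θ, which gives
`ggDefect_le`. Fixed state sizes enter here: they make R_{1,1} the deterministic matrix diag(d^N),
so the self-overlap terms cancel.

Concentration comes from convexity. As a function of u_θ, log Z is convex; its derivative is the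
Gibbs mean of the scaled h_θ and its second derivative is the Gibbs variance. Integrated over u_θ in
(1, 2], the thermal fluctuations are bounded by an increment of the first derivative, and the
fluctuations of the Gibbs mean by those of log Z (`lintegral_gAvg_abs_sub_mean_le`). An Efron–Stein
argument bounds the latter by order √N (`integral_abs_freeEnergy_sub_le`), where γ ≤ 1/2 is used.
The resulting relative error has order N^{1/4-γ}, and it vanishes because γ > 1/4. Averaging over
independent uniform parameters, with summable weights over the countably many θ, yields one choice
of u that serves all θ at once (`exists_relDev_le`).

For continuous f the identities for C^θ pass to the limit array. With all n_j = 1 and repetitions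
among the λ^j they cover every monomial in the quadratic forms, for rational vectors and, by
density, for real ones. The identities then say that the law of R^n together with the forms of
R_{1,n+1} has the same mixed moments as an explicit mixture: weight 1/n for an independent copy of
the forms of R_{1,2}, and 1/n for the forms of each R_{1,l}, 2 ≤ l ≤ n. The forms are bounded, so
these moments determine the measure (`ext_of_integral_mul_prod`), and equal measures integrate all
bounded measurable f and φ alike. -/

noncomputable section

namespace Potts

/-! ### Finite Gibbs measures: Jensen's inequality and derivatives along a tilt. -/

section Tilt

variable {X : Type*} [Fintype X]

/-- The partition function of the energies `H` with respect to the reference weights `e`. -/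
def gZ (e H : X → ℝ) : ℝ := ∑ x, e x * Real.exp (H x)

/-- The normalized Gibbs weights of the energies `H` with reference weights `e`. -/
def gW (e H : X → ℝ) (x : X) : ℝ := e x * Real.exp (H x) / gZ e H

/-- The Gibbs average of `f`. -/
def gAvg (e H f : X → ℝ) : ℝ := ∑ x, gW e H x * f x

/-- Nonnegative reference weights that do not vanish identically. -/
structure IsRef (e : X → ℝ) : Prop where
  nonneg : ∀ x, 0 ≤ e x
  exists_pos : ∃ x, 0 < e x

variable {e : X → ℝ} (he : IsRef e)
include he

theorem gZ_pos (H : X → ℝ) : 0 < gZ e H := by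
  obtain ⟨x, hx⟩ := he.exists_pos
  refine Finset.sum_pos' (fun y _ => mul_nonneg (he.nonneg y) (Real.exp_pos _).le)
    ⟨x, Finset.mem_univ _, by positivity⟩

theorem gW_nonneg (H : X → ℝ) (x : X) : 0 ≤ gW e H x :=
  div_nonneg (mul_nonneg (he.nonneg x) (Real.exp_pos _).le) (gZ_pos he H).le

theorem sum_gW (H : X → ℝ) : ∑ x, gW e H x = 1 := by
  unfold gW
  rw [← Finset.sum_div]
  exact div_self (gZ_pos he H).ne'

theorem gW_le_one (H : X → ℝ) (x : X) : gW e H x ≤ 1 := by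
  rw [← sum_gW he H]
  exact Finset.single_le_sum (fun y _ => gW_nonneg he H y) (Finset.mem_univ x)

theorem abs_gAvg_le (H f : X → ℝ) {B : ℝ} (hf : ∀ x, |f x| ≤ B) : |gAvg e H f| ≤ B := by
  calc |gAvg e H f| ≤ ∑ x, |gW e H x * f x| := Finset.abs_sum_le_sum_abs _ _
    _ ≤ ∑ x, gW e H x * B := Finset.sum_le_sum fun x _ => by
        rw [abs_mul, abs_of_nonneg (gW_nonneg he H x)]
        exact mul_le_mul_of_nonneg_left (hf x) (gW_nonneg he H x)
    _ = B := by rw [← Finset.sum_mul, sum_gW he, one_mul]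

theorem abs_gAvg_le_sum (H f : X → ℝ) : |gAvg e H f| ≤ ∑ x, |f x| :=
  abs_gAvg_le he H f fun x =>
    Finset.single_le_sum (f := fun x => |f x|) (fun y _ => abs_nonneg (f y)) (Finset.mem_univ x)

/-- Jensen's inequality for the logarithm of the partition function. -/
theorem gAvg_sub_le_log_gZ_sub (H H' : X → ℝ) :
    gAvg e H (fun x => H' x - H x) ≤ Real.log (gZ e H') - Real.log (gZ e H) := by
  set m := gAvg e H (fun x => H' x - H x) with hm
  have hZ := gZ_pos he H
  rw [← Real.log_div (gZ_pos he H').ne' hZ.ne', Real.le_log_iff_exp_le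
    (div_pos (gZ_pos he H') hZ)]
  have h1 : gZ e H' / gZ e H = ∑ x, gW e H x * Real.exp (H' x - H x) := by
    unfold gW
    rw [gZ, Finset.sum_div]
    refine Finset.sum_congr rfl fun x _ => ?_
    rw [Real.exp_sub]
    field_simp
  -- The tangent line of the exponential at the mean m: its Gibbs average is exactly exp m, and it
  -- lies below the exponential.
  have h2 : ∑ x, gW e H x * (1 + (H' x - H x - m)) = 1 := by
    have : ∀ x, gW e H x * (1 + (H' x - H x - m)) =
        gW e H x * (1 - m) + gW e H x * (H' x - H x) := fun x => by ring
    simp only [this, Finset.sum_add_distrib, ← Finset.sum_mul, sum_gW he]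
    have : ∑ x, gW e H x * (H' x - H x) = m := rfl
    rw [this]; ring
  rw [h1]
  calc Real.exp m = Real.exp m * ∑ x, gW e H x * (1 + (H' x - H x - m)) := by rw [h2, mul_one]
    _ = ∑ x, gW e H x * (Real.exp m * (1 + (H' x - H x - m))) := by
        rw [Finset.mul_sum]; exact Finset.sum_congr rfl fun x _ => by ring
    _ ≤ ∑ x, gW e H x * Real.exp (H' x - H x) := Finset.sum_le_sum fun x _ => by
        refine mul_le_mul_of_nonneg_left ?_ (gW_nonneg he H x)
        have h3 : Real.exp (H' x - H x) = Real.exp m * Real.exp (H' x - H x - m) := by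
          rw [← Real.exp_add]; congr 1; ring
        rw [h3]
        refine mul_le_mul_of_nonneg_left ?_ (Real.exp_pos _).le
        linarith [Real.add_one_le_exp (H' x - H x - m)]

theorem abs_log_gZ_sub_le {H H' : X → ℝ} {B : ℝ} (hB : ∀ x, |H' x - H x| ≤ B) :
    |Real.log (gZ e H') - Real.log (gZ e H)| ≤ B := by
  rw [abs_le]
  constructor
  · exact ((abs_le.1 (abs_gAvg_le he H _ hB)).1).trans (gAvg_sub_le_log_gZ_sub he H H')
  · have h := gAvg_sub_le_log_gZ_sub he H' H
    have h' := (abs_le.1 (abs_gAvg_le he H' (fun x => H x - H' x) (B := B)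
      (fun x => by rw [abs_sub_comm]; exact hB x))).1
    linarith

/-- The weight e^{A+tc}/Z differentiates to itself times the centred direction: c comes from the
numerator and its Gibbs mean from log Z. -/
theorem hasDerivAt_gW (A c : X → ℝ) (x : X) (t : ℝ) :
    HasDerivAt (fun t => gW e (fun y => A y + t * c y) x)
      (gW e (fun y => A y + t * c y) x * (c x - gAvg e (fun y => A y + t * c y) c)) t := by
  have h1 : ∀ y, HasDerivAt (fun t => e y * Real.exp (A y + t * c y))
      (e y * Real.exp (A y + t * c y) * c y) t := fun y => by
    have : HasDerivAt (fun t => A y + t * c y) (c y) t := by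
      simpa using ((hasDerivAt_id t).mul_const (c y)).const_add (A y)
    simpa [mul_assoc] using this.exp.const_mul (e y)
  have h2 : HasDerivAt (fun t => gZ e (fun y => A y + t * c y))
      (∑ y, e y * Real.exp (A y + t * c y) * c y) t := by
    unfold gZ
    exact HasDerivAt.fun_sum fun y _ => h1 y
  have hZ := (gZ_pos he (fun y => A y + t * c y)).ne'
  have h3 := (h1 x).fun_div h2 hZ
  unfold gW at *
  refine h3.congr_deriv ?_
  have h4 : ∑ y, e y * Real.exp (A y + t * c y) * c y =
      gZ e (fun y => A y + t * c y) * gAvg e (fun y => A y + t * c y) c := by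
    unfold gAvg gW
    rw [Finset.mul_sum]
    refine Finset.sum_congr rfl fun y _ => ?_
    field_simp
  rw [h4]
  field_simp

/-- The term with the factor n, an average over one fresh replica, is the origin of the replica n+1
in the Ghirlanda–Guerra identities. -/
theorem hasDerivAt_prod_gW {n : ℕ} (A c : X → ℝ) (s : Fin n → X) (t : ℝ) :
    HasDerivAt (fun t => ∏ i, gW e (fun y => A y + t * c y) (s i))
      ((∏ i, gW e (fun y => A y + t * c y) (s i)) *
        (∑ i, c (s i) - n * gAvg e (fun y => A y + t * c y) c)) t := by
  have h := HasDerivAt.fun_finsetProd (u := Finset.univ)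
    (fun i _ => hasDerivAt_gW he A c (s i) t)
  refine h.congr_deriv ?_
  have : ∑ i, c (s i) - n * gAvg e (fun y => A y + t * c y) c =
      ∑ i, (c (s i) - gAvg e (fun y => A y + t * c y) c) := by
    simp [Finset.sum_sub_distrib]
  rw [this, Finset.mul_sum]
  refine Finset.sum_congr rfl fun i _ => ?_
  rw [smul_eq_mul, ← mul_assoc, Finset.prod_erase_mul _ _ (Finset.mem_univ i)]

theorem hasDerivAt_gAvg (A c : X → ℝ) (t : ℝ) :
    HasDerivAt (fun t => gAvg e (fun y => A y + t * c y) c)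
      (gAvg e (fun y => A y + t * c y)
        (fun x => (c x - gAvg e (fun y => A y + t * c y) c) ^ 2)) t := by
  have h := HasDerivAt.fun_sum (u := Finset.univ)
    (fun x _ => (hasDerivAt_gW he A c x t).mul_const (c x))
  refine h.congr_deriv ?_
  set m := gAvg e (fun y => A y + t * c y) c with hm
  -- Centring makes it free to replace the factor c by c - m, which completes the square.
  have h1 : ∑ x, gW e (fun y => A y + t * c y) x * (c x - m) = 0 := by
    simp only [mul_sub, Finset.sum_sub_distrib, ← Finset.sum_mul, sum_gW he]
    rw [show ∑ x, gW e (fun y => A y + t * c y) x * c x = m from rfl]; ring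
  calc _ = ∑ x, gW e (fun y => A y + t * c y) x * (c x - m) * c x
        - (∑ x, gW e (fun y => A y + t * c y) x * (c x - m)) * m := by rw [h1]; ring
    _ = _ := by
      unfold gAvg
      rw [Finset.sum_mul, ← Finset.sum_sub_distrib]
      exact Finset.sum_congr rfl fun x _ => by ring

end Tilt

/-! ### Averages over finitely many independent replicas. -/

section Replica

variable {X : Type*} [Fintype X] {e : X → ℝ} (he : IsRef e)

/-- The average of a function of `n` independent replicas. -/
def repAvg (e H : X → ℝ) {n : ℕ} (F : (Fin n → X) → ℝ) : ℝ := ∑ s, (∏ i, gW e H (s i)) * F s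

theorem repAvg_snoc (H : X → ℝ) {n : ℕ} (F : (Fin (n + 1) → X) → ℝ) :
    repAvg e H F = repAvg e H fun s : Fin n → X => gAvg e H fun x => F (Fin.snoc s x) := by
  unfold repAvg gAvg
  rw [← (Fin.snocEquiv fun _ : Fin (n + 1) => X).sum_comp, Fintype.sum_prod_type, Finset.sum_comm]
  refine Finset.sum_congr rfl fun s _ => ?_
  rw [Finset.mul_sum]
  refine Finset.sum_congr rfl fun x _ => ?_
  simp only [Fin.snocEquiv, Equiv.coe_fn_mk, Fin.prod_univ_castSucc, Fin.snoc_castSucc,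
    Fin.snoc_last]
  ring

include he

theorem sum_prod_gW (H : X → ℝ) (n : ℕ) : ∑ s : Fin n → X, ∏ i, gW e H (s i) = 1 := by
  classical
  rw [← Fintype.piFinset_univ, ← Finset.prod_univ_sum]
  simp [sum_gW he]

theorem prod_gW_nonneg (H : X → ℝ) {n : ℕ} (s : Fin n → X) : 0 ≤ ∏ i, gW e H (s i) :=
  Finset.prod_nonneg fun _ _ => gW_nonneg he H _

theorem prod_gW_le_one (H : X → ℝ) {n : ℕ} (s : Fin n → X) : ∏ i, gW e H (s i) ≤ 1 :=
  Finset.prod_le_one (fun _ _ => gW_nonneg he H _) fun _ _ => gW_le_one he H _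

theorem repAvg_init (H : X → ℝ) {n : ℕ} (F : (Fin n → X) → ℝ) :
    repAvg e H (fun s : Fin (n + 1) → X => F fun i => s i.castSucc) = repAvg e H F := by
  rw [repAvg_snoc]
  congr 1
  funext s
  simp only [Fin.snoc_castSucc]
  rw [gAvg, ← Finset.sum_mul, sum_gW he, one_mul]

theorem repAvg_zero_coord (H : X → ℝ) {n : ℕ} (f : X → ℝ) :
    repAvg e H (fun s : Fin (n + 1) → X => f (s 0)) = gAvg e H f := by
  induction n with
  | zero =>
    rw [repAvg_snoc]
    simp [repAvg, Fin.snoc]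
  | succ n ih =>
    rw [← ih, ← repAvg_init he H (fun s : Fin (n + 1) → X => f (s 0))]
    rfl

theorem abs_repAvg_mul_le (H : X → ℝ) {n : ℕ} (F G : (Fin n → X) → ℝ) {K : ℝ}
    (hF : ∀ s, |F s| ≤ K) :
    |repAvg e H fun s => F s * G s| ≤ K * repAvg e H fun s => |G s| := by
  unfold repAvg
  rw [Finset.mul_sum]
  refine (Finset.abs_sum_le_sum_abs _ _).trans (Finset.sum_le_sum fun s _ => ?_)
  have h := prod_gW_nonneg he H s
  rw [abs_mul, abs_mul, abs_of_nonneg h]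
  calc _ ≤ (∏ i, gW e H (s i)) * (K * |G s|) := by gcongr; exact hF s
    _ = _ := by ring

theorem abs_repAvg_le (H : X → ℝ) {n : ℕ} (F : (Fin n → X) → ℝ) {K : ℝ}
    (hF : ∀ s, |F s| ≤ K) : |repAvg e H F| ≤ K := by
  have h := abs_repAvg_mul_le he H F (fun _ => 1) hF
  simpa [repAvg, sum_prod_gW he] using h

end Replica

theorem repAvg_add {X : Type*} [Fintype X] (e H : X → ℝ) {n : ℕ} (F G : (Fin n → X) → ℝ) :
    repAvg e H (fun s => F s + G s) = repAvg e H F + repAvg e H G := by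
  simp [repAvg, mul_add, Finset.sum_add_distrib]

theorem repAvg_const_mul {X : Type*} [Fintype X] (e H : X → ℝ) {n : ℕ} (a : ℝ)
    (F : (Fin n → X) → ℝ) :
    repAvg e H (fun s => a * F s) = a * repAvg e H F := by
  simp only [repAvg, Finset.mul_sum]
  exact Finset.sum_congr rfl fun s _ => by ring

theorem repAvg_sum {X ι : Type*} [Fintype X] (e H : X → ℝ) {n : ℕ} (t : Finset ι)
    (F : ι → (Fin n → X) → ℝ) :
    repAvg e H (fun s => ∑ i ∈ t, F i s) = ∑ i ∈ t, repAvg e H (F i) := by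
  simp only [repAvg, Finset.mul_sum]
  exact Finset.sum_comm

/-! ### Gaussian integration by parts, in one variable and for infinite families. -/

/-- **Gaussian integration by parts** for bounded functions with bounded derivative. -/
theorem integral_id_mul_gaussianReal {F F' : ℝ → ℝ} (hF : ∀ t, HasDerivAt F (F' t) t) {K : ℝ}
    (hK : ∀ t, |F t| ≤ K) (hK' : ∀ t, |F' t| ≤ K) :
    ∫ t, t * F t ∂gaussianReal 0 1 = ∫ t, F' t ∂gaussianReal 0 1 := by
  have hFc : Continuous F := continuous_iff_continuousAt.2 fun t => (hF t).continuousAt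
  have hF'm : Measurable F' := by
    have : F' = deriv F := funext fun t => (hF t).deriv.symm
    rw [this]; exact measurable_deriv F
  rw [integral_gaussianReal_eq_integral_smul one_ne_zero,
    integral_gaussianReal_eq_integral_smul one_ne_zero]
  set v := gaussianPDFReal 0 1 with hv
  have hvd : ∀ t, HasDerivAt v (-(t * v t)) t := fun t => by
    have h1 : HasDerivAt (fun x : ℝ => -(x - 0) ^ 2 / (2 * 1)) (-t) t := by
      have := ((hasDerivAt_id t).pow 2).neg.div_const 2
      simp only [sub_zero, mul_one]
      refine this.congr_deriv ?_
      simp; ring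
    have h2 := h1.exp.const_mul ((√(2 * Real.pi * 1))⁻¹)
    have h3 : v = fun x : ℝ => (√(2 * Real.pi * 1))⁻¹ * Real.exp (-(x - 0) ^ 2 / (2 * 1)) := by
      rw [hv, gaussianPDFReal_def]; simp
    rw [h3]
    refine h2.congr_deriv ?_
    ring
  have hvi : Integrable v := integrable_gaussianPDFReal 0 1
  have hid : Integrable (fun t : ℝ => t) (gaussianReal 0 1) :=
    (memLp_id_gaussianReal (μ := 0) (v := 1) 1).integrable (by simp)
  have htv : Integrable (fun t => t * v t) := by
    rw [gaussianReal_of_var_ne_zero 0 one_ne_zero, integrable_withDensity_iff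
      (measurable_gaussianPDF 0 1) (.of_forall fun x => gaussianPDF_lt_top)] at hid
    simpa [toReal_gaussianPDF] using hid
  have i1 : Integrable (fun t => F t * -(t * v t)) :=
    htv.neg.bdd_mul hFc.aestronglyMeasurable (.of_forall fun t => hK t)
  have i2 : Integrable (fun t => F' t * v t) :=
    hvi.bdd_mul hF'm.aestronglyMeasurable (.of_forall fun t => hK' t)
  have i3 : Integrable (fun t => F t * v t) :=
    hvi.bdd_mul hFc.aestronglyMeasurable (.of_forall fun t => hK t)
  have h := integral_mul_deriv_eq_deriv_mul_of_integrable (fun x _ => hF x) (fun x _ => hvd x)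
    i1 i2 i3
  simp only [mul_neg, integral_neg, neg_inj] at h
  simp only [smul_eq_mul]
  calc _ = ∫ x, F x * (x * v x) := by congr 1; ext x; ring
    _ = _ := by rw [h]; congr 1; ext x; ring

theorem integral_eq_integral_comp {α β : Type*} {mα : MeasurableSpace α} {mβ : MeasurableSpace β}
    {μ : Measure α} {ν : Measure β} {T : α → β} (h : MeasurePreserving T μ ν) {g : β → ℝ}
    (hg : AEStronglyMeasurable g ν) : ∫ y, g y ∂ν = ∫ x, g (T x) ∂μ := by
  rw [← h.map_eq, integral_map h.measurable.aemeasurable (by rwa [h.map_eq])]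

/-- Resampling a single coordinate leaves a product law unchanged. With Fubini this reduces
statements about one of infinitely many coordinates to the real line; it serves both the Gaussian
disorder and the uniform parameters. -/
theorem measurePreserving_update_infinitePi {ι : Type*} [DecidableEq ι] (ν : Measure ℝ)
    [IsProbabilityMeasure ν] (i : ι) :
    MeasurePreserving (fun p : (ι → ℝ) × ℝ => Function.update p.1 i p.2)
      ((Measure.infinitePi fun _ : ι => ν).prod ν) (Measure.infinitePi fun _ : ι => ν) := by
  have hm : Measurable fun p : (ι → ℝ) × ℝ => Function.update p.1 i p.2 := by
    refine measurable_pi_lambda _ fun j => ?_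
    by_cases h : j = i
    · subst h; simpa using measurable_snd
    · simp only [Function.update_of_ne h]; fun_prop
  refine ⟨hm, Measure.eq_infinitePi _ fun s t ht => ?_⟩
  rw [Measure.map_apply hm (.pi s.countable_toSet fun _ _ => ht _)]
  by_cases his : i ∈ s
  · have : (fun p : (ι → ℝ) × ℝ => Function.update p.1 i p.2) ⁻¹' (Set.pi s t) =
        (Set.pi (s.erase i : Finset ι) t) ×ˢ t i := by
      ext p
      simp only [Set.mem_preimage, Set.mem_pi, Set.mem_prod, Finset.mem_coe, Finset.mem_erase]
      constructor
      · intro h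
        refine ⟨fun j hj => ?_, by simpa using h i his⟩
        simpa [Function.update_of_ne hj.1] using h j hj.2
      · rintro ⟨h1, h2⟩ j hj
        by_cases hji : j = i
        · subst hji; simpa using h2
        · rw [Function.update_of_ne hji]; exact h1 j ⟨hji, hj⟩
    rw [this, Measure.prod_prod, Measure.infinitePi_pi _ fun j _ => ht j,
      Finset.prod_erase_mul _ _ his]
  · have : (fun p : (ι → ℝ) × ℝ => Function.update p.1 i p.2) ⁻¹' (Set.pi s t) =
        (Set.pi s t) ×ˢ Set.univ := by
      ext p
      simp only [Set.mem_preimage, Set.mem_pi, Set.mem_prod, Finset.mem_coe, Set.mem_univ,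
        and_true]
      refine forall₂_congr fun j hj => ?_
      rw [Function.update_of_ne (by rintro rfl; exact his hj)]
    rw [this, Measure.prod_prod, Measure.infinitePi_pi _ fun j _ => ht j]
    simp

section GaussPi

/-- The law of a family of independent standard Gaussian random variables. -/
def gaussPi (ι : Type*) : Measure (ι → ℝ) := Measure.infinitePi fun _ => gaussianReal 0 1

instance (ι : Type*) : IsProbabilityMeasure (gaussPi ι) := by
  unfold gaussPi
  infer_instance

variable {ι : Type*}

theorem measurePreserving_comp_gaussPi {α : Type*} {f : α → ι} (hf : Function.Injective f) :
    MeasurePreserving (fun (ω : ι → ℝ) i => ω (f i)) (gaussPi ι) (gaussPi α) :=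
  ⟨by fun_prop, Measure.map_infinitePi_infinitePi_of_inj hf⟩

theorem measurePreserving_eval_gaussPi (i : ι) :
    MeasurePreserving (fun g : ι → ℝ => g i) (gaussPi ι) (gaussianReal 0 1) :=
  measurePreserving_eval_infinitePi _ i

/-- Two independent copies are read off one family indexed by `Bool × ι`, so that exchanging
coordinates between the copies becomes an injection of the index set. -/
theorem measurePreserving_pair_gaussPi :
    MeasurePreserving
      (fun ω : Bool × ι → ℝ => ((fun i => ω (false, i), fun i => ω (true, i)) :
        (ι → ℝ) × (ι → ℝ))) (gaussPi (Bool × ι)) ((gaussPi ι).prod (gaussPi ι)) := by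
  refine ⟨by fun_prop, ?_⟩
  have h1 := Measure.infinitePi_map_curry (fun (_ : Bool) (_ : ι) => gaussianReal 0 1)
  have h2 := Measure.infinitePi_map_eval_prod (P := fun _ : Bool => gaussPi ι)
    (i := false) (j := true) (by simp)
  unfold gaussPi at *
  rw [← h1, Measure.map_map (by fun_prop) (by fun_prop)] at h2
  exact h2

theorem measurePreserving_update_gaussPi [DecidableEq ι] (i : ι) :
    MeasurePreserving (fun p : (ι → ℝ) × ℝ => Function.update p.1 i p.2)
      ((gaussPi ι).prod (gaussianReal 0 1)) (gaussPi ι) :=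
  measurePreserving_update_infinitePi _ i

theorem integrable_eval_gaussPi (i : ι) : Integrable (fun g : ι → ℝ => g i) (gaussPi ι) :=
  (measurePreserving_eval_gaussPi i).integrable_comp_of_integrable
    ((memLp_id_gaussianReal (μ := 0) (v := 1) 1).integrable (by simp))

/-- Gaussian integration by parts with respect to one coordinate. -/
theorem integral_eval_mul_gaussPi [DecidableEq ι] (i : ι) {Φ Φ' : (ι → ℝ) → ℝ}
    (hΦ : Measurable Φ) (hΦ' : Measurable Φ') {K : ℝ} (hK : ∀ g, |Φ g| ≤ K)
    (hK' : ∀ g, |Φ' g| ≤ K)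
    (hd : ∀ᵐ g ∂gaussPi ι, ∀ t, HasDerivAt (fun t => Φ (Function.update g i t))
      (Φ' (Function.update g i t)) t) :
    ∫ g, g i * Φ g ∂gaussPi ι = ∫ g, Φ' g ∂gaussPi ι := by
  have hp := measurePreserving_update_gaussPi i
  have i1 : Integrable (fun g : ι → ℝ => g i * Φ g) (gaussPi ι) :=
    (integrable_eval_gaussPi i).mul_bdd hΦ.aestronglyMeasurable (.of_forall hK)
  have i2 : Integrable Φ' (gaussPi ι) :=
    (integrable_const K).mono' hΦ'.aestronglyMeasurable (.of_forall hK')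
  have j1 : Integrable (fun p : (ι → ℝ) × ℝ => Function.update p.1 i p.2 i *
      Φ (Function.update p.1 i p.2)) ((gaussPi ι).prod (gaussianReal 0 1)) :=
    hp.integrable_comp_of_integrable i1
  have j2 : Integrable (fun p : (ι → ℝ) × ℝ => Φ' (Function.update p.1 i p.2))
      ((gaussPi ι).prod (gaussianReal 0 1)) := hp.integrable_comp_of_integrable i2
  rw [integral_eq_integral_comp hp i1.aestronglyMeasurable,
    integral_eq_integral_comp hp i2.aestronglyMeasurable, integral_prod _ j1, integral_prod _ j2]
  refine integral_congr_ae (hd.mono fun g hg => ?_)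
  simp only [Function.update_self]
  exact integral_id_mul_gaussianReal hg (fun t => hK _) (fun t => hK' _)

theorem integral_sq_linear_gaussPi {α : Type*} (s : Finset α) {f : α → ι}
    (hf : Function.Injective f) (c : α → ℝ) :
    Integrable (fun g : ι → ℝ => (∑ a ∈ s, g (f a) * c a) ^ 2) (gaussPi ι) ∧
    ∫ g, (∑ a ∈ s, g (f a) * c a) ^ 2 ∂gaussPi ι = ∑ a ∈ s, c a ^ 2 := by
  have hL : ∀ a, MemLp (fun g : ι → ℝ => g (f a) * c a) 2 (gaussPi ι) := fun a => by
    have h := (memLp_id_gaussianReal (μ := 0) (v := 1) 2)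
    exact (h.comp_measurePreserving (measurePreserving_eval_gaussPi (f a))).mul_const (c a)
  have hLs : MemLp (∑ a ∈ s, fun g : ι → ℝ => g (f a) * c a) 2 (gaussPi ι) :=
    memLp_finsetSum' s fun a _ => hL a
  have hmean : ∀ a, ∫ g, g (f a) * c a ∂gaussPi ι = 0 := fun a => by
    rw [integral_mul_const]
    rw [← integral_eq_integral_comp (measurePreserving_eval_gaussPi (f a))
      (g := fun x : ℝ => x) measurable_id.aestronglyMeasurable, integral_id_gaussianReal, zero_mul]
  have hind : iIndepFun (fun (a : α) (g : ι → ℝ) => g (f a) * c a) (gaussPi ι) := by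
    have h := iIndepFun_infinitePi (P := fun _ : ι => gaussianReal 0 1)
      (X := fun _ x => x) (fun i => measurable_id)
    exact (h.precomp hf).comp (fun a x => x * c a) fun a => by fun_prop
  have hvar := IndepFun.variance_sum (s := s) (fun a _ => hL a)
    (fun a _ b _ hab => hind.indepFun hab)
  have hm0 : ∫ g, (∑ a ∈ s, fun g : ι → ℝ => g (f a) * c a) g ∂gaussPi ι = 0 := by
    simp only [Finset.sum_apply]
    rw [integral_finsetSum _ fun a _ => (hL a).integrable (by simp)]
    exact Finset.sum_eq_zero fun a _ => hmean a
  have key : (fun g : ι → ℝ => (∑ a ∈ s, g (f a) * c a) ^ 2) =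
      (∑ a ∈ s, fun g : ι → ℝ => g (f a) * c a) ^ 2 := by
    ext g; simp
  refine ⟨by rw [key]; exact hLs.integrable_sq, ?_⟩
  have hv := variance_of_integral_eq_zero hLs.aemeasurable hm0
  rw [hvar] at hv
  rw [key]
  refine hv.symm.trans ?_
  refine Finset.sum_congr rfl fun a _ => ?_
  rw [variance_mul_const]
  have : Var[fun g : ι → ℝ => g (f a); gaussPi ι] = 1 := by
    have h := variance_id_gaussianReal (μ := 0) (v := 1)
    rw [← (measurePreserving_eval_gaussPi (f a)).map_eq, variance_map
      measurable_id.aemeasurable (measurable_pi_apply (f a)).aemeasurable] at h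
    simpa using h
  rw [this, one_mul]

end GaussPi

/-! ### An Efron–Stein inequality for coordinatewise Lipschitz functions of Gaussians. -/

section EfronStein

variable {ι : Type*} [DecidableEq ι]

/-- Replace the coordinates in `F` of `g` by those of `g'`. -/
def mix (F : Finset ι) (g g' : ι → ℝ) : ι → ℝ := fun i => if i ∈ F then g' i else g i

theorem measurable_mix (F : Finset ι) :
    Measurable fun p : (ι → ℝ) × (ι → ℝ) => mix F p.1 p.2 := by
  refine measurable_pi_lambda _ fun i => ?_
  unfold mix
  split_ifs <;> fun_prop

theorem mix_insert {F : Finset ι} {k : ι} (hk : k ∉ F) (g g' : ι → ℝ) :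
    mix (insert k F) g g' = Function.update (mix F g g') k (g' k) := by
  ext i
  by_cases h : i = k
  · subst h; simp [mix]
  · simp [mix, h]

/-- Exchange the coordinates in `F` of two copies. -/
theorem measurePreserving_swap_mix (F : Finset ι) :
    MeasurePreserving (fun p : (ι → ℝ) × (ι → ℝ) => (mix F p.1 p.2, mix F p.2 p.1))
      ((gaussPi ι).prod (gaussPi ι)) ((gaussPi ι).prod (gaussPi ι)) := by
  have h1 := measurePreserving_pair_gaussPi (ι := ι)
  -- The exchange is the relabelling that flips the copy exactly over the indices in F.
  have hinj : Function.Injective fun q : Bool × ι => ((if q.2 ∈ F then !q.1 else q.1), q.2) := by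
    rintro ⟨a, i⟩ ⟨b, j⟩ h
    simp only [Prod.mk.injEq] at h
    obtain ⟨h, rfl⟩ := h
    split_ifs at h <;> simp_all
  have h2 := measurePreserving_comp_gaussPi hinj
  have h3 := h1.comp h2
  refine ⟨((measurable_mix F).prodMk ((measurable_mix F).comp measurable_swap)), ?_⟩
  conv_lhs => rw [← h1.map_eq]
  refine (Measure.map_map ((measurable_mix F).prodMk ((measurable_mix F).comp measurable_swap))
    h1.measurable).trans ?_
  rw [← h3.map_eq]
  congr 1
  ext ω i <;> simp only [mix, Function.comp_apply] <;> split_ifs <;> rfl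

theorem mix_empty (g g' : ι → ℝ) : mix ∅ g g' = g := by ext i; simp [mix]

/-- Expanding the square leaves a difference of correlations between ψ(g) and ψ of the mixed vector,
which telescopes over F. Each increment, symmetrized by exchanging one coordinate k, is the mean of
a product of two increments of ψ in that coordinate; the value 2 of E(g'_k - g_k)² gives the
constant. -/
theorem efronStein_of_bounded {ψ : (ι → ℝ) → ℝ} (hψ : Measurable ψ) {K : ℝ}
    (hK : ∀ g, |ψ g| ≤ K) {a : ι → ℝ}
    (ha : ∀ g k t, |ψ (Function.update g k t) - ψ g| ≤ a k * |t - g k|) (F : Finset ι) :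
    ∫ p, (ψ p.1 - ψ (mix F p.1 p.2)) ^ 2 ∂(gaussPi ι).prod (gaussPi ι) ≤
      2 * ∑ k ∈ F, a k ^ 2 := by
  set P := (gaussPi ι).prod (gaussPi ι) with hP
  have m1 : Measurable fun p : (ι → ℝ) × (ι → ℝ) => ψ p.1 := hψ.comp measurable_fst
  have m2 : ∀ F : Finset ι, Measurable fun p : (ι → ℝ) × (ι → ℝ) => ψ (mix F p.1 p.2) :=
    fun F => hψ.comp (measurable_mix F)
  have hint : ∀ {f g : (ι → ℝ) × (ι → ℝ) → ℝ}, Measurable f → Measurable g → (∀ p, |f p| ≤ K) →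
      (∀ p, |g p| ≤ K) → Integrable (fun p => f p * g p) P := fun hf hg hf' hg' =>
    (integrable_const (K * K)).mono' (hf.mul hg).aestronglyMeasurable (.of_forall fun p => by
      rw [Real.norm_eq_abs, abs_mul]
      exact mul_le_mul (hf' p) (hg' p) (abs_nonneg _) ((abs_nonneg _).trans (hf' p)))
  -- The mixed vector has the same law as g.
  have hsq : ∀ F : Finset ι, ∫ p, ψ (mix F p.1 p.2) * ψ (mix F p.1 p.2) ∂P =
      ∫ p, ψ p.1 * ψ p.1 ∂P := fun F => by
    have h := measurePreserving_swap_mix F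
    exact (integral_eq_integral_comp h (g := fun p => ψ p.1 * ψ p.1)
      (m1.mul m1).aestronglyMeasurable).symm
  have hD : ∀ F : Finset ι, ∫ p, (ψ p.1 - ψ (mix F p.1 p.2)) ^ 2 ∂P =
      2 * (∫ p, ψ p.1 * ψ p.1 ∂P - ∫ p, ψ p.1 * ψ (mix F p.1 p.2) ∂P) := fun F => by
    have e : ∀ p : (ι → ℝ) × (ι → ℝ), (ψ p.1 - ψ (mix F p.1 p.2)) ^ 2 =
        ψ p.1 * ψ p.1 - 2 * (ψ p.1 * ψ (mix F p.1 p.2)) +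
          ψ (mix F p.1 p.2) * ψ (mix F p.1 p.2) := fun p => by ring
    have i1 := hint m1 m1 (fun p => hK _) (fun p => hK _)
    have i2 := hint m1 (m2 F) (fun p => hK _) (fun p => hK _)
    have i3 := hint (m2 F) (m2 F) (fun p => hK _) (fun p => hK _)
    simp only [e]
    have i4 : Integrable (fun p : (ι → ℝ) × (ι → ℝ) =>
      ψ p.1 * ψ p.1 - 2 * (ψ p.1 * ψ (mix F p.1 p.2))) P := i1.sub (i2.const_mul 2)
    rw [integral_add i4 i3, integral_sub i1 (i2.const_mul 2), integral_const_mul, hsq]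
    ring
  rw [hD]
  refine mul_le_mul_of_nonneg_left ?_ (by norm_num)
  induction F using Finset.induction_on with
  | empty => simp [mix_empty]
  | insert k F hk ih =>
    rw [Finset.sum_insert hk]
    -- Exchanging coordinate k between the copies interchanges mixing on F with mixing on F ∪ {k}.
    have h := measurePreserving_swap_mix ({k} : Finset ι)
    have e1 : ∀ p : (ι → ℝ) × (ι → ℝ),
        mix F (mix {k} p.1 p.2) (mix {k} p.2 p.1) = mix (insert k F) p.1 p.2 := fun p => by
      ext i
      by_cases hi : i = k
      · subst hi; simp [mix, hk]
      · simp [mix, hi]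
    have e2 : ∀ p : (ι → ℝ) × (ι → ℝ),
        mix (insert k F) (mix {k} p.1 p.2) (mix {k} p.2 p.1) = mix F p.1 p.2 := fun p => by
      ext i
      by_cases hi : i = k
      · subst hi; simp [mix, hk]
      · simp [mix, hi]
    have s1 : ∫ p, ψ p.1 * ψ (mix F p.1 p.2) ∂P =
        ∫ p, ψ (mix {k} p.1 p.2) * ψ (mix (insert k F) p.1 p.2) ∂P := by
      rw [hP, integral_eq_integral_comp h (g := fun p => ψ p.1 * ψ (mix F p.1 p.2))
        (m1.mul (m2 F)).aestronglyMeasurable]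
      simp only [e1]
    have s2 : ∫ p, ψ p.1 * ψ (mix (insert k F) p.1 p.2) ∂P =
        ∫ p, ψ (mix {k} p.1 p.2) * ψ (mix F p.1 p.2) ∂P := by
      rw [hP, integral_eq_integral_comp h (g := fun p => ψ p.1 * ψ (mix (insert k F) p.1 p.2))
        (m1.mul (m2 _)).aestronglyMeasurable]
      simp only [e2]
    have i1 := hint m1 (m2 F) (fun p => hK _) (fun p => hK _)
    have i2 := hint m1 (m2 (insert k F)) (fun p => hK _) (fun p => hK _)
    have i3 := hint (m2 {k}) (m2 (insert k F)) (fun p => hK _) (fun p => hK _)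
    have i4 := hint (m2 {k}) (m2 F) (fun p => hK _) (fun p => hK _)
    have i5 : Integrable (fun p : (ι → ℝ) × (ι → ℝ) =>
      ψ p.1 * ψ (mix F p.1 p.2) - ψ p.1 * ψ (mix (insert k F) p.1 p.2)) P := i1.sub i2
    have i6 : Integrable (fun p : (ι → ℝ) × (ι → ℝ) =>
      ψ (mix {k} p.1 p.2) * ψ (mix (insert k F) p.1 p.2) -
        ψ (mix {k} p.1 p.2) * ψ (mix F p.1 p.2)) P := i3.sub i4
    have hincr : 2 * (∫ p, ψ p.1 * ψ (mix F p.1 p.2) ∂P -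
        ∫ p, ψ p.1 * ψ (mix (insert k F) p.1 p.2) ∂P) ≤ 2 * a k ^ 2 := by
      have : 2 * (∫ p, ψ p.1 * ψ (mix F p.1 p.2) ∂P -
          ∫ p, ψ p.1 * ψ (mix (insert k F) p.1 p.2) ∂P) =
          ∫ p, (ψ p.1 - ψ (mix {k} p.1 p.2)) *
            (ψ (mix F p.1 p.2) - ψ (mix (insert k F) p.1 p.2)) ∂P := by
        have e : ∀ p : (ι → ℝ) × (ι → ℝ), (ψ p.1 - ψ (mix {k} p.1 p.2)) *
            (ψ (mix F p.1 p.2) - ψ (mix (insert k F) p.1 p.2)) =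
            (ψ p.1 * ψ (mix F p.1 p.2) - ψ p.1 * ψ (mix (insert k F) p.1 p.2)) +
            (ψ (mix {k} p.1 p.2) * ψ (mix (insert k F) p.1 p.2) -
              ψ (mix {k} p.1 p.2) * ψ (mix F p.1 p.2)) := fun p => by ring
        simp only [e]
        rw [integral_add i5 i6, integral_sub i1 i2, integral_sub i3 i4,
          ← s1, ← s2]
        ring
      rw [this]
      have hinj : Function.Injective fun b : Bool => (b, k) := fun b c h => by simpa using h
      obtain ⟨j1, j2⟩ := integral_sq_linear_gaussPi (Finset.univ : Finset Bool) hinj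
        (fun b => if b then 1 else -1)
      have hpair := measurePreserving_pair_gaussPi (ι := ι)
      have mq : Measurable fun p : (ι → ℝ) × (ι → ℝ) => (p.2 k - p.1 k) ^ 2 := by fun_prop
      have j3 : ∫ p, (p.2 k - p.1 k) ^ 2 ∂P = 2 := by
        rw [hP, ← hpair.map_eq, integral_map hpair.measurable.aemeasurable
          mq.aestronglyMeasurable]
        simp [sub_eq_add_neg] at j2 ⊢
        rw [j2]
      have j4 : Integrable (fun p : (ι → ℝ) × (ι → ℝ) => (p.2 k - p.1 k) ^ 2) P := by
        rw [hP, ← hpair.map_eq, integrable_map_measure mq.aestronglyMeasurable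
          hpair.measurable.aemeasurable]
        simpa [sub_eq_add_neg, Function.comp_def] using j1
      rw [show 2 * a k ^ 2 = ∫ p, a k ^ 2 * (p.2 k - p.1 k) ^ 2 ∂P by
        rw [integral_const_mul, j3]; ring]
      refine integral_mono ?_ (j4.const_mul _) fun p => ?_
      · have e : (fun p : (ι → ℝ) × (ι → ℝ) => (ψ p.1 - ψ (mix {k} p.1 p.2)) *
            (ψ (mix F p.1 p.2) - ψ (mix (insert k F) p.1 p.2))) = fun p =>
            (ψ p.1 * ψ (mix F p.1 p.2) - ψ p.1 * ψ (mix (insert k F) p.1 p.2)) +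
            (ψ (mix {k} p.1 p.2) * ψ (mix (insert k F) p.1 p.2) -
              ψ (mix {k} p.1 p.2) * ψ (mix F p.1 p.2)) := by ext p; ring
        rw [e]
        exact i5.add i6
      · have h1 : |ψ p.1 - ψ (mix {k} p.1 p.2)| ≤ a k * |p.2 k - p.1 k| := by
          have := ha p.1 k (p.2 k)
          rw [abs_sub_comm]
          convert this using 4
          ext i; by_cases hi : i = k
          · subst hi; simp [mix]
          · simp [mix, hi]
        have h2 : |ψ (mix F p.1 p.2) - ψ (mix (insert k F) p.1 p.2)| ≤ a k * |p.2 k - p.1 k| := by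
          have := ha (mix F p.1 p.2) k (p.2 k)
          rw [← mix_insert hk] at this
          rw [abs_sub_comm]
          simpa [mix, hk] using this
        calc (ψ p.1 - ψ (mix {k} p.1 p.2)) *
              (ψ (mix F p.1 p.2) - ψ (mix (insert k F) p.1 p.2))
            ≤ |ψ p.1 - ψ (mix {k} p.1 p.2)| *
              |ψ (mix F p.1 p.2) - ψ (mix (insert k F) p.1 p.2)| := by
              rw [← abs_mul]; exact le_abs_self _
          _ ≤ (a k * |p.2 k - p.1 k|) * (a k * |p.2 k - p.1 k|) :=
              mul_le_mul h1 h2 (abs_nonneg _) ((abs_nonneg _).trans h1)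
          _ = a k ^ 2 * (p.2 k - p.1 k) ^ 2 := by rw [← sq_abs (p.2 k - p.1 k)]; ring
    linarith

/-- Clipping φ to [-M, M] preserves the Lipschitz constants, so the bounded case applies uniformly
in M and Fatou's lemma removes the clipping. The lower integral is used because square integrability
is not known in advance. -/
theorem lintegral_sq_sub_mix_le {φ : (ι → ℝ) → ℝ} (hφ : Measurable φ) {a : ι → ℝ}
    (ha : ∀ g k t, |φ (Function.update g k t) - φ g| ≤ a k * |t - g k|) (F : Finset ι) :
    ∫⁻ p, ENNReal.ofReal ((φ p.1 - φ (mix F p.1 p.2)) ^ 2) ∂(gaussPi ι).prod (gaussPi ι) ≤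
      ENNReal.ofReal (2 * ∑ k ∈ F, a k ^ 2) := by
  let clip : ℕ → ℝ → ℝ := fun M x => max (-(M : ℝ)) (min M x)
  have hclipm : ∀ M, Measurable (clip M) := fun M =>
    measurable_const.max (measurable_const.min measurable_id)
  have hclip : ∀ M x, |clip M x| ≤ M := fun M x =>
    abs_le.2 ⟨le_max_left _ _, max_le (by linarith [Nat.cast_nonneg (α := ℝ) M]) (min_le_left _ _)⟩
  have hlip : ∀ M x y, |clip M x - clip M y| ≤ |x - y| := fun M x y => by
    rw [abs_sub_le_iff]
    have := abs_sub_le_iff.1 (le_refl |x - y|)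
    constructor <;> simp only [clip, max_def, min_def] <;> split_ifs <;> linarith [this.1, this.2]
  have hb : ∀ M : ℕ, ∫⁻ p, ENNReal.ofReal ((clip M (φ p.1) - clip M (φ (mix F p.1 p.2))) ^ 2)
      ∂(gaussPi ι).prod (gaussPi ι) ≤ ENNReal.ofReal (2 * ∑ k ∈ F, a k ^ 2) := fun M => by
    have m : Measurable fun p : (ι → ℝ) × (ι → ℝ) =>
        (clip M (φ p.1) - clip M (φ (mix F p.1 p.2))) ^ 2 :=
      (((hclipm M).comp (hφ.comp measurable_fst)).sub
        ((hclipm M).comp (hφ.comp (measurable_mix F)))).pow_const 2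
    rw [← ofReal_integral_eq_lintegral_ofReal]
    · exact ENNReal.ofReal_le_ofReal (efronStein_of_bounded (ψ := fun g => clip M (φ g))
        ((hclipm M).comp hφ) (fun g => hclip M _)
        (fun g k t => (hlip M _ _).trans (ha g k t)) F)
    · refine (integrable_const ((2 * M : ℝ) ^ 2)).mono' m.aestronglyMeasurable
        (.of_forall fun p => ?_)
      rw [Real.norm_eq_abs, abs_of_nonneg (sq_nonneg _), sq_le_sq]
      refine (abs_sub _ _).trans ?_
      rw [abs_of_nonneg (by positivity : (0 : ℝ) ≤ 2 * M)]
      linarith [hclip M (φ p.1), hclip M (φ (mix F p.1 p.2))]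
    · exact .of_forall fun p => sq_nonneg _
  refine le_trans ?_ (lintegral_liminf_le (fun M : ℕ => ?_) |>.trans
    (liminf_le_of_frequently_le' (f := atTop) (.of_forall hb)))
  · refine lintegral_mono fun p => ?_
    obtain ⟨M₀, hM₀⟩ := exists_nat_ge (max |φ p.1| |φ (mix F p.1 p.2)|)
    have hid : ∀ M ≥ M₀, ∀ x, |x| ≤ max |φ p.1| |φ (mix F p.1 p.2)| → clip M x = x :=
      fun M hM x hx => by
        have h1 : |x| ≤ M := hx.trans (hM₀.trans (by exact_mod_cast hM))
        have h2 := abs_le.1 h1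
        simp only [clip]
        rw [min_eq_right h2.2, max_eq_right h2.1]
    have ht : Tendsto (fun M : ℕ => ENNReal.ofReal
        ((clip M (φ p.1) - clip M (φ (mix F p.1 p.2))) ^ 2)) atTop
        (𝓝 (ENNReal.ofReal ((φ p.1 - φ (mix F p.1 p.2)) ^ 2))) := by
      refine tendsto_const_nhds.congr' ?_
      filter_upwards [eventually_ge_atTop M₀] with M hM
      rw [hid M hM _ (le_max_left _ _), hid M hM _ (le_max_right _ _)]
    exact ht.liminf_eq.ge
  · exact ENNReal.measurable_ofReal.comp ((((hclipm M).comp (hφ.comp measurable_fst)).sub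
        ((hclipm M).comp (hφ.comp (measurable_mix F)))).pow_const 2)

end EfronStein

/-! ### Measurability and integrability of Gibbs averages and of log Z. -/

section Measurability

variable {X α : Type*} [Fintype X] [MeasurableSpace α] (e : X → ℝ) {H : α → X → ℝ}

theorem measurable_gZ (hH : ∀ x, Measurable fun a => H a x) : Measurable fun a => gZ e (H a) := by
  unfold gZ
  exact Finset.measurable_sum _ fun x _ => (hH x).exp.const_mul _

theorem measurable_gW (hH : ∀ x, Measurable fun a => H a x) (x : X) :
    Measurable fun a => gW e (H a) x :=
  ((hH x).exp.const_mul _).div (measurable_gZ e hH)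

theorem measurable_gAvg (hH : ∀ x, Measurable fun a => H a x) {f : α → X → ℝ}
    (hf : ∀ x, Measurable fun a => f a x) : Measurable fun a => gAvg e (H a) (f a) := by
  unfold gAvg
  exact Finset.measurable_sum _ fun x _ => (measurable_gW e hH x).mul (hf x)

theorem measurable_repAvg (hH : ∀ x, Measurable fun a => H a x) {n : ℕ}
    {F : α → (Fin n → X) → ℝ} (hF : ∀ s, Measurable fun a => F a s) :
    Measurable fun a => repAvg e (H a) (F a) := by
  unfold repAvg
  exact Finset.measurable_sum _ fun s _ =>
    (Finset.measurable_prod _ fun i _ => measurable_gW e hH (s i)).mul (hF s)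

variable {e} (he : IsRef e)
include he

theorem integrable_gAvg {μ : Measure α} (hH : ∀ x, Measurable fun a => H a x) {f : α → X → ℝ}
    (hf : ∀ x, Measurable fun a => f a x) (hfi : ∀ x, Integrable (fun a => f a x) μ) :
    Integrable (fun a => gAvg e (H a) (f a)) μ :=
  (integrable_finsetSum Finset.univ fun x _ => (hfi x).abs).mono'
    (measurable_gAvg e hH hf).aestronglyMeasurable
    (.of_forall fun a => abs_gAvg_le_sum he (H a) (f a))

theorem integrable_log_gZ {μ : Measure α} [IsFiniteMeasure μ]
    (hH : ∀ x, Measurable fun a => H a x) (hHi : ∀ x, Integrable (fun a => H a x) μ) :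
    Integrable (fun a => Real.log (gZ e (H a))) μ := by
  refine ((integrable_const |Real.log (gZ e fun _ => 0)|).add
    (integrable_finsetSum Finset.univ fun x _ => (hHi x).abs)).mono'
    (measurable_gZ e hH).log.aestronglyMeasurable (.of_forall fun a => ?_)
  have h : |Real.log (gZ e (H a)) - Real.log (gZ e fun _ => 0)| ≤ ∑ x, |H a x| :=
    abs_log_gZ_sub_le he fun x => by
      rw [sub_zero]
      exact Finset.single_le_sum (f := fun x => |H a x|) (fun y _ => abs_nonneg _)
        (Finset.mem_univ x)
  have h2 := abs_sub_abs_le_abs_sub (Real.log (gZ e (H a))) (Real.log (gZ e fun _ => 0))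
  simp only [Real.norm_eq_abs, Pi.add_apply]
  linarith

end Measurability

/-! ### From concentration of the free energy to concentration of the energy. -/

section Concentration

variable {X : Type*} [Fintype X] {e : X → ℝ} (he : IsRef e)
include he

/-- Convexity of log Z in x, as a subgradient inequality with the Gibbs mean as slope. -/
theorem gAvg_mul_le_log_gZ_sub (A h : X → ℝ) (x x' : ℝ) :
    (x' - x) * gAvg e (fun σ => A σ + x * h σ) h ≤
      Real.log (gZ e fun σ => A σ + x' * h σ) - Real.log (gZ e fun σ => A σ + x * h σ) := by
  refine le_trans (le_of_eq ?_) (gAvg_sub_le_log_gZ_sub he _ _)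
  unfold gAvg
  rw [Finset.mul_sum]
  exact Finset.sum_congr rfl fun σ _ => by ring

theorem monotone_gAvg (A h : X → ℝ) :
    Monotone fun x : ℝ => gAvg e (fun σ => A σ + x * h σ) h := by
  intro x x' hx
  rcases hx.eq_or_lt with rfl | hlt
  · exact le_rfl
  have h1 := gAvg_mul_le_log_gZ_sub he A h x x'
  have h2 := gAvg_mul_le_log_gZ_sub he A h x' x
  have : (x' - x) * gAvg e (fun σ => A σ + x * h σ) h ≤
      (x' - x) * gAvg e (fun σ => A σ + x' * h σ) h := by linarith
  exact le_of_mul_le_mul_left this (by linarith)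

/-- The fundamental theorem of calculus, the Gibbs variance being the derivative of the Gibbs mean.
-/
theorem lintegral_gibbs_variance (A h : X → ℝ) {a b : ℝ} (hab : a ≤ b) :
    ∫⁻ x in Set.Ioc a b, ENNReal.ofReal (gAvg e (fun σ => A σ + x * h σ)
      fun σ => (h σ - gAvg e (fun σ => A σ + x * h σ) h) ^ 2) =
    ENNReal.ofReal (gAvg e (fun σ => A σ + b * h σ) h - gAvg e (fun σ => A σ + a * h σ) h) := by
  have hW : ∀ σ, Continuous fun x : ℝ => gW e (fun σ => A σ + x * h σ) σ := fun σ =>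
    continuous_iff_continuousAt.2 fun x => (hasDerivAt_gW he A h σ x).continuousAt
  have hq : Continuous fun x : ℝ => gAvg e (fun σ => A σ + x * h σ) h :=
    continuous_iff_continuousAt.2 fun x => (hasDerivAt_gAvg he A h x).continuousAt
  have hc : Continuous fun x : ℝ => gAvg e (fun σ => A σ + x * h σ)
      fun σ => (h σ - gAvg e (fun σ => A σ + x * h σ) h) ^ 2 :=
    continuous_finsetSum _ fun σ _ => (hW σ).mul ((continuous_const.sub hq).pow 2)
  rw [← ofReal_integral_eq_lintegral_ofReal, ← intervalIntegral.integral_of_le hab,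
    intervalIntegral.integral_eq_sub_of_hasDerivAt (fun x _ => hasDerivAt_gAvg he A h x)
      (hc.intervalIntegrable a b)]
  · exact (hc.intervalIntegrable a b).1
  · exact .of_forall fun x => Finset.sum_nonneg fun σ _ =>
      mul_nonneg (gW_nonneg he _ σ) (sq_nonneg _)

variable {Ω : Type*} [MeasurableSpace Ω] {P : Measure Ω} [IsProbabilityMeasure P]

set_option maxHeartbeats 1600000 in
/-- If the free energy concentrates and its expected derivative is bounded by `M` on `[0, 3]`,
then the energy `h` concentrates around its Gibbs mean, on average over the parameter. -/
theorem lintegral_gAvg_abs_sub_mean_le {A h : Ω → X → ℝ} (hA : ∀ σ, Measurable fun ω => A ω σ)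
    (hh : ∀ σ, Measurable fun ω => h ω σ) (hAi : ∀ σ, Integrable (fun ω => A ω σ) P)
    (hhi : ∀ σ, Integrable (fun ω => h ω σ) P) {m : ℝ → ℝ}
    (hm : ∀ x, m x = ∫ ω, gAvg e (fun σ => A ω σ + x * h ω σ) (h ω) ∂P) {M v y δ : ℝ}
    (hM : ∀ x ∈ Set.Icc (0 : ℝ) 3, |m x| ≤ M)
    (hv : ∀ x ∈ Set.Icc (0 : ℝ) 3, ∫ ω, |Real.log (gZ e fun σ => A ω σ + x * h ω σ) -
      ∫ ω', Real.log (gZ e fun σ => A ω' σ + x * h ω' σ) ∂P| ∂P ≤ v)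
    (hy : 0 < y) (hy1 : y ≤ 1) (hδ : 0 < δ) :
    ∫⁻ x in Set.Ioc (1 : ℝ) 2, ∫⁻ ω, ENNReal.ofReal (gAvg e (fun σ => A ω σ + x * h ω σ)
      fun σ => |h ω σ - m x|) ∂P ≤
    ENNReal.ofReal (δ / 2 + M / δ + (3 * v / y + 4 * y * M)) := by
  set H : ℝ → Ω → X → ℝ := fun x ω σ => A ω σ + x * h ω σ with hHdef
  have hHm : ∀ x σ, Measurable fun ω => H x ω σ := fun x σ => (hA σ).add ((hh σ).const_mul x)
  have hHi : ∀ x σ, Integrable (fun ω => H x ω σ) P := fun x σ =>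
    (hAi σ).add ((hhi σ).const_mul x)
  have hHj : ∀ σ, Measurable fun p : ℝ × Ω => H p.1 p.2 σ := fun σ =>
    ((hA σ).comp measurable_snd).add (measurable_fst.mul ((hh σ).comp measurable_snd))
  set q : ℝ → Ω → ℝ := fun x ω => gAvg e (H x ω) (h ω) with hq
  set φ : ℝ → Ω → ℝ := fun x ω => Real.log (gZ e (H x ω)) with hφ
  set D : ℝ → Ω → ℝ := fun x ω => |φ x ω - ∫ ω', φ x ω' ∂P| with hDdef
  have hqi : ∀ x, Integrable (q x) P := fun x => integrable_gAvg he (hHm x) hh hhi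
  have hφi : ∀ x, Integrable (φ x) P := fun x => integrable_log_gZ he (hHm x) (hHi x)
  have hDi : ∀ x, Integrable (D x) P := fun x => ((hφi x).sub (integrable_const _)).abs
  have hmono : Monotone m := fun x x' hx => by
    rw [hm, hm]
    exact integral_mono (hqi x) (hqi x') fun ω => monotone_gAvg he (A ω) (h ω) hx
  have hψ : ∀ x x', (x' - x) * m x ≤ (∫ ω, φ x' ω ∂P) - ∫ ω, φ x ω ∂P := fun x x' => by
    rw [hm, ← integral_const_mul, ← integral_sub (hφi x') (hφi x)]
    exact integral_mono ((hqi x).const_mul _) ((hφi x').sub (hφi x))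
      fun ω => gAvg_mul_le_log_gZ_sub he (A ω) (h ω) x x'
  -- For convex functions, slopes at x are squeezed between difference quotients over [x - y, x] and
  -- [x, x + y]. Comparing the random function with its expectation costs the deviations D at the
  -- three points and the variation of the averaged slope m.
  have hdev : ∀ x ω, |q x ω - m x| ≤
      (D (x + y) ω + D x ω + D (x - y) ω) / y + (m (x + y) - m (x - y)) := fun x ω => by
    have a1 : y * q x ω ≤ φ (x + y) ω - φ x ω := by
      simpa using gAvg_mul_le_log_gZ_sub he (A ω) (h ω) x (x + y)
    have a2 : -y * q x ω ≤ φ (x - y) ω - φ x ω := by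
      simpa using gAvg_mul_le_log_gZ_sub he (A ω) (h ω) x (x - y)
    have b1 : -y * m (x + y) ≤ (∫ ω, φ x ω ∂P) - ∫ ω, φ (x + y) ω ∂P := by
      simpa using hψ (x + y) x
    have b2 : y * m (x - y) ≤ (∫ ω, φ x ω ∂P) - ∫ ω, φ (x - y) ω ∂P := by
      simpa using hψ (x - y) x
    have m1 := hmono (show x ≤ x + y by linarith)
    have m2 := hmono (show x - y ≤ x by linarith)
    have d1 := abs_le.1 (le_refl (D (x + y) ω))
    have d2 := abs_le.1 (le_refl (D x ω))
    have d3 := abs_le.1 (le_refl (D (x - y) ω))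
    have n1 : 0 ≤ D (x + y) ω := abs_nonneg _
    have n2 : 0 ≤ D (x - y) ω := abs_nonneg _
    have c1 := mul_le_mul_of_nonneg_left m1 hy.le
    have c2 := mul_le_mul_of_nonneg_left m2 hy.le
    rw [← sub_le_iff_le_add, le_div_iff₀ hy, sub_mul, ← abs_of_pos hy, ← abs_mul,
      abs_of_pos hy, sub_le_iff_le_add, abs_le]
    simp only [hDdef] at *
    constructor <;> linarith [d1.1, d1.2, d2.1, d2.2, d3.1, d3.2]
  have hqm : Measurable fun p : ℝ × Ω => q p.1 p.2 :=
    measurable_gAvg e hHj fun σ => (hh σ).comp measurable_snd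
  have hVm : Measurable fun p : ℝ × Ω => gAvg e (H p.1 p.2) fun σ => (h p.2 σ - q p.1 p.2) ^ 2 :=
    measurable_gAvg e hHj fun σ => (((hh σ).comp measurable_snd).sub hqm).pow_const 2
  have hmi : ∀ a b : ℝ, IntervalIntegrable m volume a b := fun a b =>
    hmono.intervalIntegrable
  -- the pointwise decomposition
  have hpt : ∀ x ω, gAvg e (H x ω) (fun σ => |h ω σ - m x|) ≤
      δ / 2 + 1 / (2 * δ) * gAvg e (H x ω) (fun σ => (h ω σ - q x ω) ^ 2) +
      ((D (x + y) ω + D x ω + D (x - y) ω) / y + (m (x + y) - m (x - y))) := fun x ω => by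
    have e1 : ∀ c : ℝ, gAvg e (H x ω) (fun _ => c) = c := fun c => by
      rw [gAvg, ← Finset.sum_mul, sum_gW he, one_mul]
    refine le_trans ?_ (add_le_add_right (hdev x ω) _)
    rw [← e1 (δ / 2), ← e1 |q x ω - m x|]
    unfold gAvg
    rw [Finset.mul_sum, ← Finset.sum_add_distrib, ← Finset.sum_add_distrib]
    refine Finset.sum_le_sum fun σ _ => ?_
    have hw := gW_nonneg he (H x ω) σ
    have t1 : |h ω σ - m x| ≤ |h ω σ - q x ω| + |q x ω - m x| := abs_sub_le _ _ _
    -- The inequality 2δ|a| ≤ δ² + a², with δ left free for later balancing.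
    have t2 : |h ω σ - q x ω| ≤ δ / 2 + 1 / (2 * δ) * (h ω σ - q x ω) ^ 2 := by
      rw [← sq_abs (h ω σ - q x ω)]
      have : 0 ≤ (|h ω σ - q x ω| - δ) ^ 2 := sq_nonneg _
      have h3 : δ / 2 + 1 / (2 * δ) * |h ω σ - q x ω| ^ 2 - |h ω σ - q x ω| =
        (|h ω σ - q x ω| - δ) ^ 2 / (2 * δ) := by field_simp; ring
      have : 0 ≤ (|h ω σ - q x ω| - δ) ^ 2 / (2 * δ) := by positivity
      linarith
    calc gW e (H x ω) σ * |h ω σ - m x| ≤ gW e (H x ω) σ *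
          (δ / 2 + 1 / (2 * δ) * (h ω σ - q x ω) ^ 2 + |q x ω - m x|) := by
            gcongr; linarith
      _ = _ := by ring
  have hin : ∀ x ∈ Set.Ioc (1 : ℝ) 2, ∫⁻ ω, ENNReal.ofReal (gAvg e (H x ω)
      fun σ => |h ω σ - m x|) ∂P ≤ ENNReal.ofReal (δ / 2) + (ENNReal.ofReal (1 / (2 * δ)) *
        ∫⁻ ω, ENNReal.ofReal (gAvg e (H x ω) fun σ => (h ω σ - q x ω) ^ 2) ∂P +
      ENNReal.ofReal (3 * v / y + (m (x + y) - m (x - y)))) := fun x hx => by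
    have hV : Measurable fun ω => gAvg e (H x ω) fun σ => (h ω σ - q x ω) ^ 2 :=
      hVm.comp measurable_prodMk_left
    have hDs : Integrable (fun ω => (D (x + y) ω + D x ω + D (x - y) ω) / y) P :=
      (((hDi _).add (hDi _)).add (hDi _)).div_const y
    have hmm : 0 ≤ m (x + y) - m (x - y) := sub_nonneg.2 (hmono (by linarith))
    have hD0 : ∀ ω, 0 ≤ (D (x + y) ω + D x ω + D (x - y) ω) / y := fun ω =>
      div_nonneg (add_nonneg (add_nonneg (abs_nonneg _) (abs_nonneg _)) (abs_nonneg _)) hy.le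
    calc _ ≤ ∫⁻ ω, (ENNReal.ofReal (δ / 2) + (ENNReal.ofReal (1 / (2 * δ)) *
          ENNReal.ofReal (gAvg e (H x ω) fun σ => (h ω σ - q x ω) ^ 2) +
          ENNReal.ofReal ((D (x + y) ω + D x ω + D (x - y) ω) / y +
            (m (x + y) - m (x - y))))) ∂P := by
          refine lintegral_mono fun ω => ?_
          have hg : 0 ≤ gAvg e (H x ω) fun σ => (h ω σ - q x ω) ^ 2 :=
            Finset.sum_nonneg fun σ _ => mul_nonneg (gW_nonneg he _ σ) (sq_nonneg _)
          rw [← ENNReal.ofReal_mul (by positivity), ← ENNReal.ofReal_add (by positivity)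
            (add_nonneg (hD0 ω) hmm), ← ENNReal.ofReal_add (by positivity)
            (add_nonneg (by positivity) (add_nonneg (hD0 ω) hmm))]
          exact ENNReal.ofReal_le_ofReal (by linarith [hpt x ω])
      _ = ENNReal.ofReal (δ / 2) + (ENNReal.ofReal (1 / (2 * δ)) *
        ∫⁻ ω, ENNReal.ofReal (gAvg e (H x ω) fun σ => (h ω σ - q x ω) ^ 2) ∂P +
          ∫⁻ ω, ENNReal.ofReal ((D (x + y) ω + D x ω + D (x - y) ω) / y +
            (m (x + y) - m (x - y))) ∂P) := by
          rw [lintegral_add_left measurable_const, lintegral_add_left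
            (hV.ennreal_ofReal.const_mul _), lintegral_const_mul _ hV.ennreal_ofReal]
          simp
      _ ≤ _ := by
          gcongr
          have hDs' : Integrable (fun ω => (D (x + y) ω + D x ω + D (x - y) ω) / y +
              (m (x + y) - m (x - y))) P := hDs.add (integrable_const _)
          rw [← ofReal_integral_eq_lintegral_ofReal hDs' (.of_forall fun ω => add_nonneg (hD0 ω) hmm)]
          refine ENNReal.ofReal_le_ofReal ?_
          rw [integral_add hDs (integrable_const _), integral_div,
            integral_add (f := fun ω => D (x + y) ω + D x ω) ((hDi _).add (hDi _)) (hDi _),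
            integral_add (hDi _) (hDi _)]
          have v1 := hv (x + y) ⟨by linarith [hx.1], by linarith [hx.2]⟩
          have v2 := hv x ⟨by linarith [hx.1], by linarith [hx.2]⟩
          have v3 := hv (x - y) ⟨by linarith [hx.1], by linarith [hx.2]⟩
          simp only [integral_const, probReal_univ, one_smul]
          have : (∫ ω, D (x + y) ω ∂P + ∫ ω, D x ω ∂P + ∫ ω, D (x - y) ω ∂P) / y ≤ 3 * v / y := by
            gcongr
            linarith
          linarith
  have hM0 : 0 ≤ M := (abs_nonneg _).trans (hM 0 ⟨le_rfl, by norm_num⟩)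
  have hv0 : 0 ≤ v := (integral_nonneg fun ω => abs_nonneg _).trans
    (hv 0 ⟨le_rfl, by norm_num⟩)
  have hvol : volume (Set.Ioc (1 : ℝ) 2) = 1 := by rw [Real.volume_Ioc]; norm_num
  have hmdm : Measurable fun x => m (x + y) - m (x - y) :=
    (hmono.measurable.comp (measurable_id.add_const y)).sub
      (hmono.measurable.comp (measurable_id.sub_const y))
  -- After Tonelli the variance integrates to the mean of q 2 - q 1, that is m 2 - m 1, hence the
  -- bound 2M.
  have I1 : ∫⁻ x in Set.Ioc (1 : ℝ) 2, ∫⁻ ω, ENNReal.ofReal (gAvg e (H x ω)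
      fun σ => (h ω σ - q x ω) ^ 2) ∂P ≤ ENNReal.ofReal (2 * M) := by
    rw [lintegral_lintegral_swap hVm.ennreal_ofReal.aemeasurable]
    simp only [hq, hHdef]
    have hq21 : Integrable (fun ω => gAvg e (fun σ => A ω σ + 2 * h ω σ) (h ω) -
        gAvg e (fun σ => A ω σ + 1 * h ω σ) (h ω)) P := (hqi 2).sub (hqi 1)
    rw [lintegral_congr fun ω => lintegral_gibbs_variance he (A ω) (h ω)
      (show (1 : ℝ) ≤ 2 by norm_num), ← ofReal_integral_eq_lintegral_ofReal
      hq21 (.of_forall fun ω => sub_nonneg.2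
        (monotone_gAvg he (A ω) (h ω) (show (1 : ℝ) ≤ 2 by norm_num)))]
    refine ENNReal.ofReal_le_ofReal ?_
    rw [integral_sub (hqi 2) (hqi 1), ← hm, ← hm]
    have := abs_le.1 (hM 2 ⟨by norm_num, by norm_num⟩)
    have := abs_le.1 (hM 1 ⟨by norm_num, by norm_num⟩)
    linarith
  -- The shifted integrals of m cancel except on two intervals of length 2y near the endpoints 1 and
  -- 2, whence 4yM. Since y ≤ 1, only arguments in [0, 3] occur.
  have I2 : ∫⁻ x in Set.Ioc (1 : ℝ) 2, ENNReal.ofReal (3 * v / y + (m (x + y) - m (x - y))) ≤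
      ENNReal.ofReal (3 * v / y + 4 * y * M) := by
    have j1 : IntervalIntegrable (fun x => m (x + y)) volume 1 2 :=
      Monotone.intervalIntegrable fun a b hab => hmono (by linarith)
    have j2 : IntervalIntegrable (fun x => m (x - y)) volume 1 2 :=
      Monotone.intervalIntegrable fun a b hab => hmono (by linarith)
    have j3 : IntervalIntegrable (fun x => 3 * v / y + (m (x + y) - m (x - y))) volume 1 2 :=
      intervalIntegrable_const.add (j1.sub j2)
    rw [← ofReal_integral_eq_lintegral_ofReal]
    · refine ENNReal.ofReal_le_ofReal ?_
      rw [← intervalIntegral.integral_of_le (by norm_num), intervalIntegral.integral_add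
        intervalIntegrable_const (j1.sub j2), intervalIntegral.integral_sub j1 j2,
        intervalIntegral.integral_comp_add_right, intervalIntegral.integral_comp_sub_right,
        intervalIntegral.integral_interval_sub_interval_comm (hmi _ _) (hmi _ _) (hmi _ _)]
      have k1 := intervalIntegral.norm_integral_le_of_norm_le_const (a := 1 + y) (b := 1 - y)
        (f := m) (C := M) fun x hx => by
          rw [Set.uIoc_of_ge (by linarith)] at hx
          exact hM x ⟨by linarith [hx.1], by linarith [hx.2]⟩
      have k2 := intervalIntegral.norm_integral_le_of_norm_le_const (a := 2 + y) (b := 2 - y)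
        (f := m) (C := M) fun x hx => by
          rw [Set.uIoc_of_ge (by linarith)] at hx
          exact hM x ⟨by linarith [hx.1], by linarith [hx.2]⟩
      rw [Real.norm_eq_abs, show (1 - y - (1 + y)) = -(2 * y) by ring, abs_neg,
        abs_of_pos (by linarith : 0 < 2 * y)] at k1
      rw [Real.norm_eq_abs, show (2 - y - (2 + y)) = -(2 * y) by ring, abs_neg,
        abs_of_pos (by linarith : 0 < 2 * y)] at k2
      have := abs_le.1 k1
      have := abs_le.1 k2
      rw [intervalIntegral.integral_const]
      norm_num
      linarith
    · exact j3.1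
    · refine .of_forall fun x => add_nonneg (by positivity) (sub_nonneg.2 (hmono (by linarith)))
  calc _ ≤ ∫⁻ x in Set.Ioc (1 : ℝ) 2, (ENNReal.ofReal (δ / 2) + (ENNReal.ofReal (1 / (2 * δ)) *
        ∫⁻ ω, ENNReal.ofReal (gAvg e (H x ω) fun σ => (h ω σ - q x ω) ^ 2) ∂P +
      ENNReal.ofReal (3 * v / y + (m (x + y) - m (x - y))))) :=
        setLIntegral_mono' measurableSet_Ioc hin
    _ = ENNReal.ofReal (δ / 2) + (ENNReal.ofReal (1 / (2 * δ)) *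
        (∫⁻ x in Set.Ioc (1 : ℝ) 2, ∫⁻ ω, ENNReal.ofReal (gAvg e (H x ω)
          fun σ => (h ω σ - q x ω) ^ 2) ∂P) +
        ∫⁻ x in Set.Ioc (1 : ℝ) 2, ENNReal.ofReal (3 * v / y + (m (x + y) - m (x - y)))) := by
        have hlm : Measurable fun x => ∫⁻ ω, ENNReal.ofReal (gAvg e (H x ω)
            fun σ => (h ω σ - q x ω) ^ 2) ∂P :=
          Measurable.lintegral_prod_right' (f := fun p : ℝ × Ω => ENNReal.ofReal
            (gAvg e (H p.1 p.2) fun σ => (h p.2 σ - q p.1 p.2) ^ 2)) hVm.ennreal_ofReal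
        rw [lintegral_add_left measurable_const, lintegral_add_left (hlm.const_mul _),
          lintegral_const_mul _ hlm]
        simp [hvol]
    _ ≤ ENNReal.ofReal (δ / 2) + (ENNReal.ofReal (1 / (2 * δ)) * ENNReal.ofReal (2 * M) +
        ENNReal.ofReal (3 * v / y + 4 * y * M)) := by gcongr
    _ = _ := by
        rw [← ENNReal.ofReal_mul (by positivity), ← ENNReal.ofReal_add (by positivity)
          (by positivity), ← ENNReal.ofReal_add (by positivity) (by positivity)]
        congr 1
        field_simp
        try ring

end Concentration

/-! ### Coefficients and covariance of the perturbation terms. -/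

section Coefficients

variable {κ N : ℕ}

/-- The weight `2^{-j(θ)}` of a perturbation term. -/
def Theta.weight (j₀ : RatVec κ → ℕ) (θ : Theta κ) : ℝ := (2 : ℝ)⁻¹ ^ θ.exponent j₀

theorem Theta.weight_pos (j₀ : RatVec κ → ℕ) (θ : Theta κ) : 0 < θ.weight j₀ := by
  unfold Theta.weight; positivity

theorem Theta.weight_le_one (j₀ : RatVec κ → ℕ) (θ : Theta κ) : θ.weight j₀ ≤ 1 :=
  pow_le_one₀ (by norm_num) (by norm_num)

/-- The total degree `p (n_1 + … + n_m)` of a perturbation term. -/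
def Theta.degree (θ : Theta κ) : ℕ := θ.p * ∑ j, θ.n j

/-- The coefficient of the Gaussian variable with index `I` in a perturbation term. -/
def thetaCoeff (θ : Theta κ) (I : θ.Idx N) (σ : Config κ N) : ℝ :=
  (1 / √((N : ℝ) ^ θ.degree)) * ∏ j, ∏ a, spinSum (θ.vec j) σ (I j a)

theorem thetaH_eq_sum (g : DisorderIdx κ N → ℝ) (θ : Theta κ) (σ : Config κ N) :
    thetaH g θ σ = ∑ I : θ.Idx N, g (.inr ⟨θ, I⟩) * thetaCoeff θ I σ := by
  unfold thetaH thetaCoeff Theta.degree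
  rw [Finset.mul_sum]
  exact Finset.sum_congr rfl fun I _ => by ring

/-- Only the term for the common state of the spins in e can survive; this needs at least one spin,
that is p ≥ 1. -/
theorem abs_spinSum_le_one {p : ℕ} (hp : 1 ≤ p) {lam : Fin κ → ℝ} (hlam : ∀ k, |lam k| ≤ 1)
    (σ : Config κ N) (e : Fin p → Fin N) : |spinSum lam σ e| ≤ 1 := by
  unfold spinSum
  calc |∑ k, lam k * ∏ r, if σ (e r) = k then (1 : ℝ) else 0|
      ≤ ∑ k, |lam k * ∏ r, if σ (e r) = k then (1 : ℝ) else 0| := Finset.abs_sum_le_sum_abs _ _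
    _ ≤ ∑ k, if σ (e ⟨0, hp⟩) = k then (1 : ℝ) else 0 := Finset.sum_le_sum fun k _ => by
        rw [abs_mul, Finset.abs_prod]
        split_ifs with h
        · refine mul_le_one₀ (hlam k) (Finset.prod_nonneg fun _ _ => abs_nonneg _)
            (Finset.prod_le_one (fun _ _ => abs_nonneg _) fun r _ => ?_)
          split_ifs <;> simp
        · rw [Finset.prod_eq_zero (Finset.mem_univ (⟨0, hp⟩ : Fin p)) (by simp [h]), mul_zero]
    _ = 1 := by simp

theorem Theta.abs_vec_le_one (θ : Theta κ) (j : Fin θ.m) (k : Fin κ) : |θ.vec j k| ≤ 1 := by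
  have h := (θ.lam j k).2
  unfold Theta.vec
  rw [abs_le]
  exact ⟨by exact_mod_cast h.1, by exact_mod_cast h.2⟩

theorem abs_thetaCoeff_le (θ : Theta κ) (I : θ.Idx N) (σ : Config κ N) :
    |thetaCoeff θ I σ| ≤ 1 / √((N : ℝ) ^ θ.degree) := by
  unfold thetaCoeff
  rw [abs_mul, abs_of_nonneg (by positivity : 0 ≤ 1 / √((N : ℝ) ^ θ.degree)), Finset.abs_prod]
  refine mul_le_of_le_one_right (by positivity)
    (Finset.prod_le_one (fun _ _ => abs_nonneg _) fun j _ => ?_)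
  rw [Finset.abs_prod]
  exact Finset.prod_le_one (fun _ _ => abs_nonneg _) fun a _ =>
    abs_spinSum_le_one θ.one_le_p (θ.abs_vec_le_one j) _ _

theorem card_idx (θ : Theta κ) (N : ℕ) : Fintype.card (θ.Idx N) = N ^ θ.degree := by
  simp only [Theta.Idx, Fintype.card_pi, Finset.prod_const, Finset.card_univ, Fintype.card_fin,
    Theta.degree, ← pow_mul, Finset.prod_pow_eq_pow_sum, Finset.mul_sum]

theorem sum_idx_sq_bound (hN : 1 ≤ N) (θ : Theta κ) :
    ∑ _I : θ.Idx N, (1 / √((N : ℝ) ^ θ.degree)) ^ 2 = 1 := by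
  have : (0 : ℝ) < (N : ℝ) ^ θ.degree := by positivity
  rw [Finset.sum_const, Finset.card_univ, card_idx, nsmul_eq_mul, div_pow, Real.sq_sqrt this.le]
  push_cast
  field_simp

/-- For each pair of states the sum over e factorizes into p equal sums, each N times an entry of
the overlap matrix; this produces the Hadamard power. -/
theorem sum_spinSum_mul (p : ℕ) (lam : Fin κ → ℝ) (σ τ : Config κ N) :
    ∑ e : Fin p → Fin N, spinSum lam σ e * spinSum lam τ e =
      (N : ℝ) ^ p * hadamardForm p (overlap σ τ) lam := by
  rcases Nat.eq_zero_or_pos N with rfl | hN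
  · rcases Nat.eq_zero_or_pos p with rfl | hp
    · simp [spinSum, hadamardForm, Finset.sum_mul_sum]
    · have : IsEmpty (Fin p → Fin 0) := ⟨fun e => (e ⟨0, hp⟩).elim0⟩
      simp [hp.ne']
  have hN' : (N : ℝ) ≠ 0 := by positivity
  have h1 : ∀ k k', ∑ e : Fin p → Fin N, (∏ r, if σ (e r) = k then (1 : ℝ) else 0) *
      (∏ r, if τ (e r) = k' then (1 : ℝ) else 0) = (N : ℝ) ^ p * overlap σ τ k k' ^ p := by
    intro k k'
    simp only [← Finset.prod_mul_distrib]
    rw [← mul_pow, overlap, ← mul_assoc, mul_one_div_cancel hN', one_mul]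
    exact (Fintype.sum_pow (fun i => (if σ i = k then (1 : ℝ) else 0) *
      (if τ i = k' then (1 : ℝ) else 0)) p).symm
  unfold spinSum hadamardForm
  simp only [Finset.sum_mul_sum]
  simp only [Finset.mul_sum]
  rw [Finset.sum_comm]
  refine Finset.sum_congr rfl fun k _ => ?_
  rw [Finset.sum_comm]
  refine Finset.sum_congr rfl fun k' _ => ?_
  rw [← mul_assoc, ← mul_assoc, ← h1 k k', Finset.sum_mul, Finset.sum_mul]
  exact Finset.sum_congr rfl fun e _ => by ring

/-- The covariance of the perturbation terms is `C^θ` of the overlap matrix. -/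
theorem sum_thetaCoeff_mul (hN : 1 ≤ N) (θ : Theta κ) (σ τ : Config κ N) :
    ∑ I : θ.Idx N, thetaCoeff θ I σ * thetaCoeff θ I τ = covTheta θ (overlap σ τ) := by
  have hpos : (0 : ℝ) < (N : ℝ) ^ θ.degree := by positivity
  have h1 : ∑ I : θ.Idx N, (∏ j, ∏ a, spinSum (θ.vec j) σ (I j a)) *
      (∏ j, ∏ a, spinSum (θ.vec j) τ (I j a)) =
      (N : ℝ) ^ θ.degree * covTheta θ (overlap σ τ) := by
    simp only [← Finset.prod_mul_distrib]
    have h2 : ∀ j, ∑ x : Fin (θ.n j) → Fin θ.p → Fin N,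
        ∏ a, spinSum (θ.vec j) σ (x a) * spinSum (θ.vec j) τ (x a) =
        ((N : ℝ) ^ θ.p * hadamardForm θ.p (overlap σ τ) (θ.vec j)) ^ θ.n j := fun j => by
      rw [← sum_spinSum_mul]
      exact (Fintype.sum_pow (fun e => spinSum (θ.vec j) σ e * spinSum (θ.vec j) τ e) _).symm
    have h3 := (Fintype.prod_sum (κ := fun j : Fin θ.m => Fin (θ.n j) → Fin θ.p → Fin N)
      (fun j (x : Fin (θ.n j) → Fin θ.p → Fin N) =>
        ∏ a, spinSum (θ.vec j) σ (x a) * spinSum (θ.vec j) τ (x a)))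
    rw [← h3]
    simp only [h2]
    simp only [mul_pow, Finset.prod_mul_distrib, ← pow_mul, Finset.prod_pow_eq_pow_sum,
      Theta.degree, Finset.mul_sum, covTheta]
  have h4 : ∀ I : θ.Idx N, thetaCoeff θ I σ * thetaCoeff θ I τ = ((N : ℝ) ^ θ.degree)⁻¹ *
      ((∏ j, ∏ a, spinSum (θ.vec j) σ (I j a)) * (∏ j, ∏ a, spinSum (θ.vec j) τ (I j a))) :=
    fun I => by
      unfold thetaCoeff
      rw [← Real.sq_sqrt hpos.le]
      have : √((N : ℝ) ^ θ.degree) ≠ 0 := (Real.sqrt_pos.2 hpos).ne'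
      rw [Real.sq_sqrt hpos.le]
      nth_rw 3 [← Real.sq_sqrt hpos.le]
      field_simp
  simp only [h4, ← Finset.mul_sum, h1]
  field_simp

theorem abs_covTheta_overlap_le_one (hN : 1 ≤ N) (θ : Theta κ) (σ τ : Config κ N) :
    |covTheta θ (overlap σ τ)| ≤ 1 := by
  rw [← sum_thetaCoeff_mul hN, ← sum_idx_sq_bound hN θ]
  refine (Finset.abs_sum_le_sum_abs _ _).trans (Finset.sum_le_sum fun I _ => ?_)
  rw [abs_mul, sq]
  exact mul_le_mul (abs_thetaCoeff_le θ I σ) (abs_thetaCoeff_le θ I τ) (abs_nonneg _)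
    (by positivity)

/-- This is what the restriction to fixed state sizes buys: the self-overlap is not random. -/
theorem overlap_self (hN : 1 ≤ N) {d : Fin κ → ℝ} {σ : Config κ N} (hσ : σ ∈ stateSet N d) :
    overlap σ σ = fun k k' => if k = k' then d k else 0 := by
  have hN' : (N : ℝ) ≠ 0 := by positivity
  ext k k'
  unfold overlap
  split_ifs with h
  · subst h
    have h1 : ∀ i, (if σ i = k then (1 : ℝ) else 0) * (if σ i = k then 1 else 0) =
      if σ i = k then (1 : ℝ) else 0 := fun i => by split_ifs <;> simp
    simp only [h1]
    rw [hσ k]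
    field_simp
  · rw [Finset.sum_eq_zero, mul_zero]
    intro i _
    split_ifs with h1 h2 <;> simp_all

end Coefficients

/-! ### Summability of the weights of the perturbation. -/

section Weights

variable {κ : ℕ}

/-- Injectivity of `j₀` lets each θ be encoded by p, m and the pairs (n_j, j₀(λ^j)). Over these
codes the weight is a product, so sums over boxes factor into geometric series. -/
theorem summable_weight {j₀ : RatVec κ → ℕ} (hj₀ : Function.Injective j₀) :
    Summable fun θ : Theta κ => θ.weight j₀ := by
  have hr : ∀ M : ℕ, ∑ n ∈ Finset.range M, (2 : ℝ)⁻¹ ^ n ≤ 2 := fun M => by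
    have h := (summable_geometric_of_lt_one (r := (2 : ℝ)⁻¹) (by norm_num)
      (by norm_num)).sum_le_tsum (Finset.range M) (fun _ _ => by positivity)
    rw [tsum_geometric_of_lt_one (by norm_num) (by norm_num)] at h
    exact h.trans (by norm_num)
  let wt : (ℕ × (Σ m : ℕ, Fin m → ℕ × ℕ)) → ℝ := fun x => (2 : ℝ)⁻¹ ^ x.1 *
    ∏ j, ((2 : ℝ)⁻¹ ^ (x.2.2 j).1 * (2 : ℝ)⁻¹ ^ (x.2.2 j).2 * (2 : ℝ)⁻¹ ^ 4)
  let emb : Theta κ → ℕ × (Σ m : ℕ, Fin m → ℕ × ℕ) := fun θ => (θ.p, ⟨θ.m, fun j => (θ.n j, j₀ (θ.lam j))⟩)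
  have hemb : Function.Injective emb := by
    rintro ⟨p, m, n, lam, _, _, _⟩ ⟨p', m', n', lam', _, _, _⟩ h
    simp only [emb, Prod.mk.injEq, Sigma.mk.injEq] at h
    obtain ⟨rfl, rfl, h⟩ := h
    simp only [heq_eq_eq, funext_iff, Prod.mk.injEq] at h
    obtain rfl : n = n' := funext fun j => (h j).1
    obtain rfl : lam = lam' := funext fun j => hj₀ (h j).2
    rfl
  have hwt : (fun θ : Theta κ => θ.weight j₀) = wt ∘ emb := by
    ext θ
    simp only [Theta.weight, Theta.exponent, wt, emb, Function.comp, pow_add,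
      Finset.prod_mul_distrib, Finset.prod_pow_eq_pow_sum, Finset.sum_const, Finset.card_univ,
      Fintype.card_fin, smul_eq_mul, mul_comm 4 θ.m]
    ring
  rw [hwt]
  refine Summable.comp_injective ?_ hemb
  have hnn : ∀ x, 0 ≤ wt x := fun x => by positivity
  refine summable_of_sum_le hnn (c := 4) fun s => ?_
  obtain ⟨M, hM⟩ : ∃ M : ℕ, ∀ x ∈ s, x.1 < M ∧ x.2.1 < M ∧ ∀ j, (x.2.2 j).1 < M ∧
      (x.2.2 j).2 < M := by
    refine ⟨∑ x ∈ s, (x.1 + x.2.1 + ∑ j, ((x.2.2 j).1 + (x.2.2 j).2)) + 1, fun x hx => ?_⟩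
    have h1 := Finset.single_le_sum (f := fun x : ℕ × (Σ m : ℕ, Fin m → ℕ × ℕ) => x.1 + x.2.1 + ∑ j, ((x.2.2 j).1 +
      (x.2.2 j).2)) (fun _ _ => Nat.zero_le _) hx
    refine ⟨by omega, by omega, fun j => ?_⟩
    have h2 := Finset.single_le_sum (f := fun j => (x.2.2 j).1 + (x.2.2 j).2)
      (fun _ _ => Nat.zero_le _) (Finset.mem_univ j)
    constructor <;> omega
  let B : Finset (ℕ × ℕ) := Finset.range M ×ˢ Finset.range M
  let big : Finset (ℕ × (Σ m : ℕ, Fin m → ℕ × ℕ)) := Finset.range M ×ˢ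
    (Finset.range M).sigma fun m => Fintype.piFinset fun _ : Fin m => B
  have hsub : s ⊆ big := fun x hx => by
    obtain ⟨h1, h2, h3⟩ := hM x hx
    simp only [big, B, Finset.mem_product, Finset.mem_range, Finset.mem_sigma,
      Fintype.mem_piFinset]
    exact ⟨h1, h2, h3⟩
  refine (Finset.sum_le_sum_of_subset_of_nonneg hsub fun x _ _ => hnn x).trans ?_
  -- The two geometric sums contribute at most 4, so without the summand 4m in the exponent the
  -- series over m would not be controlled; with it the ratio is at most 4/16.
  have hB : ∑ b ∈ B, ((2 : ℝ)⁻¹ ^ b.1 * (2 : ℝ)⁻¹ ^ b.2 * (2 : ℝ)⁻¹ ^ 4) ≤ 2⁻¹ := by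
    rw [← Finset.sum_mul, Finset.sum_product, ← Finset.sum_mul_sum]
    have h0 : 0 ≤ ∑ n ∈ Finset.range M, (2 : ℝ)⁻¹ ^ n := Finset.sum_nonneg fun _ _ => by positivity
    have := mul_le_mul (hr M) (hr M) h0 (by norm_num)
    norm_num at this ⊢
    linarith
  have hB0 : 0 ≤ ∑ b ∈ B, ((2 : ℝ)⁻¹ ^ b.1 * (2 : ℝ)⁻¹ ^ b.2 * (2 : ℝ)⁻¹ ^ 4) :=
    Finset.sum_nonneg fun _ _ => by positivity
  calc ∑ x ∈ big, wt x = (∑ p ∈ Finset.range M, (2 : ℝ)⁻¹ ^ p) * ∑ m ∈ Finset.range M,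
        (∑ b ∈ B, ((2 : ℝ)⁻¹ ^ b.1 * (2 : ℝ)⁻¹ ^ b.2 * (2 : ℝ)⁻¹ ^ 4)) ^ m := by
        simp only [big, wt]
        rw [Finset.sum_product, Finset.sum_mul_sum]
        refine Finset.sum_congr rfl fun p _ => ?_
        rw [Finset.sum_sigma]
        refine Finset.sum_congr rfl fun m _ => ?_
        simp only
        rw [← Finset.mul_sum]
        congr 1
        have h := Finset.prod_univ_sum (fun _ : Fin m => B) (fun _ b =>
          ((2 : ℝ)⁻¹ ^ b.1 * (2 : ℝ)⁻¹ ^ b.2 * (2 : ℝ)⁻¹ ^ 4))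
        rw [← h]
        simp only [Finset.prod_const, Finset.card_univ, Fintype.card_fin]
    _ ≤ 2 * ∑ m ∈ Finset.range M, (2 : ℝ)⁻¹ ^ m :=
        mul_le_mul (hr M) (Finset.sum_le_sum fun m _ => pow_le_pow_left₀ hB0 hB m)
          (Finset.sum_nonneg fun m _ => pow_nonneg hB0 m) (by norm_num)
    _ ≤ 4 := by linarith [hr M]

end Weights

/-! ### The perturbed Hamiltonian as a function of the disorder. -/

section Model

variable {κ N : ℕ}

open Classical in
/-- The indicator of the set of configurations with state sizes `d`, as reference weights. -/
def sizeRef (N : ℕ) (d : Fin κ → ℝ) (σ : Config κ N) : ℝ := if σ ∈ stateSet N d then 1 else 0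

theorem isRef_sizeRef (d : stateSizes κ N) : IsRef (sizeRef N (d : Fin κ → ℝ)) := by
  classical
  refine ⟨fun σ => ?_, ?_⟩
  · unfold sizeRef; split_ifs <;> norm_num
  · obtain ⟨σ, hσ⟩ := d.2.2
    exact ⟨σ, by simp [sizeRef, hσ]⟩

theorem gibbsWeight_eq_gW (γ : ℝ) (j₀ : RatVec κ → ℕ) (u : Theta κ → ℝ) (d : Fin κ → ℝ)
    (g : DisorderIdx κ N → ℝ) (σ : Config κ N) :
    gibbsWeight γ j₀ u d g σ = gW (sizeRef N d) (perturbedH γ j₀ u g) σ := by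
  unfold gibbsWeight gW gZ partitionZ sizeRef
  split_ifs <;> simp

theorem gW_sizeRef_of_notMem {d : Fin κ → ℝ} (H : Config κ N → ℝ) {σ : Config κ N}
    (hσ : σ ∉ stateSet N d) : gW (sizeRef N d) H σ = 0 := by
  simp [gW, sizeRef, hσ]

/-- The coefficient of a Gaussian variable in the perturbed Hamiltonian. -/
def disorderCoeff (γ : ℝ) (j₀ : RatVec κ → ℕ) (u : Theta κ → ℝ) (α : DisorderIdx κ N)
    (σ : Config κ N) : ℝ :=
  match α with
  | .inl q => (1 / √(N : ℝ)) * if σ q.1 = σ q.2 then 1 else 0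
  | .inr ⟨θ, I⟩ => (N : ℝ) ^ γ * (θ.weight j₀ * u θ * thetaCoeff θ I σ)

theorem pottsH_eq_sum (g : DisorderIdx κ N → ℝ) (σ : Config κ N) :
    pottsH g σ = ∑ q : Fin N × Fin N, g (.inl q) *
      ((1 / √(N : ℝ)) * if σ q.1 = σ q.2 then 1 else 0) := by
  unfold pottsH
  rw [Fintype.sum_prod_type, Finset.mul_sum]
  refine Finset.sum_congr rfl fun i _ => ?_
  rw [Finset.mul_sum]
  exact Finset.sum_congr rfl fun j _ => by ring

theorem perturbedH_eq (γ : ℝ) (j₀ : RatVec κ → ℕ) (u : Theta κ → ℝ)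
    (g : DisorderIdx κ N → ℝ) (σ : Config κ N) :
    perturbedH γ j₀ u g σ = pottsH g σ +
      (N : ℝ) ^ γ * ∑' θ : Theta κ, θ.weight j₀ * u θ * thetaH g θ σ := rfl

theorem sum_update_mul {ι β : Type*} [DecidableEq ι] [Fintype β] {f : β → ι}
    (hf : Function.Injective f) (g : ι → ℝ) (c : β → ℝ) (b : β) (t : ℝ) :
    ∑ b', Function.update g (f b) t (f b') * c b' =
      ∑ b', g (f b') * c b' + (t - g (f b)) * c b := by
  classical
  rw [← sub_eq_iff_eq_add', ← Finset.sum_sub_distrib, Finset.sum_eq_single b]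
  · simp; ring
  · intro b' _ hb
    rw [Function.update_of_ne (hf.ne hb)]; ring
  · simp

section Update

variable [DecidableEq (DisorderIdx κ N)] (γ : ℝ) (j₀ : RatVec κ → ℕ) (u : Theta κ → ℝ)
  (g : DisorderIdx κ N → ℝ)

theorem pottsH_update_inl (q : Fin N × Fin N) (t : ℝ) (σ : Config κ N) :
    pottsH (Function.update g (.inl q) t) σ = pottsH g σ +
      (t - g (.inl q)) * ((1 / √(N : ℝ)) * if σ q.1 = σ q.2 then 1 else 0) := by
  rw [pottsH_eq_sum, pottsH_eq_sum]
  exact sum_update_mul Sum.inl_injective g _ q t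

theorem pottsH_update_inr (a : Σ θ : Theta κ, θ.Idx N) (t : ℝ) (σ : Config κ N) :
    pottsH (Function.update g (.inr a) t) σ = pottsH g σ := by
  rw [pottsH_eq_sum, pottsH_eq_sum]
  simp

theorem thetaH_update_inl (q : Fin N × Fin N) (t : ℝ) (θ : Theta κ) (σ : Config κ N) :
    thetaH (Function.update g (.inl q) t) θ σ = thetaH g θ σ := by
  rw [thetaH_eq_sum, thetaH_eq_sum]
  simp

theorem thetaH_update_of_ne {θ θ' : Theta κ} (h : θ' ≠ θ) (I : θ.Idx N) (t : ℝ)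
    (σ : Config κ N) :
    thetaH (Function.update g (.inr ⟨θ, I⟩) t) θ' σ = thetaH g θ' σ := by
  rw [thetaH_eq_sum, thetaH_eq_sum]
  refine Finset.sum_congr rfl fun J _ => ?_
  rw [Function.update_of_ne]
  intro h'
  simp only [Sum.inr.injEq, Sigma.mk.injEq] at h'
  exact h h'.1

theorem thetaH_update_self (θ : Theta κ) (I : θ.Idx N) (t : ℝ) (σ : Config κ N) :
    thetaH (Function.update g (.inr ⟨θ, I⟩) t) θ σ =
      thetaH g θ σ + (t - g (.inr ⟨θ, I⟩)) * thetaCoeff θ I σ := by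
  rw [thetaH_eq_sum, thetaH_eq_sum]
  exact sum_update_mul (f := fun I : θ.Idx N => (.inr ⟨θ, I⟩ : DisorderIdx κ N))
    (fun I J h => by simpa using h) g _ I t

theorem perturbedH_update_of_summable (σ : Config κ N)
    (hs : Summable fun θ : Theta κ => θ.weight j₀ * u θ * thetaH g θ σ)
    (α : DisorderIdx κ N) (t : ℝ) :
    perturbedH γ j₀ u (Function.update g α t) σ =
      perturbedH γ j₀ u g σ + (t - g α) * disorderCoeff γ j₀ u α σ := by
  classical
  rcases α with q | ⟨θ, I⟩
  · simp only [perturbedH_eq, pottsH_update_inl, thetaH_update_inl, disorderCoeff]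
    ring
  · have h : (fun θ' : Theta κ => θ'.weight j₀ * u θ' *
        thetaH (Function.update g (.inr ⟨θ, I⟩) t) θ' σ) =
        fun θ' => θ'.weight j₀ * u θ' * thetaH g θ' σ + (Pi.single θ
          (θ.weight j₀ * u θ * ((t - g (.inr ⟨θ, I⟩)) * thetaCoeff θ I σ)) : Theta κ → ℝ) θ' := by
      ext θ'
      by_cases hθ : θ' = θ
      · subst hθ
        rw [thetaH_update_self, Pi.single_eq_same]; ring
      · rw [thetaH_update_of_ne _ hθ, Pi.single_eq_of_ne hθ, add_zero]
    simp only [perturbedH_eq, pottsH_update_inr, h, disorderCoeff]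
    rw [hs.tsum_add (hasSum_pi_single θ _).summable, tsum_pi_single]
    ring

/-- The bound must hold for every g for use in Efron–Stein. Changing one Gaussian variable alters at
most one term of the series, so a divergent series stays divergent and both values of `tsum` are the
default 0. -/
theorem abs_perturbedH_update_sub_le (σ : Config κ N) (α : DisorderIdx κ N) (t : ℝ) :
    |perturbedH γ j₀ u (Function.update g α t) σ - perturbedH γ j₀ u g σ| ≤
      |t - g α| * |disorderCoeff γ j₀ u α σ| := by
  classical
  by_cases hs : Summable fun θ : Theta κ => θ.weight j₀ * u θ * thetaH g θ σ
  · rw [perturbedH_update_of_summable γ j₀ u g σ hs, add_sub_cancel_left, abs_mul]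
  rcases α with q | ⟨θ, I⟩
  · simp only [perturbedH_eq, pottsH_update_inl, thetaH_update_inl, disorderCoeff]
    rw [← abs_mul]
    exact le_of_eq (by congr 1; ring)
  · have hs' : ¬ Summable fun θ' : Theta κ => θ'.weight j₀ * u θ' *
        thetaH (Function.update g (.inr ⟨θ, I⟩) t) θ' σ := by
      refine fun h => hs ((summable_congr_cofinite ?_).1 h)
      refine (Set.finite_singleton θ).subset fun θ' hθ' => ?_
      by_contra hne
      refine hθ' ?_
      simp only [Set.mem_ofPred_eq]
      rw [thetaH_update_of_ne g hne]
    simp only [perturbedH_eq, pottsH_update_inr, tsum_eq_zero_of_not_summable hs,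
      tsum_eq_zero_of_not_summable hs', sub_self, abs_zero]
    positivity

end Update

/-- The disorder for which the perturbation series converges absolutely. -/
def IsGood (j₀ : RatVec κ → ℕ) (g : DisorderIdx κ N → ℝ) : Prop :=
  ∀ σ : Config κ N, Summable fun θ : Theta κ => θ.weight j₀ * |thetaH g θ σ|

theorem IsGood.summable {j₀ : RatVec κ → ℕ} {g : DisorderIdx κ N → ℝ} (hg : IsGood j₀ g)
    {u : Theta κ → ℝ} {b : ℝ} (hu : ∀ θ, |u θ| ≤ b) (σ : Config κ N) :
    Summable fun θ : Theta κ => θ.weight j₀ * u θ * thetaH g θ σ := by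
  refine ((hg σ).mul_left b).of_norm_bounded fun θ => ?_
  rw [Real.norm_eq_abs, abs_mul, abs_mul, abs_of_pos (θ.weight_pos j₀)]
  have h1 := mul_le_mul_of_nonneg_right (hu θ)
    (mul_nonneg (θ.weight_pos j₀).le (abs_nonneg (thetaH g θ σ)))
  calc _ = |u θ| * (θ.weight j₀ * |thetaH g θ σ|) := by ring
    _ ≤ _ := h1

theorem measurable_thetaH (θ : Theta κ) (σ : Config κ N) :
    Measurable fun g : DisorderIdx κ N → ℝ => thetaH g θ σ := by
  unfold thetaH; fun_prop

theorem disorderLaw_eq : disorderLaw κ N = gaussPi (DisorderIdx κ N) := rfl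

instance : IsProbabilityMeasure (disorderLaw κ N) := by
  rw [disorderLaw_eq]; infer_instance

theorem integrable_thetaH (θ : Theta κ) (σ : Config κ N) :
    Integrable (fun g : DisorderIdx κ N → ℝ => thetaH g θ σ) (disorderLaw κ N) := by
  simp only [thetaH_eq_sum]
  exact integrable_finsetSum _ fun I _ => (integrable_eval_gaussPi _).mul_const _

theorem integral_abs_thetaH_le (hN : 1 ≤ N) (θ : Theta κ) (σ : Config κ N) :
    ∫ g, |thetaH g θ σ| ∂disorderLaw κ N ≤ 1 := by
  obtain ⟨h1, h2⟩ := integral_sq_linear_gaussPi (Finset.univ : Finset (θ.Idx N))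
    (f := fun I : θ.Idx N => (.inr ⟨θ, I⟩ : DisorderIdx κ N))
    (fun I J h => by simpa using h) (fun I => thetaCoeff θ I σ)
  simp only [← thetaH_eq_sum] at h1 h2
  have h3 : ∑ I : θ.Idx N, thetaCoeff θ I σ ^ 2 ≤ 1 := by
    simp only [sq, sum_thetaCoeff_mul hN]
    exact (le_abs_self _).trans (abs_covTheta_overlap_le_one hN θ σ σ)
  have h4 : ∫ g, |thetaH g θ σ| ∂disorderLaw κ N ≤
      ∫ g, (1 / 2 + 1 / 2 * thetaH g θ σ ^ 2) ∂disorderLaw κ N := by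
    refine integral_mono (integrable_thetaH θ σ).abs
      ((integrable_const _).add (h1.const_mul _)) fun g => ?_
    simp only
    rw [← sq_abs (thetaH g θ σ)]
    nlinarith [sq_nonneg (|thetaH g θ σ| - 1)]
  refine h4.trans ?_
  rw [disorderLaw_eq, integral_add (integrable_const _) (h1.const_mul _), integral_const_mul, h2]
  simp
  linarith

variable {j₀ : RatVec κ → ℕ} (hj₀ : Function.Injective j₀) (hN : 1 ≤ N)
include hj₀ hN

/-- Each E|h_θ| is at most 1, so the expected sum is bounded by the summable weights, which also
forces convergence almost surely. -/
theorem integrable_tsum_thetaH (σ : Config κ N) :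
    (∀ᵐ g ∂disorderLaw κ N, Summable fun θ : Theta κ => θ.weight j₀ * |thetaH g θ σ|) ∧
    Integrable (fun g : DisorderIdx κ N → ℝ => ∑' θ : Theta κ, θ.weight j₀ * |thetaH g θ σ|)
      (disorderLaw κ N) := by
  have hm : ∀ θ : Theta κ, Measurable fun g : DisorderIdx κ N → ℝ =>
      ENNReal.ofReal (θ.weight j₀ * |thetaH g θ σ|) := fun θ =>
    (((measurable_thetaH θ σ).abs).const_mul _).ennreal_ofReal
  have hle : ∀ θ : Theta κ, ∫⁻ g, ENNReal.ofReal (θ.weight j₀ * |thetaH g θ σ|)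
      ∂disorderLaw κ N ≤ ENNReal.ofReal (θ.weight j₀) := fun θ => by
    rw [← ofReal_integral_eq_lintegral_ofReal ((integrable_thetaH θ σ).abs.const_mul _)
      (.of_forall fun g => mul_nonneg (θ.weight_pos j₀).le (abs_nonneg _)), integral_const_mul]
    exact ENNReal.ofReal_le_ofReal
      (mul_le_of_le_one_right (θ.weight_pos j₀).le (integral_abs_thetaH_le hN θ σ))
  have hfin : ∫⁻ g, ∑' θ : Theta κ, ENNReal.ofReal (θ.weight j₀ * |thetaH g θ σ|)
      ∂disorderLaw κ N ≠ ⊤ := by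
    rw [lintegral_tsum fun θ => (hm θ).aemeasurable]
    exact ne_top_of_le_ne_top (summable_weight hj₀).tsum_ofReal_ne_top (ENNReal.tsum_le_tsum hle)
  have hnn : ∀ g : DisorderIdx κ N → ℝ, ∀ θ : Theta κ, 0 ≤ θ.weight j₀ * |thetaH g θ σ| :=
    fun g θ => mul_nonneg (θ.weight_pos j₀).le (abs_nonneg _)
  have hae : ∀ᵐ g ∂disorderLaw κ N,
      Summable fun θ : Theta κ => θ.weight j₀ * |thetaH g θ σ| := by
    filter_upwards [ae_lt_top (Measurable.tsum hm) hfin] with g hg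
    have := ENNReal.summable_toReal hg.ne
    simpa [ENNReal.toReal_ofReal (hnn g _)] using this
  refine ⟨hae, ⟨(Measurable.tsum fun θ =>
    ((measurable_thetaH θ σ).abs).const_mul _).aestronglyMeasurable, ?_⟩⟩
  rw [hasFiniteIntegral_iff_ofReal (.of_forall fun g => tsum_nonneg (hnn g))]
  refine lt_of_le_of_lt (lintegral_mono_ae ?_) hfin.lt_top
  filter_upwards [hae] with g hg
  rw [ENNReal.ofReal_tsum_of_nonneg (hnn g) hg]

theorem ae_isGood : ∀ᵐ g ∂disorderLaw κ N, IsGood j₀ g :=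
  ae_all_iff.2 fun σ => (integrable_tsum_thetaH hj₀ hN σ).1

theorem integrable_perturbedH (γ : ℝ) {u : Theta κ → ℝ} {b : ℝ} (hu : ∀ θ, |u θ| ≤ b)
    (σ : Config κ N) :
    Integrable (fun g : DisorderIdx κ N → ℝ => perturbedH γ j₀ u g σ) (disorderLaw κ N) := by
  simp only [perturbedH_eq]
  refine Integrable.add ?_ (Integrable.const_mul ?_ _)
  · simp only [pottsH_eq_sum]
    exact integrable_finsetSum _ fun q _ => (integrable_eval_gaussPi _).mul_const _
  · refine ((integrable_tsum_thetaH hj₀ hN σ).2.const_mul b).mono'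
      (Measurable.tsum fun θ => (measurable_thetaH θ σ).const_mul _).aestronglyMeasurable ?_
    filter_upwards [ae_isGood hj₀ hN] with g hg
    have hs := hg.summable hu σ
    refine (norm_tsum_le_tsum_norm hs.norm).trans ?_
    rw [← tsum_mul_left]
    refine hs.norm.tsum_le_tsum (fun θ => ?_) ((hg σ).mul_left b)
    rw [Real.norm_eq_abs, abs_mul, abs_mul, abs_of_pos (θ.weight_pos j₀)]
    calc _ = |u θ| * (θ.weight j₀ * |thetaH g θ σ|) := by ring
      _ ≤ _ := mul_le_mul_of_nonneg_right (hu θ)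
        (mul_nonneg (θ.weight_pos j₀).le (abs_nonneg (thetaH g θ σ)))

end Model

/-! ### Concentration of the free energy. -/

section FreeEnergy

variable {κ N : ℕ}

/-- A bound for the coefficient of a Gaussian variable, uniform over all configurations. -/
def coeffBound (γ : ℝ) (j₀ : RatVec κ → ℕ) (b : ℝ) : DisorderIdx κ N → ℝ
  | .inl _ => 1 / √(N : ℝ)
  | .inr ⟨θ, _⟩ => (N : ℝ) ^ γ * (θ.weight j₀ * b * (1 / √((N : ℝ) ^ θ.degree)))

theorem abs_disorderCoeff_le (γ : ℝ) (j₀ : RatVec κ → ℕ) {u : Theta κ → ℝ} {b : ℝ}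
    (hu : ∀ θ, |u θ| ≤ b) (α : DisorderIdx κ N) (σ : Config κ N) :
    |disorderCoeff γ j₀ u α σ| ≤ coeffBound γ j₀ b α := by
  rcases α with q | ⟨θ, I⟩
  · simp only [disorderCoeff, coeffBound]
    rw [abs_mul, abs_of_nonneg (by positivity : 0 ≤ 1 / √(N : ℝ))]
    refine mul_le_of_le_one_right (by positivity) ?_
    split_ifs <;> simp
  · simp only [disorderCoeff, coeffBound]
    have hw := (θ.weight_pos j₀).le
    rw [abs_mul, abs_mul, abs_mul, abs_of_nonneg hw,
      abs_of_nonneg (by positivity : 0 ≤ (N : ℝ) ^ γ)]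
    have h1 := hu θ
    have h2 := abs_thetaCoeff_le θ I σ
    have hb : 0 ≤ b := (abs_nonneg _).trans h1
    gcongr

/-- The indices of the Potts Hamiltonian and of the perturbation terms in `T`. -/
def blockIdx (N : ℕ) (T : Finset (Theta κ)) : Finset (DisorderIdx κ N) :=
  Finset.univ.disjSum (T.sigma fun _ => Finset.univ)

/-- The N² Potts couplings contribute 1/N each; in the term θ the number of indices N^degree cancels
the normalization. -/
theorem sum_coeffBound_sq (hN : 1 ≤ N) (γ : ℝ) (j₀ : RatVec κ → ℕ) (b : ℝ)
    (T : Finset (Theta κ)) :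
    ∑ α ∈ blockIdx N T, coeffBound γ j₀ b α ^ 2 =
      N + ∑ θ ∈ T, ((N : ℝ) ^ γ * (θ.weight j₀ * b)) ^ 2 := by
  unfold blockIdx
  rw [Finset.sum_disjSum, Finset.sum_sigma]
  congr 1
  · simp only [coeffBound, Finset.sum_const, Finset.card_univ, Fintype.card_prod,
      Fintype.card_fin, nsmul_eq_mul, div_pow, one_pow]
    rw [Real.sq_sqrt (by positivity)]
    have : (N : ℝ) ≠ 0 := by positivity
    push_cast
    field_simp
  · refine Finset.sum_congr rfl fun θ _ => ?_
    have h := sum_idx_sq_bound hN θ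
    simp only [coeffBound]
    calc _ = ∑ _I : θ.Idx N, ((N : ℝ) ^ γ * (θ.weight j₀ * b)) ^ 2 *
          (1 / √((N : ℝ) ^ θ.degree)) ^ 2 := Finset.sum_congr rfl fun I _ => by ring
      _ = _ := by rw [← Finset.mul_sum, h, mul_one]

open Classical in
theorem perturbedH_mix_blockIdx (γ : ℝ) (j₀ : RatVec κ → ℕ) {u : Theta κ → ℝ} {b : ℝ}
    (hu : ∀ θ, |u θ| ≤ b) {g g' : DisorderIdx κ N → ℝ} (hg : IsGood j₀ g) (σ : Config κ N)
    (T : Finset (Theta κ)) :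
    perturbedH γ j₀ u (mix (blockIdx N T) g g') σ = pottsH g' σ + (N : ℝ) ^ γ *
      (∑' θ : Theta κ, θ.weight j₀ * u θ * thetaH g θ σ +
        ∑ θ ∈ T, (θ.weight j₀ * u θ * thetaH g' θ σ - θ.weight j₀ * u θ * thetaH g θ σ)) := by
  have h1 : pottsH (mix (blockIdx N T) g g') σ = pottsH g' σ := by
    rw [pottsH_eq_sum, pottsH_eq_sum]
    simp [mix, blockIdx]
  have h2 : ∀ θ, thetaH (mix (blockIdx N T) g g') θ σ =
      if θ ∈ T then thetaH g' θ σ else thetaH g θ σ := fun θ => by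
    simp only [thetaH_eq_sum]
    split_ifs with h <;> simp [mix, blockIdx, h]
  have h3 : (fun θ : Theta κ => θ.weight j₀ * u θ * thetaH (mix (blockIdx N T) g g') θ σ) =
      fun θ => θ.weight j₀ * u θ * thetaH g θ σ + (if θ ∈ T then (θ.weight j₀ * u θ *
        thetaH g' θ σ - θ.weight j₀ * u θ * thetaH g θ σ) else 0) := by
    ext θ
    rw [h2]
    split_ifs <;> ring
  rw [perturbedH_eq, h1, h3, (hg.summable hu σ).tsum_add
    (summable_of_ne_finset_zero (s := T) fun θ hθ => if_neg hθ),
    tsum_eq_sum (s := T) fun θ hθ => if_neg hθ]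
  congr 3
  exact Finset.sum_congr rfl fun θ hθ => if_pos hθ

-- Efron–Stein exchanges only finitely many coordinates. This limit passes from finite exchanges to
-- a completely independent copy.
open Classical in
theorem tendsto_perturbedH_mix (γ : ℝ) (j₀ : RatVec κ → ℕ) {u : Theta κ → ℝ} {b : ℝ}
    (hu : ∀ θ, |u θ| ≤ b) {g g' : DisorderIdx κ N → ℝ} (hg : IsGood j₀ g) (hg' : IsGood j₀ g')
    (σ : Config κ N) :
    Tendsto (fun T : Finset (Theta κ) => perturbedH γ j₀ u (mix (blockIdx N T) g g') σ) atTop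
      (𝓝 (perturbedH γ j₀ u g' σ)) := by
  simp only [perturbedH_mix_blockIdx γ j₀ hu hg σ]
  have h := ((hg'.summable hu σ).hasSum).sub ((hg.summable hu σ).hasSum)
  have h2 := ((h.const_add (∑' θ : Theta κ, θ.weight j₀ * u θ * thetaH g θ σ)).const_mul
    ((N : ℝ) ^ γ)).const_add (pottsH g' σ)
  rw [add_sub_cancel] at h2
  simpa [perturbedH_eq] using h2

/-- The free energy `log Z`. -/
def freeEnergy (γ : ℝ) (j₀ : RatVec κ → ℕ) (u : Theta κ → ℝ) (d : Fin κ → ℝ)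
    (g : DisorderIdx κ N → ℝ) : ℝ :=
  Real.log (gZ (sizeRef N d) (perturbedH γ j₀ u g))

theorem measurable_freeEnergy (γ : ℝ) (j₀ : RatVec κ → ℕ) (u : Theta κ → ℝ) (d : Fin κ → ℝ) :
    Measurable fun g : DisorderIdx κ N → ℝ => freeEnergy γ j₀ u d g :=
  (measurable_gZ _ fun σ => measurable_perturbedH γ j₀ u σ).log

/-- The Efron–Stein bound on finite blocks is uniform in the block, since N^{2γ} ≤ N and the weights
are summable and at most 1. Fatou's lemma carries it to the full exchange. -/
theorem sq_sub_freeEnergy_le {j₀ : RatVec κ → ℕ} (hj₀ : Function.Injective j₀) (hN : 1 ≤ N)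
    {γ : ℝ} (hγ : γ ≤ 1 / 2) {u : Theta κ → ℝ} {b : ℝ} (hu : ∀ θ, |u θ| ≤ b)
    (d : stateSizes κ N) :
    ∫⁻ p, ENNReal.ofReal ((freeEnergy γ j₀ u d p.1 - freeEnergy γ j₀ u d p.2) ^ 2)
      ∂(disorderLaw κ N).prod (disorderLaw κ N) ≤
    ENNReal.ofReal (2 * (1 + b ^ 2 * ∑' θ : Theta κ, θ.weight j₀) * N) := by
  classical
  have he := isRef_sizeRef d
  have hN1 : (1 : ℝ) ≤ N := by exact_mod_cast hN
  have hlip : ∀ (g : DisorderIdx κ N → ℝ) α t, |freeEnergy γ j₀ u d (Function.update g α t) -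
      freeEnergy γ j₀ u d g| ≤ coeffBound γ j₀ b α * |t - g α| := fun g α t =>
    abs_log_gZ_sub_le he fun σ => (abs_perturbedH_update_sub_le γ j₀ u g σ α t).trans (by
      rw [mul_comm]
      exact mul_le_mul_of_nonneg_right (abs_disorderCoeff_le γ j₀ hu α σ) (abs_nonneg _))
  have hsum : ∀ T : Finset (Theta κ), 2 * ∑ α ∈ blockIdx N T, coeffBound γ j₀ b α ^ 2 ≤
      2 * (1 + b ^ 2 * ∑' θ : Theta κ, θ.weight j₀) * N := fun T => by
    rw [sum_coeffBound_sq hN, mul_assoc]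
    refine mul_le_mul_of_nonneg_left ?_ (by norm_num)
    have h1 : ((N : ℝ) ^ γ) ^ 2 ≤ N := by
      rw [← Real.rpow_natCast, ← Real.rpow_mul (by positivity)]
      calc (N : ℝ) ^ (γ * (2 : ℕ)) ≤ (N : ℝ) ^ (1 : ℝ) :=
            Real.rpow_le_rpow_of_exponent_le hN1 (by push_cast; linarith)
        _ = N := Real.rpow_one _
    have h2 : ∑ θ ∈ T, ((N : ℝ) ^ γ * (θ.weight j₀ * b)) ^ 2 ≤
        N * b ^ 2 * ∑ θ ∈ T, θ.weight j₀ := by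
      rw [Finset.mul_sum]
      refine Finset.sum_le_sum fun θ _ => ?_
      have hw := θ.weight_pos j₀
      have hw1 := θ.weight_le_one j₀
      calc ((N : ℝ) ^ γ * (θ.weight j₀ * b)) ^ 2
          = ((N : ℝ) ^ γ) ^ 2 * b ^ 2 * (θ.weight j₀ * θ.weight j₀) := by ring
        _ ≤ N * b ^ 2 * (θ.weight j₀ * 1) := by gcongr
        _ = _ := by ring
    have h3 : ∑ θ ∈ T, θ.weight j₀ ≤ ∑' θ : Theta κ, θ.weight j₀ :=
      (summable_weight hj₀).sum_le_tsum T fun θ _ => (θ.weight_pos j₀).le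
    have h4 : N * b ^ 2 * ∑ θ ∈ T, θ.weight j₀ ≤ N * b ^ 2 * ∑' θ : Theta κ, θ.weight j₀ :=
      mul_le_mul_of_nonneg_left h3 (by positivity)
    linarith
  have hbd : ∀ T : Finset (Theta κ), ∫⁻ p, ENNReal.ofReal ((freeEnergy γ j₀ u d p.1 -
      freeEnergy γ j₀ u d (mix (blockIdx N T) p.1 p.2)) ^ 2)
      ∂(disorderLaw κ N).prod (disorderLaw κ N) ≤
      ENNReal.ofReal (2 * (1 + b ^ 2 * ∑' θ : Theta κ, θ.weight j₀) * N) := fun T =>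
    (lintegral_sq_sub_mix_le (measurable_freeEnergy γ j₀ u d) hlip _).trans
      (ENNReal.ofReal_le_ofReal (hsum T))
  -- Fatou's lemma needs a sequence; countability of `Theta κ` supplies one exhausting all finite
  -- sets.
  obtain ⟨T, hT⟩ := (atTop : Filter (Finset (Theta κ))).exists_seq_tendsto
  refine le_trans ?_ (lintegral_liminf_le (fun k : ℕ => ?_) |>.trans
    (liminf_le_of_frequently_le' (f := atTop) (.of_forall fun k => hbd (T k))))
  · refine lintegral_mono_ae ?_
    have hgood := ae_isGood (κ := κ) hj₀ hN
    have hg1 := (Measure.quasiMeasurePreserving_fst (μ := disorderLaw κ N)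
      (ν := disorderLaw κ N)).ae hgood
    have hg2 := (Measure.quasiMeasurePreserving_snd (μ := disorderLaw κ N)
      (ν := disorderLaw κ N)).ae hgood
    filter_upwards [hg1, hg2] with p h1 h2
    have ht : Tendsto (fun k => freeEnergy γ j₀ u d (mix (blockIdx N (T k)) p.1 p.2)) atTop
        (𝓝 (freeEnergy γ j₀ u d p.2)) := by
      unfold freeEnergy
      refine Tendsto.log ?_ (gZ_pos he _).ne'
      unfold gZ
      refine tendsto_finsetSum _ fun σ _ => Tendsto.const_mul _ ?_
      exact (Real.continuous_exp.tendsto _).comp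
        ((tendsto_perturbedH_mix γ j₀ hu h1 h2 σ).comp hT)
    exact (ENNReal.tendsto_ofReal ((tendsto_const_nhds.sub ht).pow 2)).liminf_eq.ge
  · exact ((((measurable_freeEnergy γ j₀ u d).comp measurable_fst).sub
      ((measurable_freeEnergy γ j₀ u d).comp (measurable_mix _))).pow_const 2).ennreal_ofReal

theorem integrable_freeEnergy {j₀ : RatVec κ → ℕ} (hj₀ : Function.Injective j₀) (hN : 1 ≤ N)
    (γ : ℝ) {u : Theta κ → ℝ} {b : ℝ} (hu : ∀ θ, |u θ| ≤ b) (d : stateSizes κ N) :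
    Integrable (fun g : DisorderIdx κ N → ℝ => freeEnergy γ j₀ u d g) (disorderLaw κ N) :=
  integrable_log_gZ (isRef_sizeRef d) (fun σ => measurable_perturbedH γ j₀ u σ)
    fun σ => integrable_perturbedH hj₀ hN γ hu σ

/-- The free energy concentrates on the scale `√N`. -/
theorem integral_abs_freeEnergy_sub_le {j₀ : RatVec κ → ℕ} (hj₀ : Function.Injective j₀)
    (hN : 1 ≤ N) {γ : ℝ} (hγ : γ ≤ 1 / 2) {u : Theta κ → ℝ} {b : ℝ} (hu : ∀ θ, |u θ| ≤ b)
    (d : stateSizes κ N) :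
    ∫ g, |freeEnergy γ j₀ u d g - ∫ g', freeEnergy γ j₀ u d g' ∂disorderLaw κ N|
      ∂disorderLaw κ N ≤ √(2 * (1 + b ^ 2 * ∑' θ : Theta κ, θ.weight j₀) * N) := by
  set φ : (DisorderIdx κ N → ℝ) → ℝ := fun g => freeEnergy γ j₀ u d g with hφ
  set P := disorderLaw κ N
  set V := 2 * (1 + b ^ 2 * ∑' θ : Theta κ, θ.weight j₀) * N with hV
  have hB : 0 ≤ ∑' θ : Theta κ, θ.weight j₀ := tsum_nonneg fun θ => (θ.weight_pos j₀).le
  have hV0 : 0 < V := by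
    have : (1 : ℝ) ≤ N := by exact_mod_cast hN
    positivity
  have hi : Integrable φ P := integrable_freeEnergy hj₀ hN γ hu d
  have h2 := sq_sub_freeEnergy_le hj₀ hN hγ hu d
  have hm : Measurable fun p : (DisorderIdx κ N → ℝ) × (DisorderIdx κ N → ℝ) =>
      (φ p.1 - φ p.2) ^ 2 :=
    (((measurable_freeEnergy γ j₀ u d).comp measurable_fst).sub
      ((measurable_freeEnergy γ j₀ u d).comp measurable_snd)).pow_const 2
  have hi2 : Integrable (fun p : (DisorderIdx κ N → ℝ) × (DisorderIdx κ N → ℝ) =>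
      (φ p.1 - φ p.2) ^ 2) (P.prod P) := by
    refine ⟨hm.aestronglyMeasurable, ?_⟩
    rw [hasFiniteIntegral_iff_ofReal (.of_forall fun p => sq_nonneg _)]
    exact h2.trans_lt ENNReal.ofReal_lt_top
  have h3 : ∫ p, (φ p.1 - φ p.2) ^ 2 ∂P.prod P ≤ V := by
    rw [← ofReal_integral_eq_lintegral_ofReal hi2 (.of_forall fun p => sq_nonneg _)] at h2
    exact (ENNReal.ofReal_le_ofReal_iff hV0.le).1 h2
  have hi1 : Integrable (fun p : (DisorderIdx κ N → ℝ) × (DisorderIdx κ N → ℝ) =>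
      |φ p.1 - φ p.2|) (P.prod P) := ((hi.comp_fst P).sub (hi.comp_snd P)).abs
  have hs : 0 < √V := Real.sqrt_pos.2 hV0
  -- The mean is replaced by an independent copy, and |a| ≤ √V/2 + a²/(2√V) trades the first moment
  -- for the second.
  calc ∫ g, |φ g - ∫ g', φ g' ∂P| ∂P ≤ ∫ g, ∫ g', |φ g - φ g'| ∂P ∂P := by
        refine integral_mono (hi.sub (integrable_const _)).abs hi1.integral_prod_left fun g => ?_
        have : φ g - ∫ g', φ g' ∂P = ∫ g', (φ g - φ g') ∂P := by
          rw [integral_sub (integrable_const _) hi]; simp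
        simp only
        rw [this]
        exact abs_integral_le_integral_abs
    _ = ∫ p, |φ p.1 - φ p.2| ∂P.prod P := (integral_prod _ hi1).symm
    _ ≤ ∫ p, (√V / 2 + 1 / (2 * √V) * (φ p.1 - φ p.2) ^ 2) ∂P.prod P := by
        refine integral_mono hi1 ((integrable_const _).add (hi2.const_mul _)) fun p => ?_
        simp only
        rw [← sq_abs (φ p.1 - φ p.2)]
        have h3 : √V / 2 + 1 / (2 * √V) * |φ p.1 - φ p.2| ^ 2 - |φ p.1 - φ p.2| =
          (|φ p.1 - φ p.2| - √V) ^ 2 / (2 * √V) := by field_simp; ring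
        have : 0 ≤ (|φ p.1 - φ p.2| - √V) ^ 2 / (2 * √V) := by positivity
        linarith
    _ ≤ √V := by
        rw [integral_add (integrable_const _) (hi2.const_mul _), integral_const_mul]
        have h4 : 1 / (2 * √V) * ∫ p, (φ p.1 - φ p.2) ^ 2 ∂P.prod P ≤ 1 / (2 * √V) * V := by
          gcongr
        have h5 : 1 / (2 * √V) * V = √V / 2 := by
          nth_rw 2 [← Real.sq_sqrt hV0.le]
          field_simp
        simp only [integral_const, probReal_univ, one_smul]
        linarith

end FreeEnergy

/-! ### Replica expectations as finite sums of Gibbs weights. -/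

section Replicas

variable {κ N : ℕ}

theorem gibbs_singleton (γ : ℝ) (j₀ : RatVec κ → ℕ) (u : Theta κ → ℝ) (d : Fin κ → ℝ)
    (g : DisorderIdx κ N → ℝ) (σ : Config κ N) :
    gibbs γ j₀ u d g {σ} = ENNReal.ofReal (gW (sizeRef N d) (perturbedH γ j₀ u g) σ) := by
  classical
  simp only [gibbs, Measure.finsetSum_apply, Measure.smul_apply, smul_eq_mul,
    gibbsWeight_eq_gW, Measure.dirac_apply, Set.indicator_singleton]
  rw [Finset.sum_eq_single σ]
  · simp
  · intro τ _ hτ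
    simp [hτ]
  · simp

/-- Averages of functions of the first `n` replicas are finite sums. -/
theorem integral_replicaLaw (γ : ℝ) (j₀ : RatVec κ → ℕ) (u : Theta κ → ℝ) (d : stateSizes κ N)
    {n : ℕ} (F : (Fin n → Config κ N) → ℝ) :
    ∫ s, F (fun i => s i) ∂replicaLaw γ j₀ u d =
      ∫ g, repAvg (sizeRef N d) (perturbedH γ j₀ u g) F ∂disorderLaw κ N := by
  have he := isRef_sizeRef d
  have hr : Measurable fun (s : ℕ → Config κ N) (i : Fin n) => s i := by fun_prop
  have hset : ∀ t : Fin n → Config κ N, (replicaLaw γ j₀ u d)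
      ((fun (s : ℕ → Config κ N) (i : Fin n) => s i) ⁻¹' {t}) =
      ENNReal.ofReal (∫ g, ∏ i, gW (sizeRef N d) (perturbedH γ j₀ u g) (t i)
        ∂disorderLaw κ N) := fun t => by
    have hW : Measurable fun g : DisorderIdx κ N → ℝ =>
        ∏ i, gW (sizeRef N d) (perturbedH γ j₀ u g) (t i) :=
      Finset.measurable_prod _ fun i _ =>
        measurable_gW _ (fun σ => measurable_perturbedH γ j₀ u σ) (t i)
    have hWi : Integrable (fun g : DisorderIdx κ N → ℝ =>
        ∏ i, gW (sizeRef N d) (perturbedH γ j₀ u g) (t i)) (disorderLaw κ N) :=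
      (integrable_const 1).mono' hW.aestronglyMeasurable (.of_forall fun g => by
        rw [Real.norm_eq_abs, abs_of_nonneg (prod_gW_nonneg he _ _)]
        exact prod_gW_le_one he _ _)
    rw [replicaLaw, Measure.bind_apply (hr (measurableSet_singleton t))
      (measurable_replicas γ j₀ u d).aemeasurable,
      ofReal_integral_eq_lintegral_ofReal hWi (.of_forall fun g => prod_gW_nonneg he _ _)]
    refine lintegral_congr fun g => ?_
    have hpre : ((fun (s : ℕ → Config κ N) (i : Fin n) => s i) ⁻¹' {t}) =
        Set.pi ((Finset.univ : Finset (Fin n)).map Fin.valEmbedding : Finset ℕ)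
          (fun k => if h : k < n then {t ⟨k, h⟩} else Set.univ) := by
      ext s
      simp only [Set.mem_preimage, Set.mem_singleton_iff, Set.mem_pi, Finset.coe_map,
        Finset.coe_univ, Set.image_univ, Set.mem_range, Fin.valEmbedding_apply,
        forall_exists_index, forall_apply_eq_imp_iff, Fin.is_lt, dite_true, funext_iff]
    rw [hpre, Measure.infinitePi_pi _ fun k _ => by
        split_ifs
        · exact measurableSet_singleton _
        · exact MeasurableSet.univ,
      Finset.prod_map, ENNReal.ofReal_prod_of_nonneg fun i _ => gW_nonneg he _ _]
    refine Finset.prod_congr rfl fun i _ => ?_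
    simp only [Fin.valEmbedding_apply, Fin.is_lt, dite_true, gibbs_singleton]
  have : IsProbabilityMeasure ((replicaLaw γ j₀ u d).map
      fun (s : ℕ → Config κ N) (i : Fin n) => s i) :=
    Measure.isProbabilityMeasure_map hr.aemeasurable
  have hmap := integral_map (μ := replicaLaw γ j₀ u d) hr.aemeasurable
    (f := F) (measurable_of_finite F).aestronglyMeasurable
  rw [← hmap, integral_fintype .of_finite]
  unfold repAvg
  rw [integral_finsetSum]
  · refine Finset.sum_congr rfl fun t _ => ?_
    rw [integral_mul_const, Measure.real, Measure.map_apply hr (measurableSet_singleton t), hset,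
      ENNReal.toReal_ofReal (integral_nonneg fun g => prod_gW_nonneg he _ _), smul_eq_mul]
  · intro t _
    refine Integrable.mul_const ((integrable_const 1).mono' (Finset.measurable_prod _ fun i _ =>
        measurable_gW _ (fun σ => measurable_perturbedH γ j₀ u σ) (t i)).aestronglyMeasurable
        (.of_forall fun g => ?_)) _
    rw [Real.norm_eq_abs, abs_of_nonneg (prod_gW_nonneg he _ _)]
    exact prod_gW_le_one he _ _

end Replicas

/-! ### Gaussian integration by parts for replica averages. -/

section IntegrationByParts

variable {κ N : ℕ}

theorem integrable_repAvg (γ : ℝ) (j₀ : RatVec κ → ℕ) (u : Theta κ → ℝ) (d : stateSizes κ N)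
    {n : ℕ} {F : (DisorderIdx κ N → ℝ) → (Fin n → Config κ N) → ℝ} {K : ℝ}
    (hF : ∀ g s, |F g s| ≤ K) (hFm : ∀ s, Measurable fun g => F g s) :
    Integrable (fun g => repAvg (sizeRef N d) (perturbedH γ j₀ u g) (F g)) (disorderLaw κ N) :=
  (integrable_const K).mono' (measurable_repAvg _ (fun σ => measurable_perturbedH γ j₀ u σ)
    hFm).aestronglyMeasurable (.of_forall fun g => abs_repAvg_le (isRef_sizeRef d) _ _ (hF g))

theorem integrable_repAvg_of_integrable (γ : ℝ) (j₀ : RatVec κ → ℕ) (u : Theta κ → ℝ)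
    (d : stateSizes κ N) {n : ℕ} {F : (DisorderIdx κ N → ℝ) → (Fin n → Config κ N) → ℝ}
    (hF : ∀ s, Integrable (fun g => F g s) (disorderLaw κ N)) :
    Integrable (fun g => repAvg (sizeRef N d) (perturbedH γ j₀ u g) (F g)) (disorderLaw κ N) := by
  unfold repAvg
  refine integrable_finsetSum _ fun s _ => ?_
  refine (hF s).bdd_mul (c := 1) (Finset.measurable_prod _ fun i _ =>
    measurable_gW _ (fun σ => measurable_perturbedH γ j₀ u σ) (s i)).aestronglyMeasurable
    (.of_forall fun g => ?_)
  rw [Real.norm_eq_abs, abs_of_nonneg (prod_gW_nonneg (isRef_sizeRef d) _ _)]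
  exact prod_gW_le_one (isRef_sizeRef d) _ _

/-- Gaussian integration by parts for one Gaussian variable in a replica average. -/
theorem integral_eval_mul_repAvg {j₀ : RatVec κ → ℕ} (hj₀ : Function.Injective j₀) (hN : 1 ≤ N)
    (γ : ℝ) {u : Theta κ → ℝ} {b : ℝ} (hu : ∀ θ, |u θ| ≤ b) (d : stateSizes κ N) {n : ℕ}
    (F : (Fin n → Config κ N) → ℝ) (α : DisorderIdx κ N) :
    ∫ g, g α * repAvg (sizeRef N d) (perturbedH γ j₀ u g) F ∂disorderLaw κ N =
      ∫ g, repAvg (sizeRef N d) (perturbedH γ j₀ u g) (fun s => F s *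
        (∑ i, disorderCoeff γ j₀ u α (s i) - n * gAvg (sizeRef N d) (perturbedH γ j₀ u g)
          (disorderCoeff γ j₀ u α))) ∂disorderLaw κ N := by
  classical
  have he := isRef_sizeRef d
  have hH : ∀ σ, Measurable fun g : DisorderIdx κ N → ℝ => perturbedH γ j₀ u g σ :=
    fun σ => measurable_perturbedH γ j₀ u σ
  set c := disorderCoeff (N := N) γ j₀ u α with hc
  set K := ∑ s, |F s| with hK
  set B := ∑ σ, |c σ| with hB
  have hFK : ∀ s, |F s| ≤ K := fun s =>
    Finset.single_le_sum (f := fun s => |F s|) (fun _ _ => abs_nonneg _) (Finset.mem_univ s)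
  have hcB : ∀ σ, |c σ| ≤ B := fun σ =>
    Finset.single_le_sum (f := fun σ => |c σ|) (fun _ _ => abs_nonneg _) (Finset.mem_univ σ)
  have hK0 : 0 ≤ K := Finset.sum_nonneg fun _ _ => abs_nonneg _
  have hB0 : 0 ≤ B := Finset.sum_nonneg fun _ _ => abs_nonneg _
  have hD : ∀ (g : DisorderIdx κ N → ℝ) s, |F s * (∑ i, c (s i) -
      n * gAvg (sizeRef N d) (perturbedH γ j₀ u g) c)| ≤ K * (n * B + n * B) := fun g s => by
    rw [abs_mul]
    refine mul_le_mul (hFK s) ((abs_sub _ _).trans (add_le_add ?_ ?_)) (abs_nonneg _) hK0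
    · refine (Finset.abs_sum_le_sum_abs _ _).trans ?_
      calc ∑ i, |c (s i)| ≤ ∑ _i : Fin n, B := Finset.sum_le_sum fun i _ => hcB _
        _ = n * B := by simp
    · rw [abs_mul, Nat.abs_cast]
      exact mul_le_mul_of_nonneg_left (abs_gAvg_le he _ _ hcB) (by positivity)
  have hm1 : Measurable fun g : DisorderIdx κ N → ℝ =>
      repAvg (sizeRef N d) (perturbedH γ j₀ u g) F := measurable_repAvg _ hH fun s => measurable_const
  have hm2 : Measurable fun g : DisorderIdx κ N → ℝ =>
      repAvg (sizeRef N d) (perturbedH γ j₀ u g) fun s => F s * (∑ i, c (s i) -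
        n * gAvg (sizeRef N d) (perturbedH γ j₀ u g) c) := by
    refine measurable_repAvg _ hH fun s => Measurable.const_mul (Measurable.sub measurable_const
      (Measurable.const_mul ?_ _)) _
    exact measurable_gAvg _ hH fun σ => measurable_const
  have hKB : 0 ≤ K * (n * B + n * B) := by positivity
  have hb1 : ∀ g : DisorderIdx κ N → ℝ, |repAvg (sizeRef N d) (perturbedH γ j₀ u g) F| ≤
      K + K * (n * B + n * B) := fun g => (abs_repAvg_le he _ _ hFK).trans (by linarith)
  have hb2 : ∀ g : DisorderIdx κ N → ℝ, |repAvg (sizeRef N d) (perturbedH γ j₀ u g)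
      fun s => F s * (∑ i, c (s i) - n * gAvg (sizeRef N d) (perturbedH γ j₀ u g) c)| ≤
      K + K * (n * B + n * B) := fun g => (abs_repAvg_le he _ _ (hD g)).trans (by linarith)
  have hgood := ae_isGood (κ := κ) hj₀ hN
  rw [disorderLaw_eq] at hgood ⊢
  refine integral_eval_mul_gaussPi α hm1 hm2 hb1 hb2 ?_
  filter_upwards [hgood] with g hg t
  -- For almost every disorder the energies are affine in the variable α, so the replica weights
  -- differentiate by the tilt formula in the direction of its coefficients.
  have hHt : ∀ t, perturbedH γ j₀ u (Function.update g α t) =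
      fun σ => (perturbedH γ j₀ u g σ - g α * c σ) + t * c σ := fun t => by
    ext σ
    rw [perturbedH_update_of_summable γ j₀ u g σ (hg.summable hu σ)]
    ring
  simp only [hHt]
  unfold repAvg
  refine HasDerivAt.fun_sum fun s _ => ?_
  refine ((hasDerivAt_prod_gW he (fun σ => perturbedH γ j₀ u g σ - g α * c σ) c s t).mul_const
    (F s)).congr_deriv ?_
  ring

/-- Gaussian integration by parts for the perturbation term with parameters `θ`. -/
theorem integral_repAvg_mul_thetaH {j₀ : RatVec κ → ℕ} (hj₀ : Function.Injective j₀)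
    (hN : 1 ≤ N) (γ : ℝ) {u : Theta κ → ℝ} {b : ℝ} (hu : ∀ θ, |u θ| ≤ b) (d : stateSizes κ N)
    {n : ℕ} (F : (Fin (n + 1) → Config κ N) → ℝ) (θ : Theta κ) :
    ∫ g, repAvg (sizeRef N d) (perturbedH γ j₀ u g) (fun s => F s * thetaH g θ (s 0))
      ∂disorderLaw κ N = (N : ℝ) ^ γ * (θ.weight j₀ * u θ) *
      ∫ g, repAvg (sizeRef N d) (perturbedH γ j₀ u g) (fun s => F s *
        (∑ i, covTheta θ (overlap (s 0) (s i)) - (n + 1 : ℕ) * gAvg (sizeRef N d)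
          (perturbedH γ j₀ u g) (fun σ => covTheta θ (overlap (s 0) σ)))) ∂disorderLaw κ N := by
  have h1 : ∀ g : DisorderIdx κ N → ℝ, repAvg (sizeRef N d) (perturbedH γ j₀ u g)
      (fun s => F s * thetaH g θ (s 0)) = ∑ I : θ.Idx N, g (.inr ⟨θ, I⟩) *
        repAvg (sizeRef N d) (perturbedH γ j₀ u g) (fun s => F s * thetaCoeff θ I (s 0)) :=
    fun g => by
      simp only [← repAvg_const_mul, ← repAvg_sum]
      congr 1
      ext s
      rw [thetaH_eq_sum, Finset.mul_sum]
      exact Finset.sum_congr rfl fun I _ => by ring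
  simp only [h1]
  have hmeas : ∀ I : θ.Idx N, Measurable fun g : DisorderIdx κ N → ℝ =>
      gAvg (sizeRef N d) (perturbedH γ j₀ u g) (disorderCoeff γ j₀ u (.inr ⟨θ, I⟩)) := fun I =>
    measurable_gAvg _ (fun σ => measurable_perturbedH γ j₀ u σ) fun σ => measurable_const
  rw [integral_finsetSum]
  · simp only [integral_eval_mul_repAvg hj₀ hN γ hu d]
    rw [← integral_finsetSum, ← integral_const_mul]
    · congr 1
      ext g
      rw [← repAvg_sum, ← repAvg_const_mul]
      congr 1
      ext s
      have hdc : ∀ (I : θ.Idx N) σ, disorderCoeff γ j₀ u (.inr ⟨θ, I⟩) σ =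
          (N : ℝ) ^ γ * (θ.weight j₀ * u θ) * thetaCoeff θ I σ := fun I σ => by
        simp only [disorderCoeff]; ring
      have hga : ∀ I : θ.Idx N, gAvg (sizeRef N d) (perturbedH γ j₀ u g)
          (disorderCoeff γ j₀ u (.inr ⟨θ, I⟩)) = (N : ℝ) ^ γ * (θ.weight j₀ * u θ) *
          gAvg (sizeRef N d) (perturbedH γ j₀ u g) (thetaCoeff θ I) := fun I => by
        unfold gAvg
        rw [Finset.mul_sum]
        exact Finset.sum_congr rfl fun σ _ => by rw [hdc]; ring
      -- The covariances are expanded over I so that both sides can be compared index by index.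
      simp only [hdc, hga, ← sum_thetaCoeff_mul hN]
      have e1 : ∑ i, ∑ I : θ.Idx N, thetaCoeff θ I (s 0) * thetaCoeff θ I (s i) =
          ∑ I : θ.Idx N, thetaCoeff θ I (s 0) * ∑ i, thetaCoeff θ I (s i) := by
        rw [Finset.sum_comm]
        exact Finset.sum_congr rfl fun I _ => by rw [Finset.mul_sum]
      have e2 : gAvg (sizeRef N d) (perturbedH γ j₀ u g) (fun σ =>
          ∑ I : θ.Idx N, thetaCoeff θ I (s 0) * thetaCoeff θ I σ) =
          ∑ I : θ.Idx N, thetaCoeff θ I (s 0) *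
            gAvg (sizeRef N d) (perturbedH γ j₀ u g) (thetaCoeff θ I) := by
        unfold gAvg
        simp only [Finset.mul_sum]
        rw [Finset.sum_comm]
        exact Finset.sum_congr rfl fun I _ => Finset.sum_congr rfl fun σ _ => by ring
      rw [e1, e2]
      simp only [← Finset.mul_sum]
      rw [Finset.mul_sum (Finset.univ : Finset (θ.Idx N)), ← Finset.sum_sub_distrib,
        Finset.mul_sum, Finset.mul_sum]
      exact Finset.sum_congr rfl fun I _ => by ring
    · intro I _
      refine integrable_repAvg_of_integrable γ j₀ u d fun s => ?_
      refine Integrable.const_mul ((integrable_const _).sub (Integrable.const_mul ?_ _)) _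
      exact integrable_gAvg (isRef_sizeRef d) (fun σ => measurable_perturbedH γ j₀ u σ)
        (fun σ => measurable_const) fun σ => integrable_const _
  · intro I _
    have h := integrable_repAvg_of_integrable γ j₀ u d (n := n + 1)
      (F := fun g s => g (.inr ⟨θ, I⟩) * (F s * thetaCoeff θ I (s 0)))
      fun s => (integrable_eval_gaussPi _).mul_const _
    simpa only [repAvg_const_mul] using h

end IntegrationByParts

/-! ### The Ghirlanda–Guerra defect and the deviation of a perturbation term. -/

section Defect

variable {κ N : ℕ}

/-- The averaged Gibbs mean of a perturbation term. -/
def thetaMean (γ : ℝ) (j₀ : RatVec κ → ℕ) (u : Theta κ → ℝ) (d : stateSizes κ N)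
    (θ : Theta κ) : ℝ :=
  ∫ g, gAvg (sizeRef N d) (perturbedH γ j₀ u g) (thetaH g θ) ∂disorderLaw κ N

/-- The averaged Gibbs mean of the absolute deviation of a perturbation term. -/
def thetaDev (γ : ℝ) (j₀ : RatVec κ → ℕ) (u : Theta κ → ℝ) (d : stateSizes κ N)
    (θ : Theta κ) : ℝ :=
  ∫ g, gAvg (sizeRef N d) (perturbedH γ j₀ u g)
    (fun σ => |thetaH g θ σ - thetaMean γ j₀ u d θ|) ∂disorderLaw κ N

theorem integrable_gAvg_abs_thetaH_sub (γ : ℝ) (j₀ : RatVec κ → ℕ) (u : Theta κ → ℝ)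
    (d : stateSizes κ N) (θ : Theta κ) (x : ℝ) :
    Integrable (fun g => gAvg (sizeRef N d) (perturbedH γ j₀ u g)
      (fun σ => |thetaH g θ σ - x|)) (disorderLaw κ N) :=
  integrable_gAvg (isRef_sizeRef d) (fun σ => measurable_perturbedH γ j₀ u σ)
    (fun σ => ((measurable_thetaH θ σ).sub_const x).abs)
    fun σ => ((integrable_thetaH θ σ).sub (integrable_const x)).abs

/-- The self-overlap is constant on the support of the Gibbs weights; replica families with s 0
outside that support have weight zero. -/
theorem repAvg_mul_covTheta_self (hN : 1 ≤ N) (d : Fin κ → ℝ) (H : Config κ N → ℝ) {k : ℕ}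
    (F : (Fin (k + 1) → Config κ N) → ℝ) (θ : Theta κ) :
    repAvg (sizeRef N d) H (fun s => F s * covTheta θ (overlap (s 0) (s 0))) =
      covTheta θ (fun k k' => if k = k' then d k else 0) * repAvg (sizeRef N d) H F := by
  rw [← repAvg_const_mul]
  unfold repAvg
  refine Finset.sum_congr rfl fun s _ => ?_
  beta_reduce
  by_cases h : s 0 ∈ stateSet N d
  · rw [overlap_self hN h, mul_comm (F s)]
  · have h0 : ∏ i, gW (sizeRef N d) H (s i) = 0 :=
      Finset.prod_eq_zero (Finset.mem_univ (0 : Fin (k + 1))) (gW_sizeRef_of_notMem H h)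
    rw [h0, zero_mul, zero_mul]

variable {j₀ : RatVec κ → ℕ} (hj₀ : Function.Injective j₀) (hN : 1 ≤ N) (γ : ℝ)
  {u : Theta κ → ℝ} {b : ℝ} (hu : ∀ θ, |u θ| ≤ b) (d : stateSizes κ N) (θ : Theta κ)
include hj₀ hN hu

/-- Integration by parts with one replica and test function 1. -/
theorem thetaMean_eq :
    thetaMean γ j₀ u d θ = (N : ℝ) ^ γ * (θ.weight j₀ * u θ) *
      (covTheta θ (fun k k' => if k = k' then (d : Fin κ → ℝ) k else 0) -
        ∫ g, gAvg (sizeRef N d) (perturbedH γ j₀ u g) (fun τ => gAvg (sizeRef N d)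
          (perturbedH γ j₀ u g) fun σ => covTheta θ (overlap τ σ)) ∂disorderLaw κ N) := by
  have he := isRef_sizeRef d
  have h := integral_repAvg_mul_thetaH hj₀ hN γ hu d (n := 0) (fun _ => 1) θ
  simp only [one_mul] at h
  have e1 : ∀ g : DisorderIdx κ N → ℝ, repAvg (sizeRef N d) (perturbedH γ j₀ u g)
      (fun s : Fin (0 + 1) → Config κ N => thetaH g θ (s 0)) =
      gAvg (sizeRef N d) (perturbedH γ j₀ u g) (thetaH g θ) := fun g =>
    repAvg_zero_coord he _ _
  have e2 : ∀ g : DisorderIdx κ N → ℝ, repAvg (sizeRef N d) (perturbedH γ j₀ u g)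
      (fun s : Fin (0 + 1) → Config κ N => ∑ i, covTheta θ (overlap (s 0) (s i)) -
        (0 + 1 : ℕ) * gAvg (sizeRef N d) (perturbedH γ j₀ u g)
          fun σ => covTheta θ (overlap (s 0) σ)) =
      covTheta θ (fun k k' => if k = k' then (d : Fin κ → ℝ) k else 0) -
        gAvg (sizeRef N d) (perturbedH γ j₀ u g) fun τ => gAvg (sizeRef N d)
          (perturbedH γ j₀ u g) fun σ => covTheta θ (overlap τ σ) := fun g => by
    have h1 := repAvg_mul_covTheta_self hN (d : Fin κ → ℝ) (perturbedH γ j₀ u g) (k := 0)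
      (fun _ => 1) θ
    have h2 : repAvg (sizeRef N d) (perturbedH γ j₀ u g)
        (fun _ : Fin (0 + 1) → Config κ N => (1 : ℝ)) = 1 := by
      simp only [repAvg, mul_one]; exact sum_prod_gW he _ _
    have h3 := repAvg_zero_coord he (perturbedH γ j₀ u g) (n := 0)
      (fun τ => gAvg (sizeRef N d) (perturbedH γ j₀ u g) fun σ => covTheta θ (overlap τ σ))
    rw [h2, mul_one] at h1
    rw [← h1, ← h3, sub_eq_add_neg, ← neg_one_mul, ← repAvg_const_mul, ← repAvg_add]
    congr 1
    ext s
    simp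
    ring
  simp only [e1, e2] at h
  rw [thetaMean, h, integral_sub (integrable_const _)]
  · simp
  · exact integrable_gAvg he (fun σ => measurable_perturbedH γ j₀ u σ)
      (fun τ => measurable_gAvg _ (fun σ => measurable_perturbedH γ j₀ u σ)
        fun σ => measurable_const)
      fun τ => integrable_gAvg he (fun σ => measurable_perturbedH γ j₀ u σ)
        (fun σ => measurable_const) fun σ => integrable_const _

theorem abs_thetaMean_le : |thetaMean γ j₀ u d θ| ≤ (N : ℝ) ^ γ * θ.weight j₀ * (2 * b) := by
  have he := isRef_sizeRef d
  have hb : 0 ≤ b := (abs_nonneg _).trans (hu θ)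
  have hw := (θ.weight_pos j₀).le
  rw [thetaMean_eq hj₀ hN γ hu d θ, abs_mul, abs_mul, abs_mul, abs_of_nonneg hw,
    abs_of_nonneg (by positivity : 0 ≤ (N : ℝ) ^ γ)]
  -- The matrix diag(d) is an actual self-overlap, because membership in `stateSizes` provides a
  -- configuration realizing d.
  have h1 : |covTheta θ (fun k k' => if k = k' then (d : Fin κ → ℝ) k else 0)| ≤ 1 := by
    obtain ⟨σ, hσ⟩ := d.2.2
    rw [← overlap_self hN hσ]
    exact abs_covTheta_overlap_le_one hN θ σ σ
  have h2 : |∫ g, gAvg (sizeRef N d) (perturbedH γ j₀ u g) (fun τ => gAvg (sizeRef N d)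
      (perturbedH γ j₀ u g) fun σ => covTheta θ (overlap τ σ)) ∂disorderLaw κ N| ≤ 1 := by
    have hpt : ∀ g, ‖gAvg (sizeRef N d) (perturbedH γ j₀ u g) (fun τ => gAvg (sizeRef N d)
        (perturbedH γ j₀ u g) fun σ => covTheta θ (overlap τ σ))‖ ≤ 1 := fun g =>
      abs_gAvg_le he (perturbedH γ j₀ u g) _ fun τ => abs_gAvg_le he (perturbedH γ j₀ u g) _
        fun σ => abs_covTheta_overlap_le_one hN θ τ σ
    have h := norm_integral_le_of_norm_le_const (μ := disorderLaw κ N) (.of_forall hpt)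
    rwa [probReal_univ, mul_one] at h
  have h3 := (abs_sub _ _).trans (add_le_add h1 h2)
  refine (mul_le_mul (mul_le_mul_of_nonneg_left (mul_le_mul_of_nonneg_left (hu θ) hw)
    (by positivity)) h3 (abs_nonneg _) (by positivity)).trans (le_of_eq (by ring))

set_option maxHeartbeats 1600000 in
/-- The Ghirlanda–Guerra defect is controlled by the deviation of the perturbation term. -/
theorem ggDefect_le (huθ : 0 < u θ) {n : ℕ} (hn : 1 ≤ n)
    {f : (Fin n → Fin n → Mat κ) → ℝ} {K : ℝ} (hf : ∀ x, |f x| ≤ K) :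
    ggDefect γ j₀ u d n f θ ≤
      K / ((N : ℝ) ^ γ * (θ.weight j₀ * u θ) * n) * thetaDev γ j₀ u d θ := by
  obtain ⟨k, rfl⟩ : ∃ k, n = k + 1 := ⟨n - 1, by omega⟩
  have he := isRef_sizeRef d
  have hK : 0 ≤ K := (abs_nonneg _).trans (hf 0)
  set a := (N : ℝ) ^ γ * (θ.weight j₀ * u θ) with ha
  have hapos : 0 < a := by
    have := θ.weight_pos j₀
    positivity
  set e := sizeRef N (d : Fin κ → ℝ) with hedef
  set C : Config κ N → Config κ N → ℝ := fun σ τ => covTheta θ (overlap σ τ) with hC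
  set FF : (Fin (k + 1) → Config κ N) → ℝ := fun s => f fun l l' => overlap (s l) (s l') with hFF
  have hFFK : ∀ s, |FF s| ≤ K := fun s => hf _
  have hC1 : ∀ σ τ, |C σ τ| ≤ 1 := fun σ τ => abs_covTheta_overlap_le_one hN θ σ τ
  set c₀ := covTheta θ (fun k k' => if k = k' then (d : Fin κ → ℝ) k else 0) with hc₀
  set H : (DisorderIdx κ N → ℝ) → Config κ N → ℝ := fun g => perturbedH γ j₀ u g with hH
  have hHm : ∀ σ, Measurable fun g => H g σ := fun σ => measurable_perturbedH γ j₀ u σ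
  have r1 : ∫ s, f (block (k + 1) (overlapArray s)) * covTheta θ (overlapArray s 0 (k + 1))
      ∂replicaLaw γ j₀ u d = ∫ g, repAvg e (H g) (fun s => FF s * gAvg e (H g) (C (s 0)))
        ∂disorderLaw κ N := by
    have h := integral_replicaLaw γ j₀ u d (n := k + 2)
      (fun s => FF (fun i => s i.castSucc) * C (s 0) (s (Fin.last _)))
    refine h.trans (integral_congr_ae (.of_forall fun g => ?_))
    simp only
    rw [repAvg_snoc]
    congr 1
    ext s
    unfold gAvg
    rw [Finset.mul_sum]
    refine Finset.sum_congr rfl fun x _ => ?_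
    have h0 : (Fin.snoc s x : Fin (k + 1 + 1) → Config κ N) 0 = s 0 := by
      rw [← Fin.castSucc_zero]; exact Fin.snoc_castSucc (α := fun _ => Config κ N) x s 0
    simp only [Fin.snoc_castSucc, Fin.snoc_last, h0]
    ring
  have r2 : ∫ s, f (block (k + 1) (overlapArray s)) ∂replicaLaw γ j₀ u d =
      ∫ g, repAvg e (H g) FF ∂disorderLaw κ N :=
    integral_replicaLaw γ j₀ u d FF
  have r3 : ∫ s, covTheta θ (overlapArray s 0 1) ∂replicaLaw γ j₀ u d =
      ∫ g, gAvg e (H g) (fun τ => gAvg e (H g) (C τ)) ∂disorderLaw κ N := by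
    have h := integral_replicaLaw γ j₀ u d (n := 2) (fun s => C (s 0) (s 1))
    refine h.trans (integral_congr_ae (.of_forall fun g => ?_))
    simp only
    rw [repAvg_snoc]
    have h3 := repAvg_zero_coord he (H g) (n := 0) (fun τ => gAvg e (H g) (C τ))
    rw [← h3]
    rfl
  have r4 : ∀ i : Fin k, ∫ s, f (block (k + 1) (overlapArray s)) *
      covTheta θ (overlapArray s 0 (1 + i)) ∂replicaLaw γ j₀ u d =
      ∫ g, repAvg e (H g) (fun s => FF s * C (s 0) (s i.succ)) ∂disorderLaw κ N := fun i => by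
    rw [add_comm 1]
    exact integral_replicaLaw γ j₀ u d (fun s => FF s * C (s 0) (s i.succ))
  set T₁ := ∫ g, repAvg e (H g) (fun s => FF s * gAvg e (H g) (C (s 0))) ∂disorderLaw κ N
  set E₁ := ∫ g, repAvg e (H g) FF ∂disorderLaw κ N
  set T₂ := ∫ g, gAvg e (H g) (fun τ => gAvg e (H g) (C τ)) ∂disorderLaw κ N with hT₂
  set T₃ := ∑ i : Fin k, ∫ g, repAvg e (H g) (fun s => FF s * C (s 0) (s i.succ))
    ∂disorderLaw κ N with hT₃
  set X := thetaMean γ j₀ u d θ with hX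
  have x2 : X = a * (c₀ - T₂) := thetaMean_eq hj₀ hN γ hu d θ
  have i1 : Integrable (fun g => repAvg e (H g) FF) (disorderLaw κ N) :=
    integrable_repAvg γ j₀ u d (F := fun _ => FF) (fun _ => hFFK) fun s => measurable_const
  have i2 : ∀ i : Fin k, Integrable (fun g => repAvg e (H g)
      (fun s => FF s * C (s 0) (s i.succ))) (disorderLaw κ N) := fun i =>
    integrable_repAvg γ j₀ u d (F := fun _ s => FF s * C (s 0) (s i.succ)) (K := K * 1)
      (fun _ s => by
        rw [abs_mul]
        exact mul_le_mul (hFFK s) (hC1 _ _) (abs_nonneg _) hK) fun s => measurable_const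
  have hmg : ∀ σ, Measurable fun g => gAvg e (H g) (C σ) := fun σ =>
    measurable_gAvg e hHm fun τ => measurable_const
  have i3 : Integrable (fun g => repAvg e (H g) (fun s => FF s * gAvg e (H g) (C (s 0))))
      (disorderLaw κ N) :=
    integrable_repAvg γ j₀ u d (F := fun g s => FF s * gAvg e (H g) (C (s 0))) (K := K * 1)
      (fun g s => by
        rw [abs_mul]
        exact mul_le_mul (hFFK s) (abs_gAvg_le he _ _ (hC1 _)) (abs_nonneg _) hK)
      fun s => (hmg (s 0)).const_mul _
  -- The term i = 0 of the sum over replicas is a self-overlap and comes out as the constant c₀.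
  have x1 : ∫ g, repAvg e (H g) (fun s => FF s * thetaH g θ (s 0)) ∂disorderLaw κ N =
      a * (c₀ * E₁ + T₃ - (k + 1 : ℕ) * T₁) := by
    rw [integral_repAvg_mul_thetaH hj₀ hN γ hu d FF θ]
    congr 1
    have hp : ∀ g, repAvg e (H g) (fun s => FF s * (∑ i, covTheta θ (overlap (s 0) (s i)) -
        (k + 1 : ℕ) * gAvg e (H g) (fun σ => covTheta θ (overlap (s 0) σ)))) =
        c₀ * repAvg e (H g) FF + ∑ i : Fin k, repAvg e (H g)
          (fun s => FF s * C (s 0) (s i.succ)) + (-(k + 1 : ℕ) : ℝ) *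
            repAvg e (H g) (fun s => FF s * gAvg e (H g) (C (s 0))) := fun g => by
      rw [hc₀, ← repAvg_mul_covTheta_self hN, ← repAvg_sum, ← repAvg_add, ← repAvg_const_mul,
        ← repAvg_add]
      congr 1
      ext s
      rw [Fin.sum_univ_succ, ← Finset.mul_sum]
      ring
    refine (integral_congr_ae (.of_forall hp)).trans ?_
    have i1' : Integrable (fun g => c₀ * repAvg e (H g) FF) (disorderLaw κ N) := i1.const_mul _
    have i2' : Integrable (fun g => ∑ i : Fin k, repAvg e (H g)
        (fun s => FF s * C (s 0) (s i.succ))) (disorderLaw κ N) :=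
      integrable_finsetSum _ fun i _ => i2 i
    have i12 : Integrable (fun g => c₀ * repAvg e (H g) FF + ∑ i : Fin k, repAvg e (H g)
        (fun s => FF s * C (s 0) (s i.succ))) (disorderLaw κ N) := i1'.add i2'
    rw [integral_add i12 (i3.const_mul _), integral_add i1' i2',
      integral_const_mul, integral_const_mul, integral_finsetSum _ fun i _ => i2 i]
    ring
  have hk1 : (0 : ℝ) < (k + 1 : ℕ) := by positivity
  -- Subtracting E₁ * X cancels c₀ and leaves -a (k + 1) times the signed defect.
  have hdef : ggDefect γ j₀ u d (k + 1) f θ = |(∫ g, repAvg e (H g)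
      (fun s => FF s * thetaH g θ (s 0)) ∂disorderLaw κ N) - E₁ * X| / (a * (k + 1 : ℕ)) := by
    unfold ggDefect
    rw [Finset.sum_Ico_eq_sum_range, Nat.add_sub_cancel, Finset.sum_range, r1, r2, r3]
    simp only [r4]
    rw [x1, x2]
    have hq : ∀ y : ℝ, |y| / (a * (k + 1 : ℕ)) = |-(y / (a * (k + 1 : ℕ)))| := fun y => by
      rw [abs_neg, abs_div, abs_of_pos (mul_pos hapos hk1)]
    rw [hq]
    congr 1
    field_simp
    ring
  have i4 : Integrable (fun g => repAvg e (H g) (fun s => FF s * thetaH g θ (s 0)))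
      (disorderLaw κ N) := integrable_repAvg_of_integrable γ j₀ u d
        (F := fun g s => FF s * thetaH g θ (s 0)) fun s => (integrable_thetaH θ _).const_mul _
  have hdiff : (∫ g, repAvg e (H g) (fun s => FF s * thetaH g θ (s 0)) ∂disorderLaw κ N) -
      E₁ * X = ∫ g, repAvg e (H g) (fun s => FF s * (thetaH g θ (s 0) - X))
        ∂disorderLaw κ N := by
    rw [mul_comm E₁, ← integral_const_mul, ← integral_sub i4 (i1.const_mul X)]
    congr 1
    ext g
    rw [sub_eq_add_neg, ← neg_mul, ← repAvg_const_mul, ← repAvg_add]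
    congr 1
    ext s
    ring
  suffices h : |∫ g, repAvg e (H g) (fun s => FF s * (thetaH g θ (s 0) - X))
      ∂disorderLaw κ N| ≤ K * thetaDev γ j₀ u d θ by
    rw [hdef, hdiff, div_mul_eq_mul_div]
    exact div_le_div_of_nonneg_right h (mul_pos hapos hk1).le
  refine (abs_integral_le_integral_abs).trans ?_
  unfold thetaDev
  rw [← integral_const_mul]
  refine integral_mono_of_nonneg (.of_forall fun g => abs_nonneg _)
    ((integrable_gAvg_abs_thetaH_sub γ j₀ u d θ X).const_mul K) (.of_forall fun g => ?_)
  refine (abs_repAvg_mul_le he (H g) FF (fun s => thetaH g θ (s 0) - X) hFFK).trans (le_of_eq ?_)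
  congr 1
  exact repAvg_zero_coord he (H g) (n := k) fun σ => |thetaH g θ σ - X|

end Defect

/-! ### The relative deviation averaged over a single perturbation parameter. -/

section OneParameter

variable {κ N : ℕ}

/-- The deviation of a perturbation term, relative to the scale of the term in the Hamiltonian. -/
def relDev (γ : ℝ) (j₀ : RatVec κ → ℕ) (u : Theta κ → ℝ) (d : stateSizes κ N)
    (θ : Theta κ) : ℝ :=
  thetaDev γ j₀ u d θ / ((N : ℝ) ^ γ * θ.weight j₀)

theorem thetaDev_nonneg (γ : ℝ) (j₀ : RatVec κ → ℕ) (u : Theta κ → ℝ) (d : stateSizes κ N)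
    (θ : Theta κ) : 0 ≤ thetaDev γ j₀ u d θ :=
  integral_nonneg fun _ => Finset.sum_nonneg fun σ _ =>
    mul_nonneg (gW_nonneg (isRef_sizeRef d) _ σ) (abs_nonneg _)

/-- In one parameter the energies have the form A + x h required by the concentration estimate, with
slope h a multiple of h_θ. -/
theorem IsGood.perturbedH_update [DecidableEq (Theta κ)] {j₀ : RatVec κ → ℕ}
    {g : DisorderIdx κ N → ℝ} (hg : IsGood j₀ g) (γ : ℝ) {u : Theta κ → ℝ} {b : ℝ}
    (hu : ∀ θ, |u θ| ≤ b) (θ : Theta κ) (x : ℝ) (σ : Config κ N) :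
    perturbedH γ j₀ (Function.update u θ x) g σ = perturbedH γ j₀ (Function.update u θ 0) g σ +
      x * ((N : ℝ) ^ γ * θ.weight j₀ * thetaH g θ σ) := by
  have hs : ∀ y : ℝ, Summable fun θ' : Theta κ =>
      θ'.weight j₀ * Function.update u θ y θ' * thetaH g θ' σ := fun y =>
    hg.summable (b := max b |y|) (fun θ' => by
      rcases eq_or_ne θ' θ with rfl | h
      · simp
      · rw [Function.update_of_ne h]; exact (hu θ').trans (le_max_left _ _)) σ
  have h1 := (hs x).tsum_sub (hs 0)
  rw [tsum_eq_single θ fun θ' h => by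
    rw [Function.update_of_ne h, Function.update_of_ne h, sub_self]] at h1
  simp only [Function.update_self] at h1
  rw [perturbedH_eq, perturbedH_eq]
  linear_combination -(N : ℝ) ^ γ * h1

end OneParameter

section OneParameter

variable {κ N : ℕ} {j₀ : RatVec κ → ℕ} (hj₀ : Function.Injective j₀) (hN : 1 ≤ N)
include hj₀ hN

theorem lintegral_thetaDev_update_le [DecidableEq (Theta κ)] {γ : ℝ}
    (hγ : γ ∈ Set.Ioo (1 / 4 : ℝ) (1 / 2)) {u : Theta κ → ℝ}
    (hu : ∀ θ, |u θ| ≤ 3) (d : stateSizes κ N) (θ : Theta κ) :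
    letI s := (N : ℝ) ^ γ * θ.weight j₀
    ∫⁻ x in Set.Ioc (1 : ℝ) 2,
      ENNReal.ofReal (s * thetaDev γ j₀ (Function.update u θ x) d θ) ≤
    ENNReal.ofReal (s / 2 + 6 * s ^ 2 / s +
      (3 * √(2 * (1 + 3 ^ 2 * ∑' θ : Theta κ, θ.weight j₀) * N) / (N : ℝ) ^ (1 / 4 - γ) +
        4 * (N : ℝ) ^ (1 / 4 - γ) * (6 * s ^ 2))) := by
  have hN' : (1 : ℝ) ≤ N := by exact_mod_cast hN
  have hw := θ.weight_pos j₀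
  have he := isRef_sizeRef d
  set s := (N : ℝ) ^ γ * θ.weight j₀ with hs
  have hspos : 0 < s := by positivity
  have hux : ∀ x ∈ Set.Icc (0 : ℝ) 3, ∀ θ', |Function.update u θ x θ'| ≤ 3 := fun x hx θ' => by
    rcases eq_or_ne θ' θ with rfl | h
    · rw [Function.update_self, abs_of_nonneg hx.1]; exact hx.2
    · rw [Function.update_of_ne h]; exact hu θ'
  have hu0 := hux 0 (by norm_num)
  set A : (DisorderIdx κ N → ℝ) → Config κ N → ℝ :=
    fun g => perturbedH γ j₀ (Function.update u θ 0) g with hA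
  set h : (DisorderIdx κ N → ℝ) → Config κ N → ℝ := fun g σ => s * thetaH g θ σ with hh
  have hgood : ∀ᵐ g ∂disorderLaw κ N, ∀ x, (fun σ => A g σ + x * h g σ) =
      perturbedH γ j₀ (Function.update u θ x) g := by
    filter_upwards [ae_isGood hj₀ hN] with g hg x
    ext σ
    exact (hg.perturbedH_update γ hu θ x σ).symm
  have hmx : ∀ x, s * thetaMean γ j₀ (Function.update u θ x) d θ =
      ∫ g, gAvg (sizeRef N d) (fun σ => A g σ + x * h g σ) (h g) ∂disorderLaw κ N := fun x => by
    rw [thetaMean, ← integral_const_mul]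
    refine integral_congr_ae ?_
    filter_upwards [hgood] with g hg
    rw [hg x, hh]
    simp only [gAvg, Finset.mul_sum]
    exact Finset.sum_congr rfl fun σ _ => by ring
  have key := lintegral_gAvg_abs_sub_mean_le he (P := disorderLaw κ N) (A := A) (h := h)
    (fun σ => measurable_perturbedH γ j₀ _ σ) (fun σ => (measurable_thetaH θ σ).const_mul s)
    (fun σ => integrable_perturbedH hj₀ hN γ hu0 σ) (fun σ => (integrable_thetaH θ σ).const_mul s)
    (m := fun x => s * thetaMean γ j₀ (Function.update u θ x) d θ) hmx
    -- M is s times the bound 2·3·s on the mean, valid for parameters up to 3. Taking δ = s makes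
    -- δ/2 and M/δ both of order s, and y = N^{1/4-γ} balances √N/y against y N^{2γ}.
    (M := 6 * s ^ 2) (v := √(2 * (1 + 3 ^ 2 * ∑' θ : Theta κ, θ.weight j₀) * N))
    (y := (N : ℝ) ^ (1 / 4 - γ)) (δ := s) (fun x hx => by
      have := abs_thetaMean_le hj₀ hN γ (hux x hx) d θ
      rw [abs_mul, abs_of_pos hspos]
      calc _ ≤ s * (s * (2 * 3)) := mul_le_mul_of_nonneg_left this hspos.le
        _ = _ := by ring) (fun x hx => by
      refine le_trans (le_of_eq ?_) (integral_abs_freeEnergy_sub_le hj₀ hN hγ.2.le (hux x hx) d)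
      have e1 : ∫ ω', Real.log (gZ (sizeRef N d) fun σ => A ω' σ + x * h ω' σ) ∂disorderLaw κ N =
          ∫ g', freeEnergy γ j₀ (Function.update u θ x) d g' ∂disorderLaw κ N := by
        refine integral_congr_ae ?_
        filter_upwards [hgood] with g hg
        rw [hg x]; rfl
      rw [e1]
      refine integral_congr_ae ?_
      filter_upwards [hgood] with g hg
      rw [hg x]; rfl) (by positivity)
      (Real.rpow_le_one_of_one_le_of_nonpos hN' (by linarith [hγ.1])) hspos
  refine le_trans (le_of_eq ?_) key
  refine lintegral_congr fun x => ?_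
  rw [thetaDev, ← integral_const_mul, ofReal_integral_eq_lintegral_ofReal
    ((integrable_gAvg_abs_thetaH_sub γ j₀ _ d θ _).const_mul s)
    (.of_forall fun g => mul_nonneg hspos.le (Finset.sum_nonneg fun σ _ =>
      mul_nonneg (gW_nonneg he _ σ) (abs_nonneg _)))]
  refine lintegral_congr_ae ?_
  filter_upwards [hgood] with g hg
  rw [hg x, hh]
  congr 1
  simp only [gAvg, Finset.mul_sum]
  refine Finset.sum_congr rfl fun σ _ => ?_
  rw [← mul_sub, abs_mul, abs_of_pos hspos]
  ring

/-- Averaged over one perturbation parameter, the relative deviation vanishes as `N → ∞`. -/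
theorem lintegral_relDev_update_le [DecidableEq (Theta κ)] {γ : ℝ}
    (hγ : γ ∈ Set.Ioo (1 / 4 : ℝ) (1 / 2)) {u : Theta κ → ℝ}
    (hu : ∀ θ, |u θ| ≤ 3) (d : stateSizes κ N) (θ : Theta κ) :
    ∫⁻ x in Set.Ioc (1 : ℝ) 2, ENNReal.ofReal (relDev γ j₀ (Function.update u θ x) d θ) ≤
      ENNReal.ofReal ((31 + 3 * √(2 * (1 + 3 ^ 2 * ∑' θ : Theta κ, θ.weight j₀))) /
        θ.weight j₀ ^ 2 * (N : ℝ) ^ (1 / 4 - γ)) := by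
  have hN' : (1 : ℝ) ≤ N := by exact_mod_cast hN
  have hN0 : (0 : ℝ) < N := by linarith
  have hw := θ.weight_pos j₀
  have hw1 := θ.weight_le_one j₀
  have key := lintegral_thetaDev_update_le hj₀ hN hγ hu d θ
  set s := (N : ℝ) ^ γ * θ.weight j₀ with hs
  have hspos : 0 < s := by positivity
  have h1 : ∀ x, ENNReal.ofReal (relDev γ j₀ (Function.update u θ x) d θ) =
      ENNReal.ofReal ((s ^ 2)⁻¹) *
        ENNReal.ofReal (s * thetaDev γ j₀ (Function.update u θ x) d θ) := fun x => by
    rw [← ENNReal.ofReal_mul (by positivity), relDev]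
    congr 1
    field_simp
    rw [hs, mul_assoc]
  simp only [h1]
  rw [lintegral_const_mul' _ _ ENNReal.ofReal_ne_top]
  refine (mul_le_mul_right key _).trans ?_
  rw [← ENNReal.ofReal_mul (by positivity)]
  refine ENNReal.ofReal_le_ofReal ?_
  set L := √(2 * (1 + 3 ^ 2 * ∑' θ : Theta κ, θ.weight j₀)) with hL
  have hB : 0 ≤ ∑' θ : Theta κ, θ.weight j₀ := tsum_nonneg fun θ => (θ.weight_pos j₀).le
  have hsq : √(2 * (1 + 3 ^ 2 * ∑' θ : Theta κ, θ.weight j₀) * N) = L * √N :=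
    Real.sqrt_mul (by positivity) _
  rw [hsq]
  set w := θ.weight j₀ with hwdef
  set y := (N : ℝ) ^ (1 / 4 - γ) with hy
  have hypos : 0 < y := by positivity
  have a1 : (s ^ 2)⁻¹ * (s / 2 + 6 * s ^ 2 / s) = 13 / 2 * s⁻¹ := by field_simp; norm_num
  have a2 : s⁻¹ ≤ y / w ^ 2 := by
    rw [hs, mul_inv, div_eq_mul_inv, ← Real.rpow_neg hN0.le]
    refine mul_le_mul (Real.rpow_le_rpow_of_exponent_le hN' (by linarith)) ?_ (by positivity)
      (by positivity)
    exact inv_anti₀ (by positivity) (by nlinarith)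
  -- The exponents satisfy 1/2 = 2(1/4 - γ) + 2γ.
  have a3 : √(N : ℝ) = y * y * (N ^ γ) ^ 2 := by
    rw [Real.sqrt_eq_rpow, hy, ← Real.rpow_natCast, ← Real.rpow_mul hN0.le,
      ← Real.rpow_add hN0, ← Real.rpow_add hN0]
    congr 1
    push_cast
    ring
  have a4 : (s ^ 2)⁻¹ * (3 * (L * √(N : ℝ)) / y) = 3 * L * (y / w ^ 2) := by
    rw [a3, hs]; field_simp
  have a5 : (s ^ 2)⁻¹ * (4 * y * (6 * s ^ 2)) = 24 * y := by field_simp; norm_num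
  have a6 : y ≤ y / w ^ 2 := by
    rw [le_div_iff₀ (by positivity)]
    exact mul_le_of_le_one_right hypos.le (pow_le_one₀ hw.le hw1)
  calc _ = (s ^ 2)⁻¹ * (s / 2 + 6 * s ^ 2 / s) + ((s ^ 2)⁻¹ * (3 * (L * √(N : ℝ)) / y) +
        (s ^ 2)⁻¹ * (4 * y * (6 * s ^ 2))) := by ring
    _ = 13 / 2 * s⁻¹ + (3 * L * (y / w ^ 2) + 24 * y) := by rw [a1, a4, a5]
    _ ≤ 13 / 2 * (y / w ^ 2) + (3 * L * (y / w ^ 2) + 24 * (y / w ^ 2)) := by gcongr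
    -- The sum 13/2 + 24 is rounded up to 31.
    _ ≤ 31 * (y / w ^ 2) + 3 * L * (y / w ^ 2) := by
      have : 0 ≤ y / w ^ 2 := by positivity
      linarith
    _ = _ := by ring

end OneParameter

/-! ### Random parameters and the existence of admissible sequences. -/

section Choice

variable {κ N : ℕ}

/-- The law of perturbation parameters that are independent and uniform on `(1, 2]`. -/
def paramLaw (κ : ℕ) : Measure (Theta κ → ℝ) :=
  Measure.infinitePi fun _ => volume.restrict (Set.Ioc (1 : ℝ) 2)

instance : IsProbabilityMeasure ((volume : Measure ℝ).restrict (Set.Ioc (1 : ℝ) 2)) :=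
  ⟨by norm_num [Measure.restrict_apply_univ]⟩

instance : IsProbabilityMeasure (paramLaw κ) := by
  unfold paramLaw; infer_instance

theorem ae_paramLaw : ∀ᵐ u ∂paramLaw κ, ∀ θ, u θ ∈ Set.Ioc (1 : ℝ) 2 := by
  refine ae_all_iff.2 fun θ => ?_
  have h : MeasurePreserving (fun u : Theta κ → ℝ => u θ) (paramLaw κ)
    (volume.restrict (Set.Ioc (1 : ℝ) 2)) := measurePreserving_eval_infinitePi _ θ
  exact h.quasiMeasurePreserving.ae (ae_restrict_mem measurableSet_Ioc)

theorem measurable_perturbedH_uncurry (γ : ℝ) (j₀ : RatVec κ → ℕ) (σ : Config κ N) :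
    Measurable fun q : (Theta κ → ℝ) × (DisorderIdx κ N → ℝ) => perturbedH γ j₀ q.1 q.2 σ := by
  simp only [perturbedH_eq, pottsH_eq_sum]
  refine Measurable.add (by fun_prop) (Measurable.const_mul (Measurable.tsum fun θ => ?_) _)
  exact (((measurable_pi_apply θ).comp measurable_fst).const_mul _).mul
    ((measurable_thetaH θ σ).comp measurable_snd)

theorem measurable_thetaMean (γ : ℝ) (j₀ : RatVec κ → ℕ) (d : stateSizes κ N) (θ : Theta κ) :
    Measurable fun u => thetaMean γ j₀ u d θ := by
  unfold thetaMean
  refine (StronglyMeasurable.integral_prod_right (Measurable.stronglyMeasurable ?_)).measurable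
  exact measurable_gAvg _ (measurable_perturbedH_uncurry γ j₀)
    fun σ => (measurable_thetaH θ σ).comp measurable_snd

theorem measurable_relDev (γ : ℝ) (j₀ : RatVec κ → ℕ) (d : stateSizes κ N) (θ : Theta κ) :
    Measurable fun u => relDev γ j₀ u d θ := by
  unfold relDev thetaDev
  refine Measurable.div_const (StronglyMeasurable.integral_prod_right
    (Measurable.stronglyMeasurable ?_)).measurable _
  exact measurable_gAvg _ (measurable_perturbedH_uncurry γ j₀)
    fun σ => (((measurable_thetaH θ σ).comp measurable_snd).sub
      ((measurable_thetaMean γ j₀ d θ).comp measurable_fst)).abs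

theorem relDev_nonneg (γ : ℝ) (j₀ : RatVec κ → ℕ) (u : Theta κ → ℝ) (d : stateSizes κ N)
    (θ : Theta κ) : 0 ≤ relDev γ j₀ u d θ :=
  div_nonneg (thetaDev_nonneg γ j₀ u d θ)
    (mul_nonneg (by positivity) (θ.weight_pos j₀).le)

theorem ggDefect_le_relDev {j₀ : RatVec κ → ℕ} (hj₀ : Function.Injective j₀) (hN : 1 ≤ N) (γ : ℝ)
    {u : Theta κ → ℝ} (hu : ∀ θ, u θ ∈ Set.Icc (1 : ℝ) 2) (d : stateSizes κ N) (θ : Theta κ)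
    {n : ℕ} (hn : 1 ≤ n) {f : (Fin n → Fin n → Mat κ) → ℝ} {K : ℝ} (hf : ∀ x, |f x| ≤ K) :
    ggDefect γ j₀ u d n f θ ≤ K * relDev γ j₀ u d θ := by
  have hK : 0 ≤ K := (abs_nonneg _).trans (hf 0)
  have hN' : (1 : ℝ) ≤ N := by exact_mod_cast hN
  have hn' : (1 : ℝ) ≤ n := by exact_mod_cast hn
  have hw := θ.weight_pos j₀
  have h1 := (hu θ).1
  refine (ggDefect_le hj₀ hN γ (b := 2)
    (fun θ' => abs_le.2 ⟨by linarith [(hu θ').1], (hu θ').2⟩) d θ (by linarith) hn hf).trans ?_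
  rw [relDev, div_mul_eq_mul_div, ← mul_div_assoc]
  refine div_le_div_of_nonneg_left (mul_nonneg hK (thetaDev_nonneg γ j₀ u d θ)) (by positivity) ?_
  calc (N : ℝ) ^ γ * θ.weight j₀ = (N : ℝ) ^ γ * (θ.weight j₀ * 1) * 1 := by ring
    _ ≤ (N : ℝ) ^ γ * (θ.weight j₀ * u θ) * n := by gcongr

/-- There are parameters for which all the relative deviations are small at once. -/
theorem exists_relDev_le {j₀ : RatVec κ → ℕ} (hj₀ : Function.Injective j₀) {γ : ℝ}
    (hγ : γ ∈ Set.Ioo (1 / 4 : ℝ) (1 / 2)) :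
    ∃ c : Theta κ → ℝ, ∀ (N : ℕ), 1 ≤ N → ∀ d : stateSizes κ N,
      ∃ u : Theta κ → ℝ, (∀ θ, u θ ∈ Set.Icc (1 : ℝ) 2) ∧
        ∀ θ, relDev γ j₀ u d θ ≤ c θ * (N : ℝ) ^ (1 / 4 - γ) := by
  classical
  set L : Theta κ → ℝ := fun θ => (31 + 3 * √(2 * (1 + 3 ^ 2 * ∑' θ : Theta κ, θ.weight j₀))) /
    θ.weight j₀ ^ 2
  -- Positive weights, independent of N and d, that make the sum of the constants L θ less than 1.
  -- One weighted sum then controls all θ simultaneously, at the price of a constant depending on θ.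
  obtain ⟨δ, hδ, hsum⟩ := ENNReal.exists_pos_tsum_mul_lt_of_countable one_ne_zero
    (fun θ : Theta κ => ENNReal.ofReal (L θ)) fun _ => ENNReal.ofReal_ne_top
  refine ⟨fun θ => (δ θ : ℝ)⁻¹, fun N hN d => ?_⟩
  have hN' : (1 : ℝ) ≤ N := by exact_mod_cast hN
  set y := (N : ℝ) ^ (1 / 4 - γ) with hy
  have hypos : 0 < y := by positivity
  have hm : ∀ θ, Measurable fun u => ENNReal.ofReal (relDev γ j₀ u d θ) := fun θ =>
    (measurable_relDev γ j₀ d θ).ennreal_ofReal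
  have h1 : ∀ θ, ∫⁻ u, ENNReal.ofReal (relDev γ j₀ u d θ) ∂paramLaw κ ≤
      ENNReal.ofReal (L θ * y) := fun θ => by
    have hp : MeasurePreserving (fun p : (Theta κ → ℝ) × ℝ => Function.update p.1 θ p.2)
        ((paramLaw κ).prod (volume.restrict (Set.Ioc (1 : ℝ) 2))) (paramLaw κ) :=
      measurePreserving_update_infinitePi _ θ
    have hme : Measurable fun p : (Theta κ → ℝ) × ℝ =>
        ENNReal.ofReal (relDev γ j₀ (Function.update p.1 θ p.2) d θ) := (hm θ).comp hp.measurable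
    rw [← hp.lintegral_comp (hm θ), lintegral_prod _ hme.aemeasurable]
    refine (lintegral_mono_ae (g := fun _ => ENNReal.ofReal (L θ * y)) ?_).trans (by simp)
    filter_upwards [ae_paramLaw] with u hu
    exact lintegral_relDev_update_le hj₀ hN hγ
      (fun θ' => abs_le.2 ⟨by linarith [(hu θ').1], by linarith [(hu θ').2]⟩) d θ
  have h2 : ∫⁻ u, ∑' θ, ENNReal.ofReal (relDev γ j₀ u d θ) * δ θ ∂paramLaw κ ≤
      ENNReal.ofReal y := by
    rw [lintegral_tsum fun θ => ((hm θ).mul_const _).aemeasurable]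
    calc _ ≤ ∑' θ, ENNReal.ofReal y * (ENNReal.ofReal (L θ) * δ θ) :=
          ENNReal.tsum_le_tsum fun θ => by
            rw [lintegral_mul_const _ (hm θ), ← mul_assoc, ← ENNReal.ofReal_mul hypos.le,
              mul_comm y]
            exact mul_le_mul_left (h1 θ) _
      _ ≤ ENNReal.ofReal y * 1 := by
        rw [ENNReal.tsum_mul_left]
        exact mul_le_mul_right hsum.le _
      _ = _ := mul_one _
  -- Some u does no worse than the average while avoiding the null set of inadmissible values; each
  -- term of the sum is then bounded by y.
  obtain ⟨u, hu, hle⟩ := exists_notMem_null_le_lintegral (μ := paramLaw κ)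
    (f := fun u => ∑' θ, ENNReal.ofReal (relDev γ j₀ u d θ) * δ θ)
    (Measurable.tsum fun θ => (hm θ).mul_const _).aemeasurable
    (N := {u | ¬ ∀ θ, u θ ∈ Set.Ioc (1 : ℝ) 2}) ae_paramLaw
  have hu' : ∀ θ, u θ ∈ Set.Ioc (1 : ℝ) 2 := by simpa using hu
  refine ⟨u, fun θ => ⟨(hu' θ).1.le, (hu' θ).2⟩, fun θ => ?_⟩
  have h3 := (ENNReal.le_tsum θ).trans (hle.trans h2)
  have hδ' : (0 : ℝ) < δ θ := hδ θ
  rw [← ENNReal.ofReal_coe_nnreal, ← ENNReal.ofReal_mul (relDev_nonneg γ j₀ u d θ),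
    ENNReal.ofReal_le_ofReal_iff hypos.le] at h3
  rw [inv_mul_eq_div, le_div_iff₀ hδ']
  exact h3

theorem exists_admissible {j₀ : RatVec κ → ℕ} (hj₀ : Function.Injective j₀) {γ : ℝ}
    (hγ : γ ∈ Set.Ioo (1 / 4 : ℝ) (1 / 2)) (d : ∀ N, stateSizes κ N) :
    ∃ u : ℕ → Theta κ → ℝ, Admissible γ j₀ d u := by
  obtain ⟨c, hc⟩ := exists_relDev_le (κ := κ) hj₀ hγ
  have h : ∀ N : ℕ, ∃ u : Theta κ → ℝ, (∀ θ, u θ ∈ Set.Icc (1 : ℝ) 2) ∧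
      (1 ≤ N → ∀ θ, relDev γ j₀ u (d N) θ ≤ c θ * (N : ℝ) ^ (1 / 4 - γ)) := fun N => by
    by_cases hN : 1 ≤ N
    · obtain ⟨u, hu, hu'⟩ := hc N hN (d N)
      exact ⟨u, hu, fun _ => hu'⟩
    -- The case N = 0 is irrelevant to the limit, so any parameters do.
    · exact ⟨fun _ => 1, fun _ => by norm_num, fun h => absurd h hN⟩
  choose u hu hu' using h
  refine ⟨u, hu, fun n hn f _ ⟨K, hK⟩ θ => ?_⟩
  have ht : Tendsto (fun N : ℕ => K * (c θ * (N : ℝ) ^ (1 / 4 - γ))) atTop (𝓝 0) := by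
    have h1 := (tendsto_rpow_neg_atTop (y := γ - 1 / 4) (by linarith [hγ.1])).comp
      tendsto_natCast_atTop_atTop
    have h2 := (h1.const_mul (c θ)).const_mul K
    simpa [Function.comp_def] using h2
  refine squeeze_zero' (.of_forall fun N => abs_nonneg _) ?_ ht
  filter_upwards [eventually_ge_atTop 1] with N hN
  exact (ggDefect_le_relDev hj₀ hN γ (hu N) (d N) θ (by omega) hK).trans
    (mul_le_mul_of_nonneg_left (hu' N hN θ) ((abs_nonneg _).trans (hK 0)))

end Choice

/-! ### Measures determined by mixed moments. -/

section Moments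

variable {Y : Type*} [TopologicalSpace Y] [MeasurableSpace Y] [BorelSpace Y] {m : ℕ}

open scoped BoundedContinuousFunction

theorem integrable_mul_of_mem_Icc {μ : Measure (Y × (Fin m → ℝ))} [IsFiniteMeasure μ]
    {a b : Fin m → ℝ} (h : ∀ᵐ p ∂μ, p.2 ∈ Set.Icc a b) (f : Y →ᵇ ℝ) (ψ : C(Fin m → ℝ, ℝ)) :
    Integrable (fun p => f p.1 * ψ p.2) μ := by
  obtain ⟨K, hK⟩ := isCompact_Icc.exists_bound_of_continuousOn (s := Set.Icc a b)
    ψ.continuous.continuousOn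
  refine Integrable.of_bound (C := ‖f‖ * K) ?_ ?_
  · exact ((f.continuous.measurable.comp measurable_fst).mul
      (ψ.continuous.measurable.comp measurable_snd)).aestronglyMeasurable
  · filter_upwards [h] with p hp
    rw [norm_mul]
    exact mul_le_mul (f.norm_coe_le_norm _) (hK _ hp) (norm_nonneg _) (norm_nonneg _)

/-- Two finite measures whose second marginals have bounded supports are equal if the mixed moments
agree. -/
theorem ext_of_integral_mul_prod [HasOuterApproxClosed Y] {μ ν : Measure (Y × (Fin m → ℝ))}
    [IsFiniteMeasure μ] [IsFiniteMeasure ν] {a b : Fin m → ℝ}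
    (hμ : ∀ᵐ p ∂μ, p.2 ∈ Set.Icc a b) (hν : ∀ᵐ p ∂ν, p.2 ∈ Set.Icc a b)
    (h : ∀ (f : Y →ᵇ ℝ) (k : ℕ) (g : Fin k → Fin m),
      ∫ p, f p.1 * ∏ i, p.2 (g i) ∂μ = ∫ p, f p.1 * ∏ i, p.2 (g i) ∂ν) : μ = ν := by
  set X : Fin m → C(Fin m → ℝ, ℝ) := fun j => ⟨fun z => z j, continuous_apply j⟩ with hX
  set A := Algebra.adjoin ℝ (Set.range X) with hA
  have hsep : A.SeparatesPoints := fun x y hxy => by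
    obtain ⟨j, hj⟩ := Function.ne_iff.1 hxy
    exact ⟨X j, ⟨X j, Algebra.subset_adjoin ⟨j, rfl⟩, rfl⟩, hj⟩
  -- The algebra generated by the coordinates is spanned by their monomials, to which the hypothesis
  -- applies; a list of coordinates with repetitions encodes a monomial.
  have hpoly : ∀ q ∈ A, ∀ f : Y →ᵇ ℝ, ∫ p, f p.1 * q p.2 ∂μ = ∫ p, f p.1 * q p.2 ∂ν := by
    intro q hq f
    rw [hA, ← Subalgebra.mem_toSubmodule, Algebra.adjoin_eq_span] at hq
    induction hq using Submodule.span_induction with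
    | mem q hq =>
      obtain ⟨l, hl, rfl⟩ := Submonoid.exists_list_of_mem_closure hq
      have hl' : ∃ g : List (Fin m), g.map X = l := by
        clear hq
        induction l with
        | nil => exact ⟨[], rfl⟩
        | cons x l ih =>
          obtain ⟨g, rfl⟩ := ih fun y hy => hl y (List.mem_cons_of_mem _ hy)
          obtain ⟨j, rfl⟩ := hl x List.mem_cons_self
          exact ⟨j :: g, rfl⟩
      obtain ⟨g, rfl⟩ := hl'
      have h1 : ∀ z, (g.map X).prod z = ∏ i : Fin g.length, z (g.get i) := fun z => by
        have h2 : (g.map X).prod z = (g.map z).prod := by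
          clear hq hl
          induction g with
          | nil => rfl
          | cons j g ih => rw [List.map_cons, List.prod_cons, ContinuousMap.mul_apply, ih,
              List.map_cons, List.prod_cons]; rfl
        rw [h2]
        exact (Fin.prod_univ_fun_getElem g z).symm
      simp only [h1]
      exact h f _ _
    | zero => simp
    | add q q' _ _ h1 h2 =>
      simp only [ContinuousMap.add_apply, mul_add]
      rw [integral_add (integrable_mul_of_mem_Icc hμ f q) (integrable_mul_of_mem_Icc hμ f q'),
        integral_add (integrable_mul_of_mem_Icc hν f q) (integrable_mul_of_mem_Icc hν f q'), h1, h2]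
    | smul c q _ h1 =>
      simp only [ContinuousMap.smul_apply, smul_eq_mul, mul_left_comm _ c]
      rw [integral_const_mul, integral_const_mul, h1]
  have happrox : ∀ (ρ : Measure (Y × (Fin m → ℝ))) [IsFiniteMeasure ρ],
      (∀ᵐ p ∂ρ, p.2 ∈ Set.Icc a b) → ∀ (f : Y →ᵇ ℝ) (ψ q : C(Fin m → ℝ, ℝ)) (ε : ℝ),
      (∀ z ∈ Set.Icc a b, ‖q z - ψ z‖ < ε) →
      |∫ p, f p.1 * q p.2 ∂ρ - ∫ p, f p.1 * ψ p.2 ∂ρ| ≤ ‖f‖ * ε * ρ.real Set.univ := by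
    intro ρ _ hρ f ψ q ε hq
    rw [← integral_sub (integrable_mul_of_mem_Icc hρ f q) (integrable_mul_of_mem_Icc hρ f ψ)]
    have hb : ∀ᵐ p ∂ρ, ‖f p.1 * q p.2 - f p.1 * ψ p.2‖ ≤ ‖f‖ * ε := by
      filter_upwards [hρ] with p hp
      rw [← mul_sub, norm_mul]
      exact mul_le_mul (f.norm_coe_le_norm _) (hq _ hp).le (norm_nonneg _) (norm_nonneg _)
    exact norm_integral_le_of_norm_le_const hb
  refine Measure.ext_of_integral_mul_boundedContinuousFunction fun f ψ => ?_
  refine eq_of_forall_dist_le fun ε hε => ?_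
  -- Stone–Weierstrass approximation within ε/M makes the two errors total at most ε; the summand 1
  -- keeps M positive.
  set M := ‖f‖ * μ.real Set.univ + ‖f‖ * ν.real Set.univ + 1 with hM
  have hMpos : 0 < M := by positivity
  obtain ⟨q, hq, hqε⟩ :=
    ContinuousMap.exists_mem_subalgebra_near_continuous_of_isCompact_of_separatesPoints hsep
    (ψ : C(Fin m → ℝ, ℝ)) (isCompact_Icc (a := a) (b := b)) (div_pos hε hMpos)
  have e1 := happrox μ hμ f ψ q _ hqε
  have e2 := happrox ν hν f ψ q _ hqε
  have e3 := hpoly q hq f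
  simp only [ContinuousMap.coe_coe] at e1 e2
  have e4 : ‖f‖ * (ε / M) * μ.real Set.univ + ‖f‖ * (ε / M) * ν.real Set.univ ≤ ε := by
    calc _ = ε * ((M - 1) / M) := by rw [hM]; ring
      _ ≤ ε * 1 := by
        refine mul_le_mul_of_nonneg_left ((div_le_one hMpos).2 (by linarith)) hε.le
      _ = ε := mul_one ε
  rw [Real.dist_eq]
  rw [e3] at e1
  rw [abs_le] at *
  constructor <;> linarith [e1.1, e1.2, e2.1, e2.2]

end Moments

/-! ### The compact box that contains all overlap arrays. -/

section Box

variable {κ : ℕ}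

theorem overlap_mem_Icc {N : ℕ} (σ τ : Config κ N) : overlap σ τ ∈ Set.Icc (0 : Mat κ) 1 := by
  constructor <;> intro k k'
  · exact mul_nonneg (by positivity) (Finset.sum_nonneg fun i _ => by split_ifs <;> simp)
  · change 1 / (N : ℝ) * ∑ i, (if σ i = k then (1 : ℝ) else 0) * (if τ i = k' then 1 else 0) ≤ 1
    have h : ∑ i, (if σ i = k then (1 : ℝ) else 0) * (if τ i = k' then 1 else 0) ≤ N := by
      refine (Finset.sum_le_card_nsmul _ _ 1 fun i _ => ?_).trans (by simp)
      split_ifs <;> simp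
    rw [one_div, inv_mul_eq_div]
    exact div_le_one_of_le₀ h (by positivity)

theorem overlapArray_mem_Icc {N : ℕ} (s : ℕ → Config κ N) :
    overlapArray s ∈ Set.Icc (0 : OverlapArray κ) 1 :=
  ⟨fun l l' => (overlap_mem_Icc (s l) (s l')).1, fun l l' => (overlap_mem_Icc (s l) (s l')).2⟩

theorem measurable_overlapArray {N : ℕ} :
    Measurable (overlapArray : (ℕ → Config κ N) → OverlapArray κ) := by
  refine measurable_pi_lambda _ fun l => measurable_pi_lambda _ fun l' => ?_
  exact (measurable_of_finite (fun p : Config κ N × Config κ N => overlap p.1 p.2)).comp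
    (by fun_prop : Measurable fun s : ℕ → Config κ N => (s l, s l'))

/-- The projection of arrays onto the arrays with entries in `[0, 1]`. -/
def clipArray (x : OverlapArray κ) : OverlapArray κ :=
  fun l l' k k' => max 0 (min (x l l' k k') 1)

theorem continuous_clipArray : Continuous (clipArray (κ := κ)) := by
  unfold clipArray
  fun_prop

theorem clipArray_mem (x : OverlapArray κ) : clipArray x ∈ Set.Icc (0 : OverlapArray κ) 1 :=
  ⟨fun _ _ _ _ => le_max_left _ _, fun _ _ _ _ => max_le zero_le_one (min_le_right _ _)⟩

theorem clipArray_of_mem {x : OverlapArray κ} (hx : x ∈ Set.Icc (0 : OverlapArray κ) 1) :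
    clipArray x = x := by
  ext l l' k k'
  exact (congrArg (max 0) (min_eq_left (hx.2 l l' k k'))).trans (max_eq_right (hx.1 l l' k k'))

end Box

/-! ### Convergence of expectations along the subsequence. -/

section Limit

open scoped BoundedContinuousFunction

variable {κ : ℕ}

theorem exists_bound_comp_clipArray {F : OverlapArray κ → ℝ} (hF : Continuous F) :
    ∃ K, ∀ x, |F (clipArray x)| ≤ K := by
  obtain ⟨K, hK⟩ := (isCompact_Icc (a := (0 : OverlapArray κ)) (b := 1)).exists_bound_of_continuousOn
    hF.continuousOn
  exact ⟨K, fun x => hK _ (clipArray_mem x)⟩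

theorem integrable_of_ae_mem_Icc {ν : Measure (OverlapArray κ)} [IsFiniteMeasure ν]
    (hν : ∀ᵐ x ∂ν, x ∈ Set.Icc (0 : OverlapArray κ) 1) {F : OverlapArray κ → ℝ}
    (hF : Continuous F) : Integrable F ν := by
  obtain ⟨K, hK⟩ := exists_bound_comp_clipArray hF
  refine Integrable.of_bound (C := K) hF.measurable.aestronglyMeasurable ?_
  filter_upwards [hν] with x hx
  rw [← clipArray_of_mem hx]
  exact hK x

variable {γ : ℝ} {j₀ : RatVec κ → ℕ} {d : ∀ N, stateSizes κ N} {u : ℕ → Theta κ → ℝ}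
  {Nk : ℕ → ℕ} {Ω : Type*} [MeasurableSpace Ω] {P : Measure Ω} [IsProbabilityMeasure P]
  {R : Ω → OverlapArray κ}
  (hR : TendstoInDistribution
    (fun k => (overlapArray : (ℕ → Config κ (Nk k)) → OverlapArray κ))
    atTop R (fun k => replicaLaw γ j₀ (u (Nk k)) (d (Nk k))) P)
include hR

/-- The box is closed and carries every prelimit law, so the portmanteau theorem gives it full mass
in the limit. -/
theorem ae_mem_Icc_of_tendstoInDistribution :
    ∀ᵐ x ∂P.map R, x ∈ Set.Icc (0 : OverlapArray κ) 1 := by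
  have h := ProbabilityMeasure.limsup_measure_closed_le_of_tendsto hR.tendsto
    (isClosed_Icc (a := (0 : OverlapArray κ)) (b := 1))
  have h1 : ∀ k, (replicaLaw γ j₀ (u (Nk k)) (d (Nk k))).map overlapArray
      (Set.Icc (0 : OverlapArray κ) 1) = 1 := fun k => by
    rw [Measure.map_apply measurable_overlapArray isClosed_Icc.measurableSet]
    rw [Set.eq_univ_of_forall (s := overlapArray ⁻¹' Set.Icc (0 : OverlapArray κ) 1)
      fun s => overlapArray_mem_Icc s]
    exact measure_univ
  have := Measure.isProbabilityMeasure_map hR.aemeasurable_limit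
  refine (prob_compl_eq_zero_iff isClosed_Icc.measurableSet).2 (le_antisymm prob_le_one ?_)
  simpa [h1] using h

/-- F need not be bounded: composing it with `clipArray` makes it so and changes none of the
integrals. -/
theorem tendsto_integral_overlapArray {F : OverlapArray κ → ℝ} (hF : Continuous F) :
    Tendsto (fun k => ∫ s, F (overlapArray s) ∂replicaLaw γ j₀ (u (Nk k)) (d (Nk k))) atTop
      (𝓝 (∫ x, F x ∂P.map R)) := by
  obtain ⟨K, hK⟩ := exists_bound_comp_clipArray hF
  have hc : Continuous fun x => F (clipArray x) := hF.comp continuous_clipArray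
  let G : OverlapArray κ →ᵇ ℝ := BoundedContinuousFunction.ofNormedAddCommGroup _ hc K hK
  have h := ProbabilityMeasure.tendsto_iff_forall_integral_tendsto.1 hR.tendsto G
  have e1 : ∫ x, F x ∂P.map R = ∫ x, G x ∂P.map R := by
    refine integral_congr_ae ?_
    filter_upwards [ae_mem_Icc_of_tendstoInDistribution hR] with x hx
    exact congrArg F (clipArray_of_mem hx).symm
  rw [e1]
  refine h.congr fun k => ?_
  refine (integral_map measurable_overlapArray.aemeasurable
    hc.measurable.aestronglyMeasurable).trans ?_
  exact integral_congr_ae (.of_forall fun s => congrArg F (clipArray_of_mem (overlapArray_mem_Icc s)))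

end Limit

/-! ### The limiting identities for products of quadratic forms. -/

section Identity

open scoped BoundedContinuousFunction

variable {κ : ℕ}

theorem continuous_covTheta (θ : Theta κ) : Continuous (covTheta θ) := by
  unfold covTheta hadamardForm; fun_prop

theorem continuous_block (n : ℕ) : Continuous (block (κ := κ) n) := by
  unfold block; fun_prop

/-- The Ghirlanda–Guerra identity for an observable `ψ` of an overlap and a test function `f` of
the overlaps of `n` replicas. -/
def GGIdentity (ν : Measure (OverlapArray κ)) (n : ℕ) (f : (Fin n → Fin n → Mat κ) → ℝ)
    (ψ : Mat κ → ℝ) : Prop :=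
  ∫ x, f (block n x) * ψ (x 0 n) ∂ν =
    1 / (n : ℝ) * (∫ x, f (block n x) ∂ν) * (∫ x, ψ (x 0 1) ∂ν) +
      1 / (n : ℝ) * ∑ l ∈ Finset.Ico 1 n, ∫ x, f (block n x) * ψ (x 0 l) ∂ν

/-- Every expectation in the defect is that of a continuous function of the array, so the defect
converges to that of the limit law, which must be 0. -/
theorem ggIdentity_covTheta {γ : ℝ} {j₀ : RatVec κ → ℕ} {d : ∀ N, stateSizes κ N}
    {u : ℕ → Theta κ → ℝ} (hu : Admissible γ j₀ d u) {Nk : ℕ → ℕ} (hNk : StrictMono Nk)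
    {Ω : Type*} [MeasurableSpace Ω] {P : Measure Ω} [IsProbabilityMeasure P]
    {R : Ω → OverlapArray κ}
    (hR : TendstoInDistribution
      (fun k => (overlapArray : (ℕ → Config κ (Nk k)) → OverlapArray κ))
      atTop R (fun k => replicaLaw γ j₀ (u (Nk k)) (d (Nk k))) P)
    {n : ℕ} (hn : 2 ≤ n) (f : (Fin n → Fin n → Mat κ) →ᵇ ℝ) (θ : Theta κ) :
    GGIdentity (P.map R) n f (covTheta θ) := by
  have h0 : Tendsto (fun k => ggDefect γ j₀ (u (Nk k)) (d (Nk k)) n f θ) atTop (𝓝 0) :=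
    (hu.2 n hn f f.continuous.measurable ⟨‖f‖, fun x => f.norm_coe_le_norm x⟩ θ).comp
      hNk.tendsto_atTop
  have hfc : Continuous fun x : OverlapArray κ => f (block n x) :=
    f.continuous.comp (continuous_block n)
  have hcc : ∀ l, Continuous fun x : OverlapArray κ => covTheta θ (x 0 l) := fun l =>
    (continuous_covTheta θ).comp (by fun_prop)
  have t1 := tendsto_integral_overlapArray hR (hfc.mul (hcc n))
  have t2 := tendsto_integral_overlapArray hR hfc
  have t3 := tendsto_integral_overlapArray hR (hcc 1)
  have t4 := tendsto_finsetSum (Finset.Ico 1 n) fun l _ =>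
    tendsto_integral_overlapArray hR (hfc.mul (hcc l))
  have h1 := ((t1.sub ((t2.const_mul (1 / (n : ℝ))).mul t3)).sub (t4.const_mul (1 / (n : ℝ)))).abs
  have h2 := tendsto_nhds_unique h1 h0
  rw [abs_eq_zero, sub_eq_zero, sub_eq_iff_eq_add'] at h2
  exact h2

/-- This covers the empty monomial, which corresponds to no θ because m ≥ 1 there: the n terms on
the right contribute 1/n each. -/
theorem ggIdentity_const {ν : Measure (OverlapArray κ)} [IsProbabilityMeasure ν] {n : ℕ}
    (hn : 2 ≤ n) (f : (Fin n → Fin n → Mat κ) → ℝ) (c : ℝ) : GGIdentity ν n f fun _ => c := by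
  have hn0 : (n : ℝ) ≠ 0 := by positivity
  simp only [GGIdentity, integral_mul_const, integral_const, probReal_univ, one_smul,
    Finset.sum_const, Nat.card_Ico, nsmul_eq_mul, Nat.cast_sub (by omega : 1 ≤ n), Nat.cast_one]
  field_simp
  ring

/-- The product of quadratic forms of a Hadamard power. -/
def formProd {m : ℕ} (p : ℕ) (lam : Fin m → Fin κ → ℝ) (A : Mat κ) : ℝ :=
  ∏ i, hadamardForm p A (lam i)

/-- Powers of the forms are expressed by repeating vectors in the list, so parameters with all n_j =
1 suffice. -/
theorem ggIdentity_formProd_rat {ν : Measure (OverlapArray κ)} [IsProbabilityMeasure ν] {n : ℕ}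
    (hn : 2 ≤ n) {f : (Fin n → Fin n → Mat κ) → ℝ} (h : ∀ θ, GGIdentity ν n f (covTheta θ))
    {p : ℕ} (hp : 1 ≤ p) {m : ℕ} (lam : Fin m → RatVec κ) :
    GGIdentity ν n f (formProd p fun i k => ((lam i k : ℚ) : ℝ)) := by
  rcases Nat.eq_zero_or_pos m with rfl | hm
  · have : (formProd p fun (i : Fin 0) (k : Fin κ) => ((lam i k : ℚ) : ℝ)) = fun _ => 1 := by
      ext A; simp [formProd]
    rw [this]
    exact ggIdentity_const hn f 1
  · have := h ⟨p, m, fun _ => 1, lam, hp, hm, fun _ => le_rfl⟩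
    have e : (formProd p fun i k => ((lam i k : ℚ) : ℝ)) =
        covTheta ⟨p, m, fun _ => 1, lam, hp, hm, fun _ => le_rfl⟩ := by
      ext A; simp only [formProd, covTheta, pow_one]; rfl
    rwa [e]

theorem abs_hadamardForm_le {p : ℕ} {A : Mat κ} (hA : A ∈ Set.Icc (0 : Mat κ) 1)
    {x : Fin κ → ℝ} (hx : ∀ k, |x k| ≤ 1) : |hadamardForm p A x| ≤ (κ : ℝ) ^ 2 := by
  unfold hadamardForm
  have h : ∀ k k', |A k k' ^ p * x k * x k'| ≤ 1 := fun k k' => by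
    rw [abs_mul, abs_mul, abs_pow]
    refine mul_le_one₀ (mul_le_one₀ (pow_le_one₀ (abs_nonneg _) ?_) (abs_nonneg _) (hx k))
      (abs_nonneg _) (hx k')
    rw [abs_of_nonneg (hA.1 k k')]
    exact hA.2 k k'
  calc _ ≤ ∑ k : Fin κ, ∑ k' : Fin κ, (1 : ℝ) := (Finset.abs_sum_le_sum_abs _ _).trans
        (Finset.sum_le_sum fun k _ => (Finset.abs_sum_le_sum_abs _ _).trans
          (Finset.sum_le_sum fun k' _ => h k k'))
    _ = _ := by simp [sq]

/-- The projection of the real line onto `[-1, 1]`. -/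
def clipUnit (x : ℝ) : ℝ := max (-1) (min x 1)

theorem abs_clipUnit_le (x : ℝ) : |clipUnit x| ≤ 1 :=
  abs_le.2 ⟨le_max_left _ _, max_le (by norm_num) (min_le_right _ _)⟩

theorem clipUnit_of_mem {x : ℝ} (hx : x ∈ Set.Icc (-1 : ℝ) 1) : clipUnit x = x := by
  rw [clipUnit, min_eq_left hx.2, max_eq_right hx.1]

theorem continuous_clipUnit : Continuous clipUnit := by
  unfold clipUnit; fun_prop

/-- Dominated convergence. Clipping the vectors gives a bound valid for all `lam`, so density can be
used on the whole space rather than on the cube. -/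
theorem continuous_integral_formProd {ν : Measure (OverlapArray κ)} [IsProbabilityMeasure ν]
    (hν : ∀ᵐ x ∂ν, x ∈ Set.Icc (0 : OverlapArray κ) 1) {F : OverlapArray κ → ℝ}
    (hF : Continuous F) (p m l : ℕ) :
    Continuous fun lam : Fin m → Fin κ → ℝ =>
      ∫ x, F x * formProd p (fun i k => clipUnit (lam i k)) (x 0 l) ∂ν := by
  have hm : ∀ lam : Fin m → Fin κ → ℝ, Continuous fun x : OverlapArray κ =>
      F x * formProd p (fun i k => clipUnit (lam i k)) (x 0 l) := fun lam => by
    unfold formProd hadamardForm; fun_prop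
  refine continuous_of_dominated (bound := fun x => |F x| * ∏ _i : Fin m, (κ : ℝ) ^ 2)
    (fun lam => (hm lam).measurable.aestronglyMeasurable) (fun lam => ?_)
    ((integrable_of_ae_mem_Icc hν hF).abs.mul_const _) (.of_forall fun x => ?_)
  · filter_upwards [hν] with x hx
    rw [norm_mul]
    refine mul_le_mul_of_nonneg_left ?_ (abs_nonneg _)
    rw [formProd, Real.norm_eq_abs, Finset.abs_prod]
    exact Finset.prod_le_prod (fun _ _ => abs_nonneg _) fun i _ =>
      abs_hadamardForm_le ⟨hx.1 0 l, hx.2 0 l⟩ fun k => abs_clipUnit_le _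
  · have := continuous_clipUnit
    unfold formProd hadamardForm; fun_prop

theorem ggIdentity_formProd {ν : Measure (OverlapArray κ)} [IsProbabilityMeasure ν]
    (hν : ∀ᵐ x ∂ν, x ∈ Set.Icc (0 : OverlapArray κ) 1) {n : ℕ} (hn : 2 ≤ n)
    {f : (Fin n → Fin n → Mat κ) → ℝ} (hf : Continuous f)
    (h : ∀ θ, GGIdentity ν n f (covTheta θ)) {p : ℕ} (hp : 1 ≤ p) {m : ℕ}
    {lam : Fin m → Fin κ → ℝ} (hlam : ∀ i k, lam i k ∈ Set.Icc (-1 : ℝ) 1) :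
    GGIdentity ν n f (formProd p lam) := by
  have hfc : Continuous fun x : OverlapArray κ => f (block n x) :=
    hf.comp (continuous_block n)
  have hc1 := continuous_integral_formProd hν hfc p m
  have hc2 := continuous_integral_formProd hν (continuous_const (y := (1 : ℝ))) p m 1
  simp only [one_mul] at hc2
  have hd : DenseRange fun (q : Fin m → Fin κ → ℚ) i k => ((q i k : ℚ) : ℝ) :=
    DenseRange.piMap fun _ => DenseRange.piMap fun _ => Rat.denseRange_cast
  have key : (fun lam : Fin m → Fin κ → ℝ =>
      ∫ x, f (block n x) * formProd p (fun i k => clipUnit (lam i k)) (x 0 n) ∂ν) =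
      fun lam => 1 / (n : ℝ) * (∫ x, f (block n x) ∂ν) *
        (∫ x, formProd p (fun i k => clipUnit (lam i k)) (x 0 1) ∂ν) +
        1 / (n : ℝ) * ∑ l ∈ Finset.Ico 1 n,
          ∫ x, f (block n x) * formProd p (fun i k => clipUnit (lam i k)) (x 0 l) ∂ν := by
    refine hd.equalizer (hc1 n) ((hc2.const_mul _).add
      ((continuous_finsetSum _ fun l _ => hc1 l).const_mul _)) ?_
    ext q
    -- Clipping keeps a rational vector rational, so the rational case applies at every point of the
    -- dense set.
    have := ggIdentity_formProd_rat hn h hp (fun i k => (⟨max (-1) (min (q i k) 1),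
      le_max_left _ _, max_le (by norm_num) (min_le_right _ _)⟩ : Set.Icc (-1 : ℚ) 1))
    simp only [GGIdentity, Rat.cast_max, Rat.cast_min, Rat.cast_neg, Rat.cast_one] at this
    exact this
  have h1 := congrFun key lam
  simp only [clipUnit_of_mem (hlam _ _)] at h1
  exact h1

end Identity

/-! ### From moments to laws and to all bounded measurable functions. -/

section Mixture

open scoped BoundedContinuousFunction

variable {X Y : Type*} [MeasurableSpace X] [MeasurableSpace Y] {m : ℕ}
  (ν : Measure X) (n : ℕ) (B : X → Y) (Z : ℕ → X → Fin m → ℝ)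

instance (κ n : ℕ) : BorelSpace (Fin n → Fin n → Mat κ) := by
  have h1 : BorelSpace (Fin κ → ℝ) := Pi.borelSpace
  have h2 : BorelSpace (Mat κ) := Pi.borelSpace
  have h3 : BorelSpace (Fin n → Mat κ) := Pi.borelSpace
  exact Pi.borelSpace

/-- The law of the pair `(B, Z n)` according to the Ghirlanda–Guerra identities. -/
def ggMixture : Measure (Y × (Fin m → ℝ)) :=
  (n : NNReal)⁻¹ • (ν.map B).prod (ν.map (Z 1)) +
    ∑ l ∈ Finset.Ico 1 n, (n : NNReal)⁻¹ • ν.map fun x => (B x, Z l x)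

instance [IsProbabilityMeasure ν] : IsFiniteMeasure (ggMixture ν n B Z) := by
  unfold ggMixture
  infer_instance

variable {ν n B Z} (hB : Measurable B) (hZ : ∀ l, Measurable (Z l))
include hB hZ

theorem integral_ggMixture [IsProbabilityMeasure ν] {f : Y → ℝ} {φ : (Fin m → ℝ) → ℝ} (hf : Measurable f)
    (hφ : Measurable φ) (hi : Integrable (fun p : Y × (Fin m → ℝ) => f p.1 * φ p.2)
      (ggMixture ν n B Z)) :
    ∫ p, f p.1 * φ p.2 ∂ggMixture ν n B Z =
      1 / (n : ℝ) * (∫ x, f (B x) ∂ν) * (∫ x, φ (Z 1 x) ∂ν) +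
        1 / (n : ℝ) * ∑ l ∈ Finset.Ico 1 n, ∫ x, f (B x) * φ (Z l x) ∂ν := by
  have hF : Measurable fun p : Y × (Fin m → ℝ) => f p.1 * φ p.2 :=
    (hf.comp measurable_fst).mul (hφ.comp measurable_snd)
  unfold ggMixture at hi ⊢
  have h1 := hi.left_of_add_measure
  have h2 := hi.right_of_add_measure
  rw [integral_add_measure h1 h2, integral_finsetSum_measure (integrable_finsetSum_measure.1 h2),
    integral_smul_nnreal_measure, integral_prod_mul f φ,
    integral_map hB.aemeasurable hf.aestronglyMeasurable,
    integral_map (hZ 1).aemeasurable hφ.aestronglyMeasurable]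
  simp only [integral_smul_nnreal_measure]
  rw [← Finset.smul_sum, mul_assoc]
  have h3 : ∀ l, ∫ p, f p.1 * φ p.2 ∂ν.map (fun x => (B x, Z l x)) =
      ∫ x, f (B x) * φ (Z l x) ∂ν := fun l =>
    integral_map (hB.prodMk (hZ l)).aemeasurable hF.aestronglyMeasurable
  simp only [h3, NNReal.smul_def, NNReal.coe_inv, NNReal.coe_natCast, smul_eq_mul, one_div]

theorem ae_ggMixture {a b : Fin m → ℝ} (h : ∀ l, ∀ᵐ x ∂ν, Z l x ∈ Set.Icc a b) :
    ∀ᵐ p ∂ggMixture ν n B Z, p.2 ∈ Set.Icc a b := by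
  unfold ggMixture
  rw [ae_add_measure_iff, ae_finsetSum_measure_iff]
  refine ⟨Measure.ae_smul_measure ?_ _, fun l _ => Measure.ae_smul_measure ?_ _⟩
  · refine Measure.quasiMeasurePreserving_snd.ae ?_
    exact (ae_map_iff (hZ 1).aemeasurable measurableSet_Icc).2 (h 1)
  · exact (ae_map_iff (hB.prodMk (hZ l)).aemeasurable
      (measurable_snd measurableSet_Icc)).2 (h l)

/-- The Ghirlanda–Guerra identities for polynomials in bounded observables imply those for all
bounded measurable functions of the observables. -/
theorem integral_mul_eq_of_moments [IsProbabilityMeasure ν] [TopologicalSpace Y]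
    [BorelSpace Y] [HasOuterApproxClosed Y] {a b : Fin m → ℝ} (hab : ∀ l, ∀ᵐ x ∂ν, Z l x ∈ Set.Icc a b)
    (h : ∀ (f : Y →ᵇ ℝ) (k : ℕ) (g : Fin k → Fin m), ∫ x, f (B x) * ∏ i, Z n x (g i) ∂ν =
      1 / (n : ℝ) * (∫ x, f (B x) ∂ν) * (∫ x, ∏ i, Z 1 x (g i) ∂ν) +
        1 / (n : ℝ) * ∑ l ∈ Finset.Ico 1 n, ∫ x, f (B x) * ∏ i, Z l x (g i) ∂ν)
    {f : Y → ℝ} (hf : Measurable f) {K : ℝ} (hK : ∀ y, |f y| ≤ K) {φ : (Fin m → ℝ) → ℝ}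
    (hφ : Measurable φ) {L : ℝ} (hL : ∀ z, |φ z| ≤ L) :
    ∫ x, f (B x) * φ (Z n x) ∂ν =
      1 / (n : ℝ) * (∫ x, f (B x) ∂ν) * (∫ x, φ (Z 1 x) ∂ν) +
        1 / (n : ℝ) * ∑ l ∈ Finset.Ico 1 n, ∫ x, f (B x) * φ (Z l x) ∂ν := by
  have hmap : ∀ {f : Y → ℝ} {φ : (Fin m → ℝ) → ℝ}, Measurable f → Measurable φ →
      ∫ p, f p.1 * φ p.2 ∂ν.map (fun x => (B x, Z n x)) = ∫ x, f (B x) * φ (Z n x) ∂ν :=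
    fun hf hφ => integral_map (hB.prodMk (hZ n)).aemeasurable
      ((hf.comp measurable_fst).mul (hφ.comp measurable_snd)).aestronglyMeasurable
  have haemix := ae_ggMixture (n := n) hB hZ hab
  have hprob : IsProbabilityMeasure (ν.map fun x => (B x, Z n x)) :=
    Measure.isProbabilityMeasure_map (hB.prodMk (hZ n)).aemeasurable
  -- The hypothesis is exactly the equality of the mixed moments of these two finite measures. Once
  -- the measures agree, neither f nor φ needs to be continuous.
  have heq : ν.map (fun x => (B x, Z n x)) = ggMixture ν n B Z := by
    refine ext_of_integral_mul_prod (a := a) (b := b) ?_ haemix fun f k g => ?_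
    · exact (ae_map_iff (hB.prodMk (hZ n)).aemeasurable
        (measurable_snd measurableSet_Icc)).2 (hab n)
    · have hgm : Continuous fun z : Fin m → ℝ => ∏ i, z (g i) := by fun_prop
      rw [hmap (φ := fun z => ∏ i, z (g i)) f.continuous.measurable hgm.measurable, h f k g]
      exact (integral_ggMixture (φ := fun z => ∏ i, z (g i)) hB hZ f.continuous.measurable
        hgm.measurable (integrable_mul_of_mem_Icc haemix f ⟨_, hgm⟩)).symm
  rw [← hmap hf hφ, heq]
  refine integral_ggMixture hB hZ hf hφ (Integrable.of_bound (C := K * L)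
    ((hf.comp measurable_fst).mul (hφ.comp measurable_snd)).aestronglyMeasurable
    (.of_forall fun p => ?_))
  rw [norm_mul]
  exact mul_le_mul (hK _) (hL _) (abs_nonneg _) ((abs_nonneg _).trans (hK p.1))

end Mixture

end Potts

end

theorem theorem3 (κ : ℕ) (hκ : 1 ≤ κ) (γ : ℝ) (hγ : γ ∈ Set.Ioo (1 / 4 : ℝ) (1 / 2))
    (j₀ : Potts.RatVec κ → ℕ) (hj₀ : Function.Injective j₀)
    (d : ∀ N, Potts.stateSizes κ N) :
    (∃ u : ℕ → Potts.Theta κ → ℝ, Potts.Admissible γ j₀ d u) ∧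
    ∀ u : ℕ → Potts.Theta κ → ℝ, Potts.Admissible γ j₀ d u →
    ∀ Nk : ℕ → ℕ, StrictMono Nk →
    ∀ (Ω : Type*) [MeasurableSpace Ω] (P : Measure Ω) [IsProbabilityMeasure P]
      (R : Ω → Potts.OverlapArray κ),
    TendstoInDistribution
      (fun k => (Potts.overlapArray : (ℕ → Potts.Config κ (Nk k)) → Potts.OverlapArray κ))
      atTop R (fun k => Potts.replicaLaw γ j₀ (u (Nk k)) (d (Nk k))) P →
    ∀ (p : ℕ), 1 ≤ p → ∀ (m : ℕ), 1 ≤ m →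
    ∀ lam : Fin m → Fin κ → ℝ, (∀ j k, lam j k ∈ Set.Icc (-1 : ℝ) 1) →
    ∀ φ : (Fin m → ℝ) → ℝ, Measurable φ → (∃ K, ∀ y, |φ y| ≤ K) →
    ∀ (n : ℕ), 2 ≤ n →
    ∀ f : (Fin n → Fin n → Potts.Mat κ) → ℝ, Measurable f → (∃ K, ∀ x, |f x| ≤ K) →
    let Q : ℕ → ℕ → Ω → ℝ := fun l l' ω => φ fun j => Potts.hadamardForm p (R ω l l') (lam j)
    (∫ ω, f (Potts.block n (R ω)) * Q 0 n ω ∂P) =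
      1 / (n : ℝ) * (∫ ω, f (Potts.block n (R ω)) ∂P) * (∫ ω, Q 0 1 ω ∂P)
        + 1 / (n : ℝ) * ∑ l ∈ Finset.Ico 1 n, ∫ ω, f (Potts.block n (R ω)) * Q 0 l ω ∂P := by
  refine ⟨Potts.exists_admissible hj₀ hγ d, ?_⟩
  intro u hu Nk hNk Ω _ P _ R hR p hp m _ lam hlam φ hφ ⟨L, hL⟩ n hn f hf ⟨K, hK⟩
  have hRm := hR.aemeasurable_limit
  have := Measure.isProbabilityMeasure_map hRm
  have hν := Potts.ae_mem_Icc_of_tendstoInDistribution hR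
  have hBm : Measurable (Potts.block (κ := κ) n) := (Potts.continuous_block n).measurable
  let Z : ℕ → Potts.OverlapArray κ → Fin m → ℝ :=
    fun l x j => Potts.hadamardForm p (x 0 l) (lam j)
  have hZm : ∀ l, Measurable (Z l) := fun l => by
    refine Continuous.measurable ?_
    simp only [Z, Potts.hadamardForm]
    fun_prop
  -- On the box each of the κ² terms of a form is at most 1 in absolute value, which gives the
  -- bounds ±κ².
  have key := Potts.integral_mul_eq_of_moments (ν := P.map R) (n := n) (B := Potts.block n) (Z := Z)
    hBm hZm (a := fun _ => -(κ : ℝ) ^ 2) (b := fun _ => (κ : ℝ) ^ 2) (fun l => by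
      filter_upwards [hν] with x hx
      have h : ∀ j, |Z l x j| ≤ (κ : ℝ) ^ 2 := fun j =>
        Potts.abs_hadamardForm_le ⟨hx.1 0 l, hx.2 0 l⟩ fun k => abs_le.2 (hlam j k)
      exact ⟨fun j => (abs_le.1 (h j)).1, fun j => (abs_le.1 (h j)).2⟩)
    -- The monomial with index map g is the product of the forms of the vectors `lam (g i)`,
    -- repetitions included.
    (fun f' k g => Potts.ggIdentity_formProd hν hn f'.continuous
      (Potts.ggIdentity_covTheta hu hNk hR hn f') hp (lam := fun i => lam (g i))
      fun i k => hlam (g i) k)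
    hf hK hφ hL
  intro Q
  have e1 : ∫ x, f (Potts.block n x) ∂P.map R = ∫ ω, f (Potts.block n (R ω)) ∂P :=
    integral_map hRm (hf.comp hBm).aestronglyMeasurable
  have e2 : ∀ l, ∫ x, φ (Z l x) ∂P.map R = ∫ ω, Q 0 l ω ∂P := fun l =>
    integral_map hRm (hφ.comp (hZm l)).aestronglyMeasurable
  have e3 : ∀ l, ∫ x, f (Potts.block n x) * φ (Z l x) ∂P.map R =
      ∫ ω, f (Potts.block n (R ω)) * Q 0 l ω ∂P := fun l =>
    integral_map hRm ((hf.comp hBm).mul (hφ.comp (hZm l))).aestronglyMeasurable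
  simp only [e1, e2, e3] at key
  exact key
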